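/- Graphs are finite undirected multigraphs (loops and parallel edges allowed). An embedding of a graph $G$ into the torus $T^2=\mathbb R/\mathbb Z\times\mathbb R/\mathbb Z$ maps distinct vertices to distinct points and each edge to a continuous curve joining the images of its ends, such that each curve is injective on its interior, no curve interior contains the image of a vertex, and the interiors of the curves of distinct edges are disjoint. A graph is \emph{toroidal} if it has such an embedding. For a graph $G$, a graph of the form $G\cup e$ is obtained from $G$ in one of three ways: (i) subdivide an edge of $G$ once by a new vertex $u$, and add a new vertex $v$, an edge $uv$ and a loop at $v$; (ii) subdivide an edge of $G$ twice by new vertices $u$ and $v$, and add an edge $uv$ (parallel to the segment between them); (iii) subdivide two distinct edges $a,b$ of $G$ once each, by new vertices $u$ and $v$ respectively, and add an edge $uv$; this last graph is written $G\cup(a\text{–}b)$. If $G$ is cubic, so is $G\cup e$. Let $G_1$ be the cubic graph with vertices $A,B,C,A',B',C',1,2,3,4$ and edges $AA',BB',CC'$, $A1,A2,B1,B2,C1,C2$, $A'3,A'4,B'3,B'4,C'3,C'4$. In $G_1\cup(a\text{–}b)$ let $x$ and $y$ denote the vertices subdividing $a$ and $b$, respectively, and put $$\begin{aligned} H_4&=G_1\cup(AA'\text{–}BB')\cup(Ax\text{–}CC'),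 & H_5&=G_1\cup(AA'\text{–}BB')\cup(A1\text{–}B2),\\ H_6&=G_1\cup(A1\text{–}B2)\cup(Ax\text{–}By), & H_7&=G_1\cup(A1\text{–}B2)\cup(Ax\text{–}B1),\\ H_8&=G_1\cup(A1\text{–}B2)\cup(A2\text{–}B1), & H_9&=G_1\cup(AA'\text{–}BB')\cup(xy\text{–}CC'). \end{aligned}$$ Let $G_1\cup e_1$ be any graph obtained from $G_1$ by adding an edge in one of the ways (i)–(iii), and let $G_1\cup e_1\cup e_2$ be any graph obtained from $G_1\cup e_1$ by adding an edge in one of these ways. If $G_1\cup e_1\cup e_2$ is not isomorphic to any of $H_4,H_5,H_6,H_7,H_8,H_9$, then it is toroidal. -/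

import Mathlib

namespace CubicTorus

open scoped Graph

universe u v w z

/-! Graphs are Mathlib's multigraphs `Graph α β`: loops and parallel edges are allowed,
since adding an edge to a simple graph can create them. -/

/-- The multigraph on all of `α` whose edges are all of `β`, the edge `e` having
the (unordered) pair of ends `ends e`. -/
def ofEnds {α : Type u} {β : Type v} (ends : β → Sym2 α) : Graph α β where
  vertexSet := Set.univ
  IsLink e x y := ends e = s(x, y)
  isLink_symm := fun _ _ => ⟨fun _ _ h => h.trans Sym2.eq_swap⟩
  eq_or_eq_of_isLink_of_isLink := by
    intro e x y v w h h'
    rcases Sym2.eq_iff.1 (h.symm.trans h') with h | h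
    · exact Or.inl h.1
    · exact Or.inr h.1
  left_mem_of_isLink := fun _ _ _ _ => Set.mem_univ _

/-- Isomorphism of multigraphs. -/
def Isomorphic {α : Type u} {β : Type v} {γ : Type w} {δ : Type z}
    (G : Graph α β) (H : Graph γ δ) : Prop :=
  ∃ (φ : V(G) ≃ V(H)) (ψ : E(G) ≃ E(H)),
    ∀ (e : E(G)) (x y : V(G)), G.IsLink e x y ↔ H.IsLink (ψ e) (φ x) (φ y)

/-- `K` arises from `G` by subdividing the edge `e` once, with new vertex `u`:
if `e` joins `x` and `y`, then in `K` the edge `e` joins `x` and `u`, and a new edge `e'`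
joins `u` and `y`. (Either end of `e` may play the role of `x`.) -/
def IsSubdivision {α : Type u} {β : Type v} (G K : Graph α β) (e : β) (u : α) : Prop :=
  ∃ (x y : α) (e' : β), G.IsLink e x y ∧ u ∉ V(G) ∧ e' ∉ E(G) ∧
    V(K) = insert u V(G) ∧
    ∀ (f : β) (a b : α), K.IsLink f a b ↔
      (f ≠ e ∧ G.IsLink f a b) ∨ (f = e ∧ s(a, b) = s(x, u)) ∨ (f = e' ∧ s(a, b) = s(u, y))

/-- `K` arises from `G` by adding one new edge `e` with ends `u` and `v`
(together with its ends, if they are not yet vertices). -/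
def IsJoin {α : Type u} {β : Type v} (G K : Graph α β) (e : β) (u v : α) : Prop :=
  e ∉ E(G) ∧ V(K) = insert u (insert v V(G)) ∧
    ∀ (f : β) (a b : α), K.IsLink f a b ↔ G.IsLink f a b ∨ (f = e ∧ s(a, b) = s(u, v))

/-- `IsAddEdge G K`: the graph `K` is of the form `G ∪ e`, in one of three ways. -/
inductive IsAddEdge {α : Type u} {β : Type v} (G K : Graph α β) : Prop
  /-- Subdivide an edge `e₁` once by `u`, add a new vertex `v`, the edge `uv` and the loop `vv`. -/
  | pendantLoop (e₁ f l : β) (u v : α) (S T : Graph α β) (hS : IsSubdivision G S e₁ u)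
      (hv : v ∉ V(S)) (hT : IsJoin S T f u v) (hK : IsJoin T K l v v) : IsAddEdge G K
  /-- Subdivide an edge `e₁` twice, by `u` and by `v`, and add the edge `uv`. -/
  | sameEdge (e₁ f : β) (u v : α) (S T : Graph α β) (hS : IsSubdivision G S e₁ u)
      (hT : IsSubdivision S T e₁ v) (hK : IsJoin T K f u v) : IsAddEdge G K
  /-- Subdivide two distinct edges `e₁`, `e₂` of `G` once each, by `u` and by `v`, and add the
  edge `uv`. -/
  | twoEdges (e₁ e₂ f : β) (u v : α) (S T : Graph α β) (he₁ : e₁ ∈ E(G)) (he₂ : e₂ ∈ E(G))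
      (hne : e₁ ≠ e₂) (hS : IsSubdivision G S e₁ u) (hT : IsSubdivision S T e₂ v)
      (hK : IsJoin T K f u v) : IsAddEdge G K

/-- An embedding of the multigraph `G` into a topological space `X`: distinct vertices go to
distinct points, and every edge goes to a continuous curve between the images of its ends which
is simple (closed, if the edge is a loop), whose interior contains no image of a vertex and
does not meet the interior of the curve of any other edge. -/
structure Embedding {α : Type u} {β : Type v} (G : Graph α β) (X : Type w)
    [TopologicalSpace X] where
  vert : V(G) → X
  curve : E(G) → C(unitInterval, X)
  vert_injective : Function.Injective vert
  curve_ends : ∀ (e : E(G)) (x y : V(G)), G.IsLink e x y →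
    s(curve e 0, curve e 1) = s(vert x, vert y)
  curve_injOn : ∀ e : E(G), Set.InjOn (curve e) (Set.Ioo 0 1)
  curve_ne_vert : ∀ (e : E(G)), ∀ t ∈ Set.Ioo (0 : unitInterval) 1, ∀ x : V(G),
    curve e t ≠ vert x
  curve_ne_curve : ∀ e f : E(G), e ≠ f → ∀ s ∈ Set.Ioo (0 : unitInterval) 1,
    ∀ t ∈ Set.Ioo (0 : unitInterval) 1, curve e s ≠ curve f t

/-- A graph is toroidal if it embeds into the torus `ℝ/ℤ × ℝ/ℤ`. -/
def Toroidal {α : Type u} {β : Type v} (G : Graph α β) : Prop :=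
  Nonempty (Embedding G (UnitAddCircle × UnitAddCircle))

/-! In the explicit graphs below the vertices are numbered
`A = 0, B = 1, C = 2, A' = 3, B' = 4, C' = 5`, then the vertices called `1, 2, 3, 4` are
`6, 7, 8, 9`; the vertices created by the first added edge are `x = 10, y = 11`, those created by
the second one are `12, 13`. The notation `(a–b)` is the edge added between edges `a` and `b`. -/

/-- The graph `G₁`: two disjoint copies of `K_{2,3}`, with parts `{1, 2}`, `{A, B, C}` and
`{3, 4}`, `{A', B', C'}`, joined by the three edges `AA'`, `BB'`, `CC'`. -/
def G1 : Graph (Fin 10) (Fin 15) :=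
  ofEnds
    ![s(0, 3), s(1, 4), s(2, 5),
     s(0, 6), s(0, 7), s(1, 6), s(1, 7), s(2, 6), s(2, 7),
     s(3, 8), s(3, 9), s(4, 8), s(4, 9), s(5, 8), s(5, 9)]

/-- `G₁ ∪ (AA'–BB') ∪ (Ax–CC')`, where `x` subdivides `AA'` and `y` subdivides `BB'`. -/
def H4 : Graph (Fin 14) (Fin 21) :=
  ofEnds
    ![s(0, 12), s(1, 11), s(2, 13), s(0, 6), s(0, 7), s(1, 6), s(1, 7),
     s(2, 6), s(2, 7), s(3, 8), s(3, 9), s(4, 8), s(4, 9), s(5, 8),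
     s(5, 9), s(10, 3), s(11, 4), s(10, 11), s(12, 10), s(13, 5), s(12, 13)]

/-- `G₁ ∪ (AA'–BB') ∪ (A1–B2)`, where `x` subdivides `AA'` and `y` subdivides `BB'`. -/
def H5 : Graph (Fin 14) (Fin 21) :=
  ofEnds
    ![s(0, 10), s(1, 11), s(2, 5), s(0, 12), s(0, 7), s(1, 6), s(1, 13),
     s(2, 6), s(2, 7), s(3, 8), s(3, 9), s(4, 8), s(4, 9), s(5, 8),
     s(5, 9), s(10, 3), s(11, 4), s(10, 11), s(12, 6), s(13, 7), s(12, 13)]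

/-- `G₁ ∪ (A1–B2) ∪ (Ax–By)`, where `x` subdivides `A1` and `y` subdivides `B2`. -/
def H6 : Graph (Fin 14) (Fin 21) :=
  ofEnds
    ![s(0, 3), s(1, 4), s(2, 5), s(0, 12), s(0, 7), s(1, 6), s(1, 13),
     s(2, 6), s(2, 7), s(3, 8), s(3, 9), s(4, 8), s(4, 9), s(5, 8),
     s(5, 9), s(10, 6), s(11, 7), s(10, 11), s(12, 10), s(13, 11), s(12, 13)]

/-- `G₁ ∪ (A1–B2) ∪ (Ax–B1)`, where `x` subdivides `A1` and `y` subdivides `B2`. -/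
def H7 : Graph (Fin 14) (Fin 21) :=
  ofEnds
    ![s(0, 3), s(1, 4), s(2, 5), s(0, 12), s(0, 7), s(1, 13), s(1, 11),
     s(2, 6), s(2, 7), s(3, 8), s(3, 9), s(4, 8), s(4, 9), s(5, 8),
     s(5, 9), s(10, 6), s(11, 7), s(10, 11), s(12, 10), s(13, 6), s(12, 13)]

/-- `G₁ ∪ (A1–B2) ∪ (A2–B1)`, where `x` subdivides `A1` and `y` subdivides `B2`. -/
def H8 : Graph (Fin 14) (Fin 21) :=
  ofEnds
    ![s(0, 3), s(1, 4), s(2, 5), s(0, 10), s(0, 12), s(1, 13), s(1, 11),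
     s(2, 6), s(2, 7), s(3, 8), s(3, 9), s(4, 8), s(4, 9), s(5, 8),
     s(5, 9), s(10, 6), s(11, 7), s(10, 11), s(12, 7), s(13, 6), s(12, 13)]

/-- `G₁ ∪ (AA'–BB') ∪ (xy–CC')`, where `x` subdivides `AA'` and `y` subdivides `BB'`. -/
def H9 : Graph (Fin 14) (Fin 21) :=
  ofEnds
    ![s(0, 10), s(1, 11), s(2, 13), s(0, 6), s(0, 7), s(1, 6), s(1, 7),
     s(2, 6), s(2, 7), s(3, 8), s(3, 9), s(4, 8), s(4, 9), s(5, 8),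
     s(5, 9), s(10, 3), s(11, 4), s(10, 12), s(12, 11), s(13, 5), s(12, 13)]

end CubicTorus

/-! The proof separates a small amount of topology from a finite computation. A drawing on the torus
is recorded by a `Mesh`: numbered vertices, arcs between them, and for each cell the vertices met
along its boundary, in order. A cell is the image of an open rectangle, with the listed vertices on
one side of the closed rectangle, so no theorem on planar curves is needed. A single move suffices:
two vertices on one cell can be joined by a chord, which divides the cell into two cells with
explicit boundary lists (`IsCell.split`, `Mesh.Realizable.chord`). The starting point is a
subdivided theta graph whose complement in the torus is one hexagon (`theta_realizable`).

The graph `G1` has a spanning theta subgraph, and its four other edges are drawn as chords of the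
hexagon (`realizable_meshG1`). Every edge carries auxiliary vertices, so subdividing an edge means
promoting one of them to a vertex of the graph. A second edge can therefore be added to a drawing as
soon as the two edges to be joined have distinct auxiliary vertices on a common cell
(`Mesh.Cofacial`). A pendant loop fits into any cell touching the edge that carries it.

Up to automorphisms of `G1`, the first addition is one of two pendant loops or one of ten joins. An
`Atlas` for such a graph holds several torus drawings of it, all obtained from the one drawing of
`G1` by relabelling along automorphisms and adding an edge inside a face. For each pair of edges of
the enlarged graph, either some drawing in the atlas has the two edges on a common cell, and the
second addition is toroidal, or the atlas gives an explicit isomorphism of the result with one of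
the six graphs `H4`, …, `H9` (`Atlas.Complete.toroidal_or_isomorphic`). An edge paired with itself
always falls under the first alternative, which also settles pendant loops and double subdivisions.
The tables are verified by evaluation in `chordData_covers`, `chordData_correct` and
`loopData_covers`, the reduction to representatives in `exists_loopData` and `exists_chordData`.
Nothing has to be proved about the excluded graphs themselves. -/

namespace CubicTorus

open Set unitInterval

/-! ### Open arcs, cells, and the profile of a chord. -/

section Topology

variable {X : Type*} [TopologicalSpace X]

/-- `S` is the interior of a curve from `p` to `q` which is injective on its interior. -/
def OpenArc (S : Set X) (p q : X) : Prop :=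
  ∃ γ : C(unitInterval, X), γ 0 = p ∧ γ 1 = q ∧ InjOn γ (Ioo 0 1) ∧ γ '' Ioo 0 1 = S

theorem OpenArc.of_real {Γ : ℝ → X} (hΓ : Continuous Γ) {a b : ℝ} (hab : a < b)
    (hinj : InjOn Γ (Ioo a b)) : OpenArc (Γ '' Ioo a b) (Γ a) (Γ b) := by
  have hpos : 0 < b - a := sub_pos.2 hab
  refine ⟨⟨fun t => Γ (a + t * (b - a)), by fun_prop⟩, by simp, by simp, ?_, ?_⟩
  · intro s hs t ht hst
    have h := hinj (x₁ := a + s * (b - a)) (x₂ := a + t * (b - a)) ?_ ?_ hst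
    · exact Subtype.ext (mul_right_cancel₀ hpos.ne' (add_left_cancel h))
    · have h0 : (0 : ℝ) < s := hs.1
      have h1 : (s : ℝ) < 1 := hs.2
      constructor <;> nlinarith
    · have h0 : (0 : ℝ) < t := ht.1
      have h1 : (t : ℝ) < 1 := ht.2
      constructor <;> nlinarith
  · ext x
    constructor
    · rintro ⟨t, ht, rfl⟩
      have h0 : (0 : ℝ) < t := ht.1
      have h1 : (t : ℝ) < 1 := ht.2
      exact ⟨a + t * (b - a), ⟨by nlinarith, by nlinarith⟩, rfl⟩
    · rintro ⟨s, hs, rfl⟩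
      have h0 : 0 < (s - a) / (b - a) := div_pos (sub_pos.2 hs.1) hpos
      have h1 : (s - a) / (b - a) < 1 := by rw [div_lt_one hpos]; linarith [hs.2]
      refine ⟨⟨(s - a) / (b - a), h0.le, h1.le⟩, ⟨h0, h1⟩, ?_⟩
      change Γ (a + (s - a) / (b - a) * (b - a)) = Γ s
      rw [div_mul_cancel₀ _ hpos.ne']
      congr 1
      ring

theorem OpenArc.exists_real {S : Set X} {p q : X} (h : OpenArc S p q) :
    ∃ Γ : ℝ → X, Continuous Γ ∧ Γ 0 = p ∧ Γ 1 = q ∧ InjOn Γ (Ioo 0 1) ∧ Γ '' Ioo 0 1 = S := by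
  obtain ⟨γ, h0, h1, hinj, rfl⟩ := h
  have key : ∀ t (ht : t ∈ Icc (0 : ℝ) 1), IccExtend zero_le_one γ t = γ ⟨t, ht⟩ :=
    fun t ht => IccExtend_of_mem _ _ ht
  refine ⟨IccExtend zero_le_one γ, γ.continuous.Icc_extend', ?_, ?_, ?_, ?_⟩
  · rw [key 0 (by simp)]; exact h0
  · rw [key 1 (by simp)]; exact h1
  · intro s hs t ht hst
    rw [key s (Ioo_subset_Icc_self hs), key t (Ioo_subset_Icc_self ht)] at hst
    exact congrArg Subtype.val (hinj (x₁ := ⟨s, _⟩) (x₂ := ⟨t, _⟩) hs ht hst)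
  · ext x
    constructor
    · rintro ⟨t, ht, rfl⟩
      exact ⟨⟨t, Ioo_subset_Icc_self ht⟩, ht, (key t _).symm⟩
    · rintro ⟨t, ht, rfl⟩
      exact ⟨t, ht, key t t.2⟩

theorem OpenArc.symm {S : Set X} {p q : X} (h : OpenArc S p q) : OpenArc S q p := by
  obtain ⟨Γ, hΓ, rfl, rfl, hinj, rfl⟩ := h.exists_real
  have h2 := OpenArc.of_real (Γ := fun t => Γ (1 - t)) (by fun_prop) zero_lt_one
    (fun s hs t ht hst => by
      have := hinj (x₁ := 1 - s) (x₂ := 1 - t) ⟨by linarith [hs.2], by linarith [hs.1]⟩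
        ⟨by linarith [ht.2], by linarith [ht.1]⟩ hst
      linarith)
  have himg : (fun t => Γ (1 - t)) '' Ioo 0 1 = Γ '' Ioo 0 1 := by
    rw [← Function.comp_def Γ, image_comp]
    simp
  simpa [himg] using h2

/-- The two curves are run one after the other over `[0, 2]`. The outer ends `p` and `r` may
coincide, which is what later allows loops. -/
theorem OpenArc.trans {S T : Set X} {p q r : X} (h₁ : OpenArc S p q) (h₂ : OpenArc T q r)
    (hST : Disjoint S T) (hS : q ∉ S) (hT : q ∉ T) : OpenArc (S ∪ ({q} ∪ T)) p r := by
  obtain ⟨Γ, hΓ, rfl, hq, hinj, rfl⟩ := h₁.exists_real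
  obtain ⟨Δ, hΔ, rfl, rfl, hinj', rfl⟩ := h₂.exists_real
  let Λ : ℝ → X := fun t => if t ≤ 1 then Γ t else Δ (t - 1)
  have hΛ : Continuous Λ := by
    refine Continuous.if_le hΓ (by fun_prop) continuous_id continuous_const ?_
    rintro t rfl
    simpa using hq
  have e1 : ∀ t, t ≤ 1 → Λ t = Γ t := fun t ht => if_pos ht
  have e2 : ∀ t, 1 < t → Λ t = Δ (t - 1) := fun t ht => if_neg (not_le.2 ht)
  have hmem : ∀ t ∈ Ioo (0 : ℝ) 2, (t < 1 ∧ Λ t ∈ Γ '' Ioo 0 1) ∨ (t = 1 ∧ Λ t = Δ 0) ∨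
      (1 < t ∧ Λ t ∈ Δ '' Ioo 0 1) := by
    intro t ht
    rcases lt_trichotomy t 1 with h | rfl | h
    · exact Or.inl ⟨h, t, ⟨ht.1, h⟩, (e1 t h.le).symm⟩
    · exact Or.inr (Or.inl ⟨rfl, (e1 1 le_rfl).trans hq⟩)
    · exact Or.inr (Or.inr ⟨h, t - 1, ⟨by linarith, by linarith [ht.2]⟩, (e2 t h).symm⟩)
  have hdis := Set.disjoint_left.1 hST
  have hΛinj : InjOn Λ (Ioo 0 2) := by
    intro s hs t ht hst
    rcases hmem s hs with ⟨h, h'⟩ | ⟨h, h'⟩ | ⟨h, h'⟩ <;>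
    rcases hmem t ht with ⟨k, k'⟩ | ⟨k, k'⟩ | ⟨k, k'⟩
    · rw [e1 s h.le, e1 t k.le] at hst
      exact hinj ⟨hs.1, h⟩ ⟨ht.1, k⟩ hst
    · exact absurd (by rwa [hst, k'] at h') hS
    · exact absurd (hst ▸ k') (hdis h')
    · exact absurd (by rwa [← hst, h'] at k') hS
    · rw [h, k]
    · exact absurd (by rwa [← hst, h'] at k') hT
    · exact absurd (hst ▸ h') (hdis k')
    · exact absurd (by rwa [hst, k'] at h') hT
    · rw [e2 s h, e2 t k] at hst
      have := hinj' ⟨by linarith, by linarith [hs.2]⟩ ⟨by linarith, by linarith [ht.2]⟩ hst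
      linarith
  have := OpenArc.of_real hΛ zero_lt_two hΛinj
  have himg : Λ '' Ioo 0 2 = Γ '' Ioo 0 1 ∪ ({Δ 0} ∪ Δ '' Ioo 0 1) := by
    ext x
    constructor
    · rintro ⟨t, ht, rfl⟩
      rcases hmem t ht with ⟨-, h⟩ | ⟨-, h⟩ | ⟨-, h⟩
      · exact Or.inl h
      · exact Or.inr (Or.inl h)
      · exact Or.inr (Or.inr h)
    · rintro (⟨t, ht, rfl⟩ | rfl | ⟨t, ht, rfl⟩)
      · exact ⟨t, ⟨ht.1, by linarith [ht.2]⟩, e1 t ht.2.le⟩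
      · exact ⟨1, by norm_num, (e1 1 le_rfl).trans hq⟩
      · refine ⟨t + 1, ⟨by linarith [ht.1], by linarith [ht.2]⟩, ?_⟩
        rw [e2 _ (by linarith [ht.1])]
        simp
  rw [himg, e1 0 zero_le_one, e2 2 one_lt_two] at this
  norm_num at this
  simpa using this

/-- `pts` are the images, in this order, of points on one side of a closed rectangle under a
continuous map which is injective on the open rectangle and maps it into `U`. -/
def IsCell (U : Set X) (pts : List X) : Prop :=
  ∃ (φ : ℝ × ℝ → X) (a b : ℝ) (xs : List ℝ), Continuous φ ∧ InjOn φ (Ioo a b ×ˢ Ioo 0 1) ∧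
    MapsTo φ (Ioo a b ×ˢ Ioo 0 1) U ∧ xs.Pairwise (· < ·) ∧ (∀ x ∈ xs, x ∈ Icc a b) ∧
    xs.map (fun x => φ (x, 0)) = pts

theorem IsCell.mono {U V : Set X} {pts : List X} (h : IsCell U pts) (hUV : U ⊆ V) :
    IsCell V pts := by
  obtain ⟨φ, a, b, xs, h1, h2, h3, h4⟩ := h
  exact ⟨φ, a, b, xs, h1, h2, h3.mono_right hUV, h4⟩

/-- The height of the chord over the interval `[x, y]`. -/
noncomputable def tent (x y z : ℝ) : ℝ := max 0 (min (z - x) (y - z)) / (y - x)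

theorem continuous_tent (x y : ℝ) : Continuous (tent x y) := by
  unfold tent; fun_prop

theorem tent_nonneg {x y : ℝ} (h : x < y) (z : ℝ) : 0 ≤ tent x y z :=
  div_nonneg (le_max_left _ _) (sub_pos.2 h).le

theorem tent_lt_one {x y : ℝ} (h : x < y) (z : ℝ) : tent x y z < 1 := by
  unfold tent
  rw [div_lt_one (sub_pos.2 h), max_lt_iff, min_lt_iff]
  refine ⟨sub_pos.2 h, ?_⟩
  by_contra! hc
  linarith [hc.1, hc.2]

theorem tent_pos {x y z : ℝ} (hx : x < z) (hy : z < y) : 0 < tent x y z := by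
  unfold tent
  apply div_pos _ (by linarith)
  rw [lt_max_iff, lt_min_iff]
  right
  constructor <;> linarith

theorem tent_left {x y z : ℝ} (hz : z ≤ x) : tent x y z = 0 := by
  unfold tent
  rw [max_eq_left, zero_div]
  exact (min_le_left _ _).trans (by linarith)

theorem tent_right {x y z : ℝ} (hz : y ≤ z) : tent x y z = 0 := by
  unfold tent
  rw [max_eq_left, zero_div]
  exact (min_le_right _ _).trans (by linarith)

/-- Up to its midpoint the chord rises with slope `1 / (y - x)`, so the relative abscissa is also
the height. The new vertices on a chord are all placed on this rising half. -/
theorem tent_slope {x y t : ℝ} (h : x < y) (h0 : 0 ≤ t) (h1 : t ≤ 1 / 2) :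
    tent x y (x + t * (y - x)) = t := by
  have hpos := sub_pos.2 h
  unfold tent
  rw [min_eq_left (by nlinarith), max_eq_right (by nlinarith)]
  field_simp
  ring

/-- This is the region under the chord in the oblique coordinates of `lensMap`, where a point has
abscissa `x + u + v` and height `v / (y - x)`. -/
theorem lt_tent {x y u v : ℝ} (h : x < y) (hu : 0 < u) (huv : u + 2 * v < y - x) :
    v / (y - x) < tent x y (x + u + v) := by
  have hpos := sub_pos.2 h
  unfold tent
  rw [div_lt_div_iff_of_pos_right hpos, lt_max_iff, lt_min_iff]
  right
  constructor <;> linarith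

end Topology

end CubicTorus

/-! ### Cutting a cell along a chord. -/

namespace CubicTorus

open Set unitInterval

section Topology

variable {X : Type*} [TopologicalSpace X]

/-- The parametrization of the region between an interval of length `l` and a chord over it. -/
noncomputable def lensMap (x l : ℝ) (z : ℝ × ℝ) : ℝ × ℝ :=
  let η := z.2 * (min (l - z.1) (l + 2 * z.1) / 4)
  (x + (max z.1 0 + η) + (max (-z.1) 0 + η), (max (-z.1) 0 + η) / l)

theorem continuous_lensMap (x l : ℝ) : Continuous (lensMap x l) := by
  unfold lensMap; fun_prop

/-- The oblique coordinates of the image differ by exactly `s`, which recovers `s`; the height then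
recovers `t`, since the factor multiplying `t` is positive. -/
theorem lensMap_injOn {x l : ℝ} (hl : 0 < l) :
    InjOn (lensMap x l) (Ioo (-(l / 2)) l ×ˢ Ioo 0 1) := by
  rintro ⟨s, t⟩ ⟨hs, -⟩ ⟨s', t'⟩ - h
  simp only [lensMap, Prod.mk.injEq] at h
  obtain ⟨h1, h2⟩ := h
  rw [div_left_inj' hl.ne'] at h2
  have h3 := max_zero_sub_max_neg_zero_eq_self s
  have h4 := max_zero_sub_max_neg_zero_eq_self s'
  have hs' : s = s' := by rw [← h3, ← h4]; linarith
  subst hs'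
  have hmin : 0 < min (l - s) (l + 2 * s) / 4 := by
    apply div_pos _ (by norm_num)
    rw [lt_min_iff]
    constructor <;> linarith [hs.1, hs.2]
  have := mul_right_cancel₀ hmin.ne' (add_left_cancel h2)
  rw [this]

theorem lensMap_mem {x y : ℝ} (h : x < y) {z : ℝ × ℝ}
    (hz : z ∈ Ioo (-((y - x) / 2)) (y - x) ×ˢ Ioo (0 : ℝ) 1) :
    (lensMap x (y - x) z).1 ∈ Ioo x y ∧ 0 < (lensMap x (y - x) z).2 ∧
      (lensMap x (y - x) z).2 < tent x y (lensMap x (y - x) z).1 := by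
  obtain ⟨⟨h1, h2⟩, h3, h4⟩ := hz
  simp only [lensMap]
  set l := y - x with hl
  have hlpos : 0 < l := sub_pos.2 h
  have hmin : 0 < min (l - z.1) (l + 2 * z.1) / 4 := by
    apply div_pos _ (by norm_num)
    rw [lt_min_iff]
    constructor <;> linarith
  set η := z.2 * (min (l - z.1) (l + 2 * z.1) / 4) with hη
  have hη0 : 0 < η := mul_pos h3 hmin
  have hη1 : η < min (l - z.1) (l + 2 * z.1) / 4 := mul_lt_of_lt_one_left hmin h4
  have hη2 := min_le_left (l - z.1) (l + 2 * z.1)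
  have hη3 := min_le_right (l - z.1) (l + 2 * z.1)
  have hu : 0 < max z.1 0 + η := by linarith [le_max_right z.1 0]
  have hv : 0 < max (-z.1) 0 + η := by linarith [le_max_right (-z.1) 0]
  have huv : (max z.1 0 + η) + 2 * (max (-z.1) 0 + η) < l := by
    rcases le_total 0 z.1 with h0 | h0
    · rw [max_eq_left h0, max_eq_right (by linarith)]; linarith
    · rw [max_eq_right h0, max_eq_left (by linarith)]; linarith
  exact ⟨⟨by linarith, by linarith⟩, div_pos hv hlpos, lt_tent h hu huv⟩

/-- In the parametrizing rectangle the chord is the graph of `tent` over the interval between the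
two chosen points. The regions below and above it are reparametrized as rectangles again. New points
are confined to parameters below `1 / 2`, so that in the lower region they fit on one straight side
together with the base. -/
theorem IsCell.split {U : Set X} {l₁ l₂ l₃ : List X} {P Q : X}
    (h : IsCell U (l₁ ++ P :: (l₂ ++ Q :: l₃))) :
    ∃ (Γ : ℝ → X) (U₁ U₂ : Set X), Continuous Γ ∧ Γ 0 = P ∧ Γ 1 = Q ∧ InjOn Γ (Ioo 0 1) ∧
      MapsTo Γ (Ioo 0 1) U ∧ U₁ ⊆ U ∧ U₂ ⊆ U ∧ Disjoint U₁ U₂ ∧ Disjoint (Γ '' Ioo 0 1) U₁ ∧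
      Disjoint (Γ '' Ioo 0 1) U₂ ∧
      ∀ ts : List ℝ, ts.Pairwise (· < ·) → (∀ t ∈ ts, 0 < t ∧ t < 1 / 2) →
        IsCell U₁ ((ts.map Γ).reverse ++ P :: (l₂ ++ [Q])) ∧
        IsCell U₂ (l₁ ++ P :: (ts.map Γ ++ Q :: l₃)) := by
  obtain ⟨φ, a, b, xs, hφ, hinj, hmaps, hsort, hmem, hxs⟩ := h
  obtain ⟨ys₁, r₁, rfl, rfl, hr₁⟩ := List.map_eq_append_iff.1 hxs
  obtain ⟨x, r₂, rfl, rfl, hr₂⟩ := List.map_eq_cons_iff.1 hr₁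
  obtain ⟨ys₂, r₃, rfl, rfl, hr₃⟩ := List.map_eq_append_iff.1 hr₂
  obtain ⟨y, ys₃, rfl, rfl, rfl⟩ := List.map_eq_cons_iff.1 hr₃
  simp only [List.pairwise_append, List.pairwise_cons, List.mem_append, List.mem_cons] at hsort hmem
  obtain ⟨hs₁, ⟨hx, hs₂, ⟨hy, hs₃⟩, h23⟩, h1⟩ := hsort
  have hxy : x < y := hx y (by simp)
  have hl : 0 < y - x := sub_pos.2 hxy
  have hax : a ≤ x := (hmem x (by simp)).1
  have hyb : y ≤ b := (hmem y (by simp)).2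
  have ht0 := tent_nonneg hxy
  have ht1 := tent_lt_one hxy
  have hrect : ∀ t ∈ Ioo (0 : ℝ) 1, (x + t * (y - x), tent x y (x + t * (y - x))) ∈
      Ioo a b ×ˢ Ioo (0 : ℝ) 1 := by
    rintro t ⟨h0, h1⟩
    have e1 : x < x + t * (y - x) := by nlinarith
    have e2 : x + t * (y - x) < y := by nlinarith
    exact ⟨⟨by linarith, by linarith⟩, tent_pos e1 e2, ht1 _⟩
  have himage : ∀ {A B : Set (ℝ × ℝ)}, A ⊆ Ioo a b ×ˢ Ioo 0 1 → B ⊆ Ioo a b ×ˢ Ioo 0 1 →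
      Disjoint A B → Disjoint (φ '' A) (φ '' B) := by
    intro A B hA hB hAB
    rw [Set.disjoint_left]
    rintro _ ⟨z, hz, rfl⟩ ⟨z', hz', h⟩
    exact Set.disjoint_left.1 hAB hz (hinj (hB hz') (hA hz) h ▸ hz')
  let R : Set (ℝ × ℝ) := Ioo a b ×ˢ Ioo 0 1
  let A₁ : Set (ℝ × ℝ) := {z ∈ R | z.2 < tent x y z.1}
  let A₂ : Set (ℝ × ℝ) := {z ∈ R | tent x y z.1 < z.2}
  let A₀ : Set (ℝ × ℝ) := {z ∈ R | z.2 = tent x y z.1}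
  have hA₁ : A₁ ⊆ R := fun z hz => hz.1
  have hA₂ : A₂ ⊆ R := fun z hz => hz.1
  have hA₀ : A₀ ⊆ R := fun z hz => hz.1
  have hΓ : (fun t => φ (x + t * (y - x), tent x y (x + t * (y - x)))) '' Ioo 0 1 ⊆ φ '' A₀ := by
    rintro _ ⟨t, ht, rfl⟩
    exact ⟨_, ⟨hrect t ht, rfl⟩, rfl⟩
  have htc := continuous_tent x y
  refine ⟨fun t => φ (x + t * (y - x), tent x y (x + t * (y - x))), φ '' A₁, φ '' A₂, by fun_prop,
    ?_, ?_, ?_, fun t ht => hmaps (hrect t ht), ?_, ?_, ?_, ?_, ?_, ?_⟩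
  · simp [tent_left (le_refl x)]
  · simp [tent_right (le_refl y)]
  · intro s hs t ht hst
    have := congrArg Prod.fst (hinj (hrect s hs) (hrect t ht) hst)
    exact mul_right_cancel₀ hl.ne' (add_left_cancel this)
  · rintro _ ⟨z, hz, rfl⟩
    exact hmaps hz.1
  · rintro _ ⟨z, hz, rfl⟩
    exact hmaps hz.1
  · refine himage hA₁ hA₂ (Set.disjoint_left.2 fun z h h' => ?_)
    exact lt_asymm h.2 h'.2
  · refine (himage hA₀ hA₁ (Set.disjoint_left.2 fun z h h' => ?_)).mono_left hΓ
    exact h'.2.ne h.2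
  · refine (himage hA₀ hA₂ (Set.disjoint_left.2 fun z h h' => ?_)).mono_left hΓ
    exact h'.2.ne' h.2
  intro ts hts hts'
  have hslope : ∀ t ∈ ts, tent x y (x + t * (y - x)) = t := fun t ht =>
    tent_slope hxy (hts' t ht).1.le (hts' t ht).2.le
  constructor
  -- The side of the new rectangle is folded at `0`: negative parameters descend from the top of the
  -- chord to `P`, positive ones follow the base from `P` to `Q`.
  · refine ⟨fun z => φ (lensMap x (y - x) z), -((y - x) / 2), y - x,
      (ts.map fun t => -(t * (y - x))).reverse ++ 0 :: (ys₂.map (fun u => u - x) ++ [y - x]),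
      hφ.comp (continuous_lensMap _ _), ?_, ?_, ?_, ?_, ?_⟩
    · intro z hz z' hz' hzz
      have k := lensMap_mem hxy hz
      have k' := lensMap_mem hxy hz'
      refine lensMap_injOn hl hz hz' (hinj ?_ ?_ hzz)
      · exact ⟨⟨by linarith [k.1.1], by linarith [k.1.2]⟩, k.2.1, k.2.2.trans (ht1 _)⟩
      · exact ⟨⟨by linarith [k'.1.1], by linarith [k'.1.2]⟩, k'.2.1, k'.2.2.trans (ht1 _)⟩
    · intro z hz
      have k := lensMap_mem hxy hz
      exact ⟨_, ⟨⟨⟨by linarith [k.1.1], by linarith [k.1.2]⟩, k.2.1, k.2.2.trans (ht1 _)⟩, k.2.2⟩,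
        rfl⟩
    · have hneg : ∀ t ∈ ts, -(t * (y - x)) < 0 := fun t ht => by nlinarith [hts' t ht]
      have hys : ∀ u ∈ ys₂, x < u ∧ u < y := fun u hu =>
        ⟨hx u (by simp [hu]), h23 u hu y (by simp)⟩
      simp only [List.pairwise_append, List.pairwise_cons, List.pairwise_reverse, List.pairwise_map,
        List.mem_append, List.mem_cons, List.mem_reverse, List.mem_map]
      refine ⟨hts.imp fun {s t} hst => ?_, ⟨?_, hs₂.imp fun {s t} hst => ?_, by simp, ?_⟩, ?_⟩
      · nlinarith
      · rintro _ (⟨u, hu, rfl⟩ | rfl | h)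
        · linarith [hys u hu]
        · exact hl
        · simp at h
      · linarith
      · rintro _ ⟨u, hu, rfl⟩ _ (rfl | h)
        · linarith [hys u hu]
        · simp at h
      · rintro _ ⟨t, ht, rfl⟩ _ (rfl | ⟨u, hu, rfl⟩ | rfl | h)
        · exact hneg t ht
        · linarith [hys u hu, hneg t ht]
        · linarith [hneg t ht]
        · simp at h
    · simp only [List.mem_append, List.mem_cons, List.mem_reverse, List.mem_map]
      rintro _ (⟨t, ht, rfl⟩ | rfl | ⟨u, hu, rfl⟩ | rfl | h)
      · constructor <;> nlinarith [hts' t ht]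
      · constructor <;> linarith
      · have := hx u (by simp [hu])
        have := h23 u hu y (by simp)
        constructor <;> linarith
      · constructor <;> linarith
      · simp at h
    · have hbot : ∀ s, 0 ≤ s → lensMap x (y - x) (s, 0) = (x + s, 0) := by
        intro s hs
        simp [lensMap, hs]
      have hleft : ∀ t ∈ ts, lensMap x (y - x) (-(t * (y - x)), 0) =
          (x + t * (y - x), tent x y (x + t * (y - x))) := by
        intro t ht
        have : 0 ≤ t * (y - x) := by nlinarith [hts' t ht]
        rw [hslope t ht]
        simp [lensMap, this, hl.ne']
      simp only [List.map_append, List.map_reverse, List.map_cons, List.map_map, List.map_nil,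
        hbot 0 le_rfl, hbot _ hl.le, add_zero, add_sub_cancel]
      congr 1
      · congr 1
        refine List.map_congr_left fun t ht => ?_
        simp only [Function.comp_def]
        rw [hleft t ht]
      · congr 2
        refine List.map_congr_left fun u hu => ?_
        simp only [Function.comp_def]
        rw [hbot _ (by linarith [hx u (by simp [hu])]), add_sub_cancel]
  -- Above the chord, each vertical segment from `tent x y z.1` to `1` is rescaled to the unit
  -- interval.
  · refine ⟨fun z => φ (z.1, tent x y z.1 + (1 - tent x y z.1) * z.2), a, b,
      ys₁ ++ x :: (ts.map (fun t => x + t * (y - x)) ++ y :: ys₃), by fun_prop, ?_, ?_, ?_, ?_, ?_⟩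
    · rintro ⟨s, t⟩ ⟨hs, ht⟩ ⟨s', t'⟩ ⟨hs', ht'⟩ hst
      have := hinj (x₁ := (s, tent x y s + (1 - tent x y s) * t))
        (x₂ := (s', tent x y s' + (1 - tent x y s') * t')) ⟨hs, ?_⟩ ⟨hs', ?_⟩ hst
      · simp only [Prod.mk.injEq] at this
        obtain ⟨rfl, h2⟩ := this
        have hne : (1 - tent x y s) ≠ 0 := by linarith [ht1 s]
        rw [mul_left_cancel₀ hne (add_left_cancel h2)]
      · constructor <;> nlinarith [ht0 s, ht1 s, ht.1, ht.2]
      · constructor <;> nlinarith [ht0 s', ht1 s', ht'.1, ht'.2]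
    · rintro ⟨s, t⟩ ⟨hs, ht⟩
      have h1 := mul_pos (sub_pos.2 (ht1 s)) ht.1
      have h2 := mul_lt_mul_of_pos_left ht.2 (sub_pos.2 (ht1 s))
      refine ⟨(s, tent x y s + (1 - tent x y s) * t), ⟨⟨hs, ?_, ?_⟩, ?_⟩, rfl⟩
      · change 0 < tent x y s + (1 - tent x y s) * t
        linarith [ht0 s]
      · change tent x y s + (1 - tent x y s) * t < 1
        linarith
      · simpa using h1
    · have hys : ∀ t ∈ ts, x < x + t * (y - x) ∧ x + t * (y - x) < y := fun t ht => by
        constructor <;> nlinarith [hts' t ht]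
      simp only [List.pairwise_append, List.pairwise_cons, List.pairwise_map,
        List.mem_append, List.mem_cons, List.mem_map]
      refine ⟨hs₁, ⟨?_, hts.imp fun {s t} hst => by nlinarith, ⟨hy, hs₃⟩, ?_⟩, ?_⟩
      · rintro _ (⟨t, ht, rfl⟩ | rfl | h)
        · exact (hys t ht).1
        · exact hxy
        · exact hx _ (by simp [h])
      · rintro _ ⟨t, ht, rfl⟩ _ (rfl | h)
        · exact (hys t ht).2
        · exact (hys t ht).2.trans (hy _ h)
      · rintro u hu _ (rfl | ⟨t, ht, rfl⟩ | rfl | h)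
        · exact h1 u hu _ (by simp)
        · exact (h1 u hu x (by simp)).trans (hys t ht).1
        · exact h1 u hu _ (by simp)
        · exact h1 u hu _ (by simp [h])
    · simp only [List.mem_append, List.mem_cons, List.mem_map]
      rintro _ (h | rfl | ⟨t, ht, rfl⟩ | rfl | h)
      · exact hmem _ (by simp [h])
      · exact hmem _ (by simp)
      · constructor <;> nlinarith [hts' t ht]
      · exact hmem _ (by simp)
      · exact hmem _ (by simp [h])
    · simp only [List.map_append, List.map_cons, List.map_map, mul_zero, add_zero,
        tent_left (le_refl x), tent_right (le_refl y)]
      congr 1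
      · refine List.map_congr_left fun u hu => ?_
        rw [tent_left (h1 u hu x (by simp)).le]
      · congr 2
        congr 1
        refine List.map_congr_left fun u hu => ?_
        rw [tent_right (hy u hu).le]

end Topology

end CubicTorus

/-! ### Paths of numbered vertices, and labellings of a space by vertices and arcs. -/

namespace CubicTorus

open Set unitInterval

/-- The pairs of consecutive elements of a list. -/
def links (l : List ℕ) : List (Sym2 ℕ) := List.zipWith (fun a b => s(a, b)) l l.tail

theorem mem_links {l : List ℕ} {z : Sym2 ℕ} :
    z ∈ links l ↔ ∃ (k : ℕ) (h : k + 1 < l.length), s(l[k], l[k + 1]) = z := by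
  simp only [links, List.mem_iff_getElem, List.getElem_zipWith, List.length_zipWith,
    List.length_tail, List.getElem_tail]
  constructor
  · rintro ⟨k, h, rfl⟩
    exact ⟨k, by omega, rfl⟩
  · rintro ⟨k, h, rfl⟩
    exact ⟨k, by omega, rfl⟩

/-- The path from `p` to `q` through the `m` vertices `n, n + 1, …`. -/
def path (n m p q : ℕ) : List ℕ := p :: (List.range' n m ++ [q])

/-- The vertex number `k` of `path n m p q`. -/
def pathVertex (n m p q k : ℕ) : ℕ := if k = 0 then p else if k ≤ m then n + (k - 1) else q

theorem length_path (n m p q : ℕ) : (path n m p q).length = m + 2 := by simp [path]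

theorem getElem_path {n m p q k : ℕ} (h : k < (path n m p q).length) :
    (path n m p q)[k] = pathVertex n m p q k := by
  rw [length_path] at h
  rcases k with _ | k
  · simp [path, pathVertex]
  · simp only [path, pathVertex, List.getElem_cons_succ]
    by_cases hk : k < m
    · rw [List.getElem_append_left (by simpa using hk)]
      simp [Nat.succ_le_of_lt hk]
    · obtain rfl : k = m := by omega
      simp

theorem pathVertex_injOn {n m p q : ℕ} (hp : p < n) (hq : q < n) (hpq : p ≠ q) {j k : ℕ}
    (hj : j ≤ m + 1) (hk : k ≤ m + 1) (h : pathVertex n m p q j = pathVertex n m p q k) :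
    j = k := by
  unfold pathVertex at h
  split_ifs at h <;> omega

theorem pathVertex_lt {n m p q : ℕ} (hp : p < n) (hq : q < n) (k : ℕ) :
    pathVertex n m p q k < n + m := by
  unfold pathVertex
  split_ifs <;> omega

theorem le_pathVertex {n m p q k : ℕ} (h : 0 < k) (hk : k ≤ m) : n ≤ pathVertex n m p q k := by
  unfold pathVertex
  split_ifs <;> omega

theorem mem_links_path {n m p q : ℕ} {z : Sym2 ℕ} : z ∈ links (path n m p q) ↔
    ∃ k ≤ m, s(pathVertex n m p q k, pathVertex n m p q (k + 1)) = z := by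
  rw [mem_links]
  simp only [getElem_path, length_path]
  constructor
  · rintro ⟨k, h, hz⟩
    exact ⟨k, by omega, hz⟩
  · rintro ⟨k, h, hz⟩
    exact ⟨k, by omega, hz⟩

/-- The part of a drawing in which a point lies: a vertex or an arc, the interior of a cell, or
none of these. The vertex `a` is the piece `s(a, a)`, an arc from `a` to `b` is `s(a, b)`. -/
inductive Label
  | piece (z : Sym2 ℕ)
  | cell (k : ℕ)
  | free

section Skeleton

variable {X : Type*} [TopologicalSpace X]

/-- The labelling `lab` of the points of `X` describes disjoint points `vert a` for `a < n` and
disjoint open arcs between them. -/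
structure IsSkeleton (n : ℕ) (arcs : List (Sym2 ℕ)) (vert : ℕ → X) (lab : X → Label) : Prop where
  lab_lt : ∀ x z, lab x = .piece z → ∀ a ∈ z, a < n
  arcs_lt : ∀ z ∈ arcs, ∀ a ∈ z, a < n
  lab_eq_vertex : ∀ a < n, ∀ x, lab x = .piece s(a, a) ↔ x = vert a
  openArc : ∀ a b, s(a, b) ∈ arcs → OpenArc {x | lab x = .piece s(a, b)} (vert a) (vert b)

theorem IsSkeleton.congr {n : ℕ} {arcs : List (Sym2 ℕ)} {vert : ℕ → X} {lab lab' : X → Label}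
    (h : IsSkeleton n arcs vert lab) (hl : ∀ x z, lab' x = .piece z ↔ lab x = .piece z) :
    IsSkeleton n arcs vert lab' where
  lab_lt x z hx := h.lab_lt x z ((hl x z).1 hx)
  arcs_lt := h.arcs_lt
  lab_eq_vertex a ha x := (hl x _).trans (h.lab_eq_vertex a ha x)
  openArc a b hab := by simpa only [hl] using h.openArc a b hab

/-- The point at time `t` receives the label formed from `⌊t⌋₊` and `⌈t⌉₊`: a vertex at integer
times, an arc in between. As `m` is positive, each new label involves a vertex number that is at
least `n`, so it cannot collide with an old label even if `p` and `q` are already joined. -/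
theorem IsSkeleton.addPath {n : ℕ} {arcs : List (Sym2 ℕ)} {vert : ℕ → X} {lab : X → Label}
    (h : IsSkeleton n arcs vert lab) {p q m : ℕ} (hp : p < n) (hq : q < n) (hpq : p ≠ q)
    (hm : 0 < m) {Γ : ℝ → X} (hΓ : Continuous Γ) (h0 : Γ 0 = vert p) (h1 : Γ (m + 1 : ℕ) = vert q)
    (hinj : InjOn Γ (Ioo 0 (m + 1 : ℕ))) (hfree : ∀ t ∈ Ioo (0 : ℝ) (m + 1 : ℕ), lab (Γ t) = .free) :
    ∃ (vert' : ℕ → X) (lab' : X → Label),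
      IsSkeleton (n + m) (arcs ++ links (path n m p q)) vert' lab' ∧
      (∀ a < n, vert' a = vert a) ∧ (∀ k < m, vert' (n + k) = Γ (k + 1 : ℕ)) ∧
      (∀ x, x ∉ Γ '' Ioo (0 : ℝ) (m + 1 : ℕ) → lab' x = lab x) ∧
      ∀ x k, lab' x = .cell k ↔ lab x = .cell k := by
  classical
  let w := pathVertex n m p q
  let lab' : X → Label := fun x =>
    if hx : ∃ t ∈ Ioo (0 : ℝ) (m + 1 : ℕ), Γ t = x then
      .piece s(w ⌊hx.choose⌋₊, w ⌈hx.choose⌉₊) else lab x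
  let vert' : ℕ → X := fun a => if a < n then vert a else Γ ((a - n) + 1 : ℕ)
  have hlab : ∀ t ∈ Ioo (0 : ℝ) (m + 1 : ℕ), lab' (Γ t) = .piece s(w ⌊t⌋₊, w ⌈t⌉₊) := by
    intro t ht
    have hx : ∃ s ∈ Ioo (0 : ℝ) (m + 1 : ℕ), Γ s = Γ t := ⟨t, ht, rfl⟩
    have hc : hx.choose = t := hinj hx.choose_spec.1 ht hx.choose_spec.2
    simp only [lab', dif_pos hx, hc]
  have hlab' : ∀ x, x ∉ Γ '' Ioo (0 : ℝ) (m + 1 : ℕ) → lab' x = lab x := fun x hx => dif_neg hx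
  have hv : ∀ a < n, vert' a = vert a := fun a ha => if_pos ha
  have hv' : ∀ k < m, vert' (n + k) = Γ (k + 1 : ℕ) := fun k _ => by simp [vert']
  have hvw : ∀ k ≤ m + 1, vert' (w k) = Γ k := by
    intro k hk
    simp only [w, pathVertex]
    split_ifs with h2 h3
    · rw [hv p hp, h2, ← h0, Nat.cast_zero]
    · rw [hv' _ (by omega)]
      congr 2
      omega
    · obtain rfl : k = m + 1 := by omega
      rw [hv q hq, ← h1]
  have hfc : ∀ t ∈ Ioo (0 : ℝ) (m + 1 : ℕ), ⌊t⌋₊ ≤ m ∧ 0 < ⌈t⌉₊ ∧ ⌈t⌉₊ ≤ m + 1 ∧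
      ⌊t⌋₊ ≤ ⌈t⌉₊ ∧ ⌈t⌉₊ ≤ ⌊t⌋₊ + 1 := by
    intro t ht
    refine ⟨?_, Nat.ceil_pos.2 ht.1, Nat.ceil_le.2 ht.2.le, Nat.floor_le_ceil t,
      Nat.ceil_le_floor_add_one t⟩
    exact Nat.lt_succ_iff.1 ((Nat.floor_lt ht.1.le).2 ht.2)
  have hnew : ∀ t ∈ Ioo (0 : ℝ) (m + 1 : ℕ), ∀ z, lab' (Γ t) = .piece z → ∃ a ∈ z, n ≤ a := by
    intro t ht z hz
    rw [hlab t ht, Label.piece.injEq] at hz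
    subst hz
    obtain ⟨h2, h3, h4, h5, h6⟩ := hfc t ht
    -- On the first arc the floor is the old vertex `p`, and the ceiling is new because `m` is
    -- positive.
    rcases Nat.eq_zero_or_pos ⌊t⌋₊ with hf | hf
    · exact ⟨w ⌈t⌉₊, by simp, le_pathVertex h3 (by omega)⟩
    · exact ⟨w ⌊t⌋₊, by simp, le_pathVertex hf h2⟩
  have hold : ∀ z : Sym2 ℕ, (∀ a ∈ z, a < n) → ∀ x, lab' x = .piece z ↔ lab x = .piece z := by
    intro z hz x
    by_cases hx : x ∈ Γ '' Ioo (0 : ℝ) (m + 1 : ℕ)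
    · obtain ⟨t, ht, rfl⟩ := hx
      rw [hfree t ht]
      constructor
      · intro h2
        obtain ⟨a, ha, hna⟩ := hnew t ht z h2
        exact absurd (hz a ha) (not_lt.2 hna)
      · intro h2; cases h2
    · rw [hlab' x hx]
  have hpre : ∀ z : Sym2 ℕ, (∃ a ∈ z, n ≤ a) → ∀ x, lab' x = .piece z ↔
      ∃ t ∈ Ioo (0 : ℝ) (m + 1 : ℕ), s(w ⌊t⌋₊, w ⌈t⌉₊) = z ∧ Γ t = x := by
    rintro z ⟨a, ha, hna⟩ x
    constructor
    · intro hz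
      by_cases hx : x ∈ Γ '' Ioo (0 : ℝ) (m + 1 : ℕ)
      · obtain ⟨t, ht, rfl⟩ := hx
        rw [hlab t ht, Label.piece.injEq] at hz
        exact ⟨t, ht, hz, rfl⟩
      · rw [hlab' x hx] at hz
        exact absurd (h.lab_lt x z hz a ha) (not_lt.2 hna)
    · rintro ⟨t, ht, rfl, rfl⟩
      exact hlab t ht
  have hwinj : ∀ {j k : ℕ}, j ≤ m + 1 → k ≤ m + 1 → w j = w k → j = k := fun hj hk he =>
    pathVertex_injOn hp hq hpq hj hk he
  refine ⟨vert', lab', ⟨?_, ?_, ?_, ?_⟩, hv, hv', hlab', ?_⟩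
  · intro x z hz a ha
    by_cases hx : x ∈ Γ '' Ioo (0 : ℝ) (m + 1 : ℕ)
    · obtain ⟨t, ht, rfl⟩ := hx
      rw [hlab t ht, Label.piece.injEq] at hz
      subst hz
      rcases Sym2.mem_iff.1 ha with rfl | rfl <;> exact pathVertex_lt hp hq _
    · rw [hlab' x hx] at hz
      exact (h.lab_lt x z hz a ha).trans_le (Nat.le_add_right _ _)
  · intro z hz a ha
    rcases List.mem_append.1 hz with hz | hz
    · exact (h.arcs_lt z hz a ha).trans_le (Nat.le_add_right _ _)
    · obtain ⟨k, -, rfl⟩ := mem_links_path.1 hz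
      rcases Sym2.mem_iff.1 ha with rfl | rfl <;> exact pathVertex_lt hp hq _
  · intro a ha x
    by_cases han : a < n
    · rw [hold _ (by simpa using han), hv a han]
      exact h.lab_eq_vertex a han x
    · obtain ⟨k, rfl⟩ := Nat.exists_eq_add_of_le (not_lt.1 han)
      have hk : k < m := by omega
      have hwk : w (k + 1) = n + k := by
        simp only [w, pathVertex]
        rw [if_neg (by omega), if_pos (by omega)]
        omega
      rw [hpre _ ⟨n + k, by simp, by omega⟩, hv' k hk]
      constructor
      · rintro ⟨t, ht, hz, rfl⟩
        obtain ⟨h2, h3, h4, h5, h6⟩ := hfc t ht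
        have e : w ⌊t⌋₊ = n + k ∧ w ⌈t⌉₊ = n + k := by
          rcases Sym2.eq_iff.1 hz with h | h
          · exact h
          · exact h
        have e1 := hwinj (by omega) (by omega) (e.1.trans hwk.symm)
        have e2 := hwinj (by omega) (by omega) (e.2.trans hwk.symm)
        congr 1
        apply le_antisymm
        · exact e2 ▸ Nat.le_ceil t
        · exact e1 ▸ Nat.floor_le ht.1.le
      · rintro rfl
        refine ⟨(k + 1 : ℕ), ⟨by positivity, by exact_mod_cast Nat.succ_lt_succ hk⟩, ?_, rfl⟩
        rw [Nat.floor_natCast, Nat.ceil_natCast, hwk]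
  · intro a b hab
    rcases List.mem_append.1 hab with hab | hab
    · have hlt := h.arcs_lt _ hab
      have e : {x | lab' x = .piece s(a, b)} = {x | lab x = .piece s(a, b)} := by
        ext x
        exact hold _ hlt x
      rw [e, hv a (hlt a (by simp)), hv b (hlt b (by simp))]
      exact h.openArc a b hab
    · obtain ⟨k, hk, hz⟩ := mem_links_path.1 hab
      change s(w k, w (k + 1)) = s(a, b) at hz
      have harc : OpenArc {x | lab' x = .piece s(w k, w (k + 1))} (vert' (w k))
          (vert' (w (k + 1))) := by
        have hsub : Ioo (k : ℝ) (k + 1 : ℕ) ⊆ Ioo (0 : ℝ) (m + 1 : ℕ) := by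
          apply Ioo_subset_Ioo
          · positivity
          · exact_mod_cast Nat.succ_le_succ hk
        have e : {x | lab' x = .piece s(w k, w (k + 1))} = Γ '' Ioo (k : ℝ) (k + 1 : ℕ) := by
          ext x
          have hex : ∃ c ∈ s(w k, w (k + 1)), n ≤ c := by
            rcases Nat.eq_zero_or_pos k with rfl | hk0
            · exact ⟨w 1, by simp, le_pathVertex one_pos hm⟩
            · exact ⟨w k, by simp, le_pathVertex hk0 hk⟩
          rw [mem_ofPred_eq, hpre _ hex]
          constructor
          · rintro ⟨t, ht, hz, rfl⟩
            obtain ⟨h2, h3, h4, h5, h6⟩ := hfc t ht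
            have e : ⌊t⌋₊ = k ∧ ⌈t⌉₊ = k + 1 := by
              rcases Sym2.eq_iff.1 hz with ⟨e1, e2⟩ | ⟨e1, e2⟩
              · exact ⟨hwinj (by omega) (by omega) e1, hwinj (by omega) (by omega) e2⟩
              · have := hwinj (by omega) (by omega) e1
                have := hwinj (by omega) (by omega) e2
                omega
            refine ⟨t, ⟨?_, ?_⟩, rfl⟩
            · exact Nat.lt_ceil.1 (by omega)
            · exact (Nat.floor_lt ht.1.le).1 (by omega)
          · rintro ⟨t, ht, rfl⟩
            refine ⟨t, hsub ht, ?_, rfl⟩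
            have hk0 : (0 : ℝ) ≤ k := Nat.cast_nonneg k
            have e1 : ⌊t⌋₊ = k := (Nat.floor_eq_iff (hk0.trans ht.1.le)).2
              ⟨ht.1.le, by exact_mod_cast ht.2⟩
            have e2 : ⌈t⌉₊ = k + 1 := (Nat.ceil_eq_iff (by omega)).2
              ⟨by simpa using ht.1, ht.2.le⟩
            rw [e1, e2]
        rw [e, hvw k (by omega), hvw (k + 1) (by omega)]
        exact OpenArc.of_real hΓ (by exact_mod_cast Nat.lt_succ_self k) (hinj.mono hsub)
      rcases Sym2.eq_iff.1 hz with ⟨rfl, rfl⟩ | ⟨rfl, rfl⟩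
      · exact harc
      · rw [Sym2.eq_swap]
        exact harc.symm
  · intro x k
    by_cases hx : x ∈ Γ '' Ioo (0 : ℝ) (m + 1 : ℕ)
    · obtain ⟨t, ht, rfl⟩ := hx
      rw [hlab t ht, hfree t ht]
      simp
    · rw [hlab' x hx]

end Skeleton

end CubicTorus

/-! ### Meshes, and chords through their cells. -/

namespace CubicTorus

open Set unitInterval

/-- A combinatorial drawing: vertices `0, …, size - 1`, arcs between them, and cells, each given
by vertices in the order in which they occur on its boundary. -/
structure Mesh where
  size : ℕ
  arcs : List (Sym2 ℕ)
  cells : List (List ℕ)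

/-- Draw a chord, with `m` new vertices on it, from `p` to `q` through the cell `k`, on whose
boundary the vertices `l₁, p, l₂, q, l₃` occur in this order. -/
def Mesh.chord (M : Mesh) (k m : ℕ) (l₁ : List ℕ) (p : ℕ) (l₂ : List ℕ) (q : ℕ) (l₃ : List ℕ) :
    Mesh where
  size := M.size + m
  arcs := M.arcs ++ links (path M.size m p q)
  cells := M.cells.set k ((List.range' M.size m).reverse ++ p :: (l₂ ++ [q])) ++
    [l₁ ++ p :: (List.range' M.size m ++ q :: l₃)]

section Realizable

variable {X : Type*} [TopologicalSpace X]

/-- The combinatorial drawing `M` is a drawing in the space `X`. -/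
def Mesh.Realizable (X : Type*) [TopologicalSpace X] (M : Mesh) : Prop :=
  ∃ (vert : ℕ → X) (lab : X → Label), IsSkeleton M.size M.arcs vert lab ∧
    (∀ c ∈ M.cells, ∀ a ∈ c, a < M.size) ∧
    ∀ (k : ℕ) (h : k < M.cells.length), IsCell {x | lab x = .cell k} (M.cells[k].map vert)

/-- The chord comes from `IsCell.split` and its labels from `IsSkeleton.addPath`. The former wants
the new vertices in the first half of the parameter interval, the latter wants them at integer
times; `ρ` reconciles the two by crowding the times up to `m` below `1 / 2`. -/
theorem Mesh.Realizable.chord {M : Mesh} (hM : M.Realizable X) {k m p q : ℕ}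
    {l₁ l₂ l₃ : List ℕ} (hk : k < M.cells.length)
    (hc : M.cells[k] = l₁ ++ p :: (l₂ ++ q :: l₃)) (hm : 0 < m) (hpq : p ≠ q) :
    (M.chord k m l₁ p l₂ q l₃).Realizable X := by
  classical
  obtain ⟨vert, lab, hs, hlt, hcell⟩ := hM
  have hck := hcell k hk
  have hltk := hlt _ (List.getElem_mem hk)
  rw [hc] at hck hltk
  simp only [List.mem_append, List.mem_cons] at hltk
  have hp : p < M.size := hltk p (by simp)
  have hq : q < M.size := hltk q (by simp)
  simp only [List.map_append, List.map_cons] at hck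
  obtain ⟨Γ, U₁, U₂, hΓ, hΓ0, hΓ1, hinj, hmaps, hU₁, hU₂, h12, hΓU₁, hΓU₂, hts⟩ := hck.split
  -- a reparametrization under which the new vertices lie at the integers
  let ρ : ℝ → ℝ := fun t => t / (2 * (m + 1)) + max 0 (t - m) / 2
  have hm1 : (0 : ℝ) < 2 * (m + 1) := by positivity
  have hρ : StrictMono ρ := by
    intro s t hst
    have h1 : s / (2 * (m + 1)) < t / (2 * (m + 1)) := by gcongr
    have h2 : max 0 (s - m) ≤ max 0 (t - m) := by gcongr
    simp only [ρ]
    linarith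
  have hρc : Continuous ρ := by fun_prop
  have hρk : ∀ j : ℕ, j ≤ m → ρ j = j / (2 * (m + 1)) := by
    intro j hj
    have : (j : ℝ) - m ≤ 0 := by
      rw [sub_nonpos]
      exact_mod_cast hj
    simp [ρ, this]
  have hρ0 : ρ 0 = 0 := by simpa using hρk 0 (Nat.zero_le m)
  have hρ1 : ρ (m + 1 : ℕ) = 1 := by
    have : (m : ℝ) + 1 ≠ 0 := by positivity
    simp only [ρ, Nat.cast_add, Nat.cast_one, add_sub_cancel_left]
    rw [max_eq_right zero_le_one]
    field_simp
    norm_num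
  have hρmaps : ∀ t ∈ Ioo (0 : ℝ) (m + 1 : ℕ), ρ t ∈ Ioo (0 : ℝ) 1 := by
    intro t ht
    rw [← hρ0, ← hρ1]
    exact ⟨hρ ht.1, hρ ht.2⟩
  -- One new cell keeps the number `k`, the other gets the first unused number, and the rest of the
  -- old cell becomes free. The chord lies in this free part.
  let lab₁ : X → Label := fun x =>
    if x ∈ U₁ then .cell k else if x ∈ U₂ then .cell M.cells.length else
      if lab x = .cell k then .free else lab x
  have hpiece : ∀ x z, lab₁ x = .piece z ↔ lab x = .piece z := by
    intro x z
    simp only [lab₁]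
    split_ifs with h1 h2 h3
    · have : lab x = .cell k := hU₁ h1
      simp [this]
    · have : lab x = .cell k := hU₂ h2
      simp [this]
    · simp [h3]
    · rfl
  have hfree : ∀ t ∈ Ioo (0 : ℝ) (m + 1 : ℕ), lab₁ (Γ (ρ t)) = .free := by
    intro t ht
    have h1 := Set.disjoint_left.1 hΓU₁ ⟨ρ t, hρmaps t ht, rfl⟩
    have h2 := Set.disjoint_left.1 hΓU₂ ⟨ρ t, hρmaps t ht, rfl⟩
    have h3 : lab (Γ (ρ t)) = .cell k := hmaps (hρmaps t ht)
    simp [lab₁, h1, h2, h3]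
  obtain ⟨vert', lab', hs', hv, hv', -, hlab'⟩ := (hs.congr hpiece).addPath hp hq hpq hm
    (Γ := fun t => Γ (ρ t)) (hΓ.comp hρc) (by simp only [hρ0, hΓ0]) (by simp only [hρ1, hΓ1])
    (fun s hs t ht hst => hρ.injective (hinj (hρmaps s hs) (hρmaps t ht) hst)) hfree
  have hmap : ∀ l : List ℕ, (∀ a ∈ l, a < M.size) → l.map vert = l.map vert' := fun l hl =>
    List.map_congr_left fun a ha => (hv a (hl a ha)).symm
  refine ⟨vert', lab', hs', ?_, ?_⟩
  · intro c hcm a ha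
    simp only [Mesh.chord, List.mem_append, List.mem_singleton] at hcm ⊢
    have hnew : ∀ a ∈ List.range' M.size m, a < M.size + m := by simp
    rcases hcm with hcm | rfl
    · rcases List.mem_or_eq_of_mem_set hcm with hcm | rfl
      · exact (hlt c hcm a ha).trans_le (Nat.le_add_right _ _)
      · simp only [List.mem_append, List.mem_reverse, List.mem_cons, List.not_mem_nil,
          or_false] at ha
        rcases ha with ha | rfl | ha | rfl
        · exact hnew a ha
        · omega
        · have := hltk a (by simp [ha]); omega
        · omega
    · simp only [List.mem_append, List.mem_cons] at ha
      rcases ha with ha | rfl | ha | rfl | ha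
      · have := hltk a (by simp [ha]); omega
      · omega
      · exact hnew a ha
      · omega
      · have := hltk a (by simp [ha]); omega
  · let ts : List ℝ := (List.range m).map fun j => ((j + 1 : ℕ) : ℝ) / (2 * (m + 1))
    have hts1 : ts.Pairwise (· < ·) := by
      simp only [ts, List.pairwise_map]
      refine List.pairwise_lt_range.imp fun {i j} hij => ?_
      gcongr
    have hts2 : ∀ t ∈ ts, 0 < t ∧ t < 1 / 2 := by
      simp only [ts, List.mem_map, List.mem_range]
      rintro _ ⟨j, hj, rfl⟩
      have : ((j + 1 : ℕ) : ℝ) ≤ m := by exact_mod_cast hj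
      refine ⟨by positivity, ?_⟩
      rw [div_lt_iff₀ hm1]
      linarith
    have htsmap : ts.map Γ = (List.range' M.size m).map vert' := by
      rw [List.range'_eq_map_range]
      simp only [ts, List.map_map]
      refine List.map_congr_left fun j hj => ?_
      have hj' := List.mem_range.1 hj
      simp only [Function.comp_apply]
      rw [hv' j hj', hρk _ (by omega)]
    obtain ⟨hc₁, hc₂⟩ := hts ts hts1 hts2
    rw [htsmap, ← hv p hp, ← hv q hq] at hc₁ hc₂
    rw [hmap l₂ (fun a ha => hltk a (by simp [ha]))] at hc₁
    rw [hmap l₁ (fun a ha => hltk a (by simp [ha])),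
      hmap l₃ (fun a ha => hltk a (by simp [ha]))] at hc₂
    have hlabU₁ : U₁ ⊆ {x | lab₁ x = .cell k} := fun x hx => if_pos hx
    have hlabU₂ : U₂ ⊆ {x | lab₁ x = .cell M.cells.length} := fun x hx => by
      have h1 : x ∉ U₁ := fun h => Set.disjoint_left.1 h12 h hx
      simp [lab₁, h1, hx]
    intro j hj
    simp only [hlab']
    simp only [Mesh.chord, List.length_append, List.length_set, List.length_singleton] at hj
    by_cases hjl : j < M.cells.length
    · have e : (M.chord k m l₁ p l₂ q l₃).cells[j] =
          (M.cells.set k ((List.range' M.size m).reverse ++ p :: (l₂ ++ [q])))[j]'(by simpa) :=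
        List.getElem_append_left (by simpa)
      rw [e]
      by_cases hjk : k = j
      · subst hjk
        rw [List.getElem_set_self]
        refine IsCell.mono ?_ hlabU₁
        simpa using hc₁
      · rw [List.getElem_set_ne hjk, ← hmap _ (hlt _ (List.getElem_mem hjl))]
        refine (hcell j hjl).mono fun x hx => ?_
        have hx' : lab x = .cell j := hx
        have hne : ∀ U : Set X, U ⊆ {x | lab x = .cell k} → x ∉ U := by
          intro U hU hxU
          have h2 : lab x = .cell k := hU hxU
          rw [hx', Label.cell.injEq] at h2
          exact hjk h2.symm
        have hjk' : j ≠ k := fun h => hjk h.symm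
        simp [lab₁, hne U₁ hU₁, hne U₂ hU₂, hx', hjk']
    · obtain rfl : j = M.cells.length := by omega
      have e : (M.chord k m l₁ p l₂ q l₃).cells[M.cells.length]'(by simp [Mesh.chord]) =
          l₁ ++ p :: (List.range' M.size m ++ q :: l₃) := by
        simp [Mesh.chord]
      rw [e]
      refine IsCell.mono ?_ hlabU₂
      simpa using hc₂

end Realizable

end CubicTorus

/-! ### The torus as a square glued with a half shift, and the boundary of the square as a hexagon.
-/

namespace CubicTorus

open Set unitInterval

/-- The covering map of the torus by the plane under which the unit square is a fundamental
domain whose upper side is glued to the lower one with a shift by one half. -/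
noncomputable def brick (z : ℝ × ℝ) : UnitAddCircle × UnitAddCircle :=
  (((z.1 - z.2 / 2 : ℝ) : UnitAddCircle), ((z.2 : ℝ) : UnitAddCircle))

theorem continuous_brick : Continuous brick := by
  unfold brick
  have : Continuous fun x : ℝ => (x : UnitAddCircle) := AddCircle.continuous_mk' 1
  fun_prop

theorem coe_injOn_Ico {x y : ℝ} (hx : x ∈ Ico (0 : ℝ) 1) (hy : y ∈ Ico (0 : ℝ) 1)
    (h : (x : UnitAddCircle) = y) : x = y := by
  have := (AddCircle.coe_eq_coe_iff_of_mem_Ico (p := (1 : ℝ)) (a := 0) (by simpa using hx)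
    (by simpa using hy)).1 h
  exact this

theorem brick_injOn : InjOn brick (Ico 0 1 ×ˢ Ico 0 1) := by
  rintro ⟨x, y⟩ ⟨hx, hy⟩ ⟨x', y'⟩ ⟨hx', hy'⟩ h
  simp only [brick, Prod.mk.injEq] at h
  obtain rfl : y = y' := coe_injOn_Ico hy hy' h.2
  have h1 : (x : UnitAddCircle) = x' := by
    have := h.1
    simpa using this
  exact Prod.ext (coe_injOn_Ico hx hx' h1) rfl

theorem brick_top (x : ℝ) : brick (x + 1 / 2, 1) = brick (x, 0) := by
  simp [brick]

theorem brick_right (x y : ℝ) : brick (x + 1, y) = brick (x, y) := by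
  simp only [brick, Prod.mk.injEq, and_true]
  rw [show x + 1 - y / 2 = x - y / 2 + 1 by ring, AddCircle.coe_add_period]

/-- A point moving around the boundary of the unit square, at the times `0`, `2`, `3`, `5`, `6`
being at the corners. -/
noncomputable def perimeter (s : ℝ) : ℝ × ℝ :=
  (max 0 (min (s / 2) 1) - max 0 (min ((s - 3) / 2) 1),
    max 0 (min (s - 2) 1) - max 0 (min (s - 5) 1))

theorem continuous_perimeter : Continuous perimeter := by
  unfold perimeter; fun_prop

theorem perimeter_bottom {s : ℝ} (h0 : 0 ≤ s) (h1 : s ≤ 2) : perimeter s = (s / 2, 0) := by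
  unfold perimeter
  rw [min_eq_left (by linarith), max_eq_right (by linarith), min_eq_left (by linarith),
    max_eq_left (by linarith), min_eq_left (by linarith), max_eq_left (by linarith),
    min_eq_left (by linarith), max_eq_left (by linarith)]
  simp

theorem perimeter_right {s : ℝ} (h0 : 2 ≤ s) (h1 : s ≤ 3) : perimeter s = (1, s - 2) := by
  unfold perimeter
  rw [min_eq_right (by linarith), max_eq_right (by linarith), min_eq_left (by linarith),
    max_eq_left (by linarith), min_eq_left (by linarith), max_eq_right (by linarith),
    min_eq_left (by linarith), max_eq_left (by linarith)]
  simp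

theorem perimeter_top {s : ℝ} (h0 : 3 ≤ s) (h1 : s ≤ 5) :
    perimeter s = (1 - (s - 3) / 2, 1) := by
  unfold perimeter
  rw [min_eq_right (by linarith), max_eq_right (by linarith), min_eq_left (by linarith),
    max_eq_right (by linarith), min_eq_right (by linarith), max_eq_right (by linarith),
    min_eq_left (by linarith), max_eq_left (by linarith)]
  simp

theorem perimeter_left {s : ℝ} (h0 : 5 ≤ s) (h1 : s ≤ 6) : perimeter s = (0, 6 - s) := by
  unfold perimeter
  rw [min_eq_right (by linarith), max_eq_right (by linarith), min_eq_right (by linarith),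
    max_eq_right (by linarith), min_eq_right (by linarith), max_eq_right (by linarith),
    min_eq_left (by linarith), max_eq_right (by linarith)]
  ext
  · simp
  · simp only; ring

theorem perimeter_cases {s : ℝ} (hs : s ∈ Ioo (0 : ℝ) 6) :
    (s ≤ 2 ∧ perimeter s = (s / 2, 0)) ∨ ((2 < s ∧ s ≤ 3) ∧ perimeter s = (1, s - 2)) ∨
      ((3 < s ∧ s ≤ 5) ∧ perimeter s = (1 - (s - 3) / 2, 1)) ∨
      (5 < s ∧ perimeter s = (0, 6 - s)) := by
  rcases le_or_gt s 2 with h | h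
  · exact Or.inl ⟨h, perimeter_bottom hs.1.le h⟩
  rcases le_or_gt s 3 with h' | h'
  · exact Or.inr (Or.inl ⟨⟨h, h'⟩, perimeter_right h.le h'⟩)
  rcases le_or_gt s 5 with h'' | h''
  · exact Or.inr (Or.inr (Or.inl ⟨⟨h', h''⟩, perimeter_top h'.le h''⟩))
  · exact Or.inr (Or.inr (Or.inr ⟨h'', perimeter_left h''.le hs.2.le⟩))

theorem perimeter_injOn : InjOn perimeter (Ioo 0 6) := by
  intro s hs t ht h
  have hs0 := hs.1
  have ht0 := ht.1
  rcases perimeter_cases hs with ⟨h1, e1⟩ | ⟨⟨h1, h1'⟩, e1⟩ | ⟨⟨h1, h1'⟩, e1⟩ | ⟨h1, e1⟩ <;>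
  rcases perimeter_cases ht with ⟨h2, e2⟩ | ⟨⟨h2, h2'⟩, e2⟩ | ⟨⟨h2, h2'⟩, e2⟩ | ⟨h2, e2⟩ <;>
  · rw [e1, e2, Prod.mk.injEq] at h
    obtain ⟨h3, h4⟩ := h
    linarith

/-- The boundary of the square is the sphere of radius `1 / 2` for the maximum norm about the
centre; shrinking it therefore sweeps out disjoint closed curves. -/
theorem perimeter_norm {s : ℝ} (hs : s ∈ Ioo (0 : ℝ) 6) :
    max |(perimeter s).1 - 1 / 2| |(perimeter s).2 - 1 / 2| = 1 / 2 := by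
  have hs0 := hs.1
  have hs6 := hs.2
  rcases perimeter_cases hs with ⟨h1, e1⟩ | ⟨⟨h1, h1'⟩, e1⟩ | ⟨⟨h1, h1'⟩, e1⟩ | ⟨h1, e1⟩ <;>
  rw [e1]
  · rw [max_eq_right]
    · norm_num
    · rw [abs_le]; norm_num; constructor <;> linarith
  · rw [max_eq_left]
    · norm_num
    · norm_num; rw [abs_le]; constructor <;> linarith
  · rw [max_eq_right]
    · norm_num
    · norm_num; rw [abs_le]; constructor <;> linarith
  · rw [max_eq_left]
    · norm_num
    · norm_num; rw [abs_le]; constructor <;> linarith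

/-- A collar of the boundary of the unit square, cut open at the corner `(0, 0)`. -/
noncomputable def collar (z : ℝ × ℝ) : ℝ × ℝ :=
  (1 / 2 + (1 - z.2 / 2) * ((perimeter z.1).1 - 1 / 2),
    1 / 2 + (1 - z.2 / 2) * ((perimeter z.1).2 - 1 / 2))

theorem continuous_collar : Continuous collar := by
  have := continuous_perimeter
  unfold collar; fun_prop

theorem collar_zero (s : ℝ) : collar (s, 0) = perimeter s := by
  simp [collar]

theorem collar_mem {z : ℝ × ℝ} (hz : z ∈ Ioo (0 : ℝ) 6 ×ˢ Ioo (0 : ℝ) 1) :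
    collar z ∈ Ioo (0 : ℝ) 1 ×ˢ Ioo (0 : ℝ) 1 := by
  have h1 := perimeter_norm hz.1
  have h2 := abs_le.1 ((le_max_left _ _).trans h1.le)
  have h3 := abs_le.1 ((le_max_right _ _).trans h1.le)
  obtain ⟨h4, h5⟩ := hz.2
  refine ⟨⟨?_, ?_⟩, ?_, ?_⟩ <;> simp only [collar] <;> nlinarith

/-- The distance from the centre in the maximum norm determines the second coordinate, after which
`perimeter` determines the first. A collar is enough, since a cell need not fill the whole face. -/
theorem collar_injOn : InjOn collar (Ioo (0 : ℝ) 6 ×ˢ Ioo (0 : ℝ) 1) := by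
  rintro ⟨s, r⟩ ⟨hs, hr⟩ ⟨s', r'⟩ ⟨hs', hr'⟩ h
  simp only [collar, Prod.mk.injEq, add_right_inj] at h
  obtain ⟨h1, h2⟩ := h
  have hr1 : 0 < 1 - r / 2 := by linarith [hr.2]
  have hr1' : 0 < 1 - r' / 2 := by linarith [hr'.2]
  have e : ∀ {s r : ℝ}, s ∈ Ioo (0 : ℝ) 6 → 0 < 1 - r / 2 →
      max |(1 - r / 2) * ((perimeter s).1 - 1 / 2)| |(1 - r / 2) * ((perimeter s).2 - 1 / 2)| =
        (1 - r / 2) * (1 / 2) := by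
    intro s r hs hr
    rw [abs_mul, abs_mul, abs_of_pos hr, ← mul_max_of_nonneg _ _ hr.le, perimeter_norm hs]
  have e1 := e hs hr1
  rw [h1, h2, e hs' hr1'] at e1
  obtain rfl : r = r' := by linarith
  have h3 := mul_left_cancel₀ hr1.ne' h1
  have h4 := mul_left_cancel₀ hr1.ne' h2
  exact Prod.ext (perimeter_injOn hs hs' (Prod.ext (by linarith) (by linarith))) rfl

/-- The theta graph with vertices `0` and `1` and three paths, with `a`, `b` and `c` inner
vertices, whose complement in the torus is one hexagonal cell. -/
def theta (a b c : ℕ) : Mesh where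
  size := 2 + a + b + c
  arcs := ([] ++ links (path 2 a 0 1)) ++ links (path (2 + a) b 1 0) ++
    links (path (2 + a + b) c 0 1)
  cells := [(path 2 a 0 1).dropLast ++ (path (2 + a) b 1 0).dropLast ++
    (path (2 + a + b) c 0 1).dropLast ++ (path 2 a 0 1).reverse.dropLast ++
    (path (2 + a) b 1 0).reverse.dropLast ++ (path (2 + a + b) c 0 1).reverse.dropLast]

/-- The last point of a side is omitted because it is the first point of the next side of the
hexagon. -/
theorem map_path_dropLast {X : Type*} {n m p q : ℕ} {vert : ℕ → X} {Γ : ℝ → X}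
    (h : ∀ k ≤ m + 1, vert (pathVertex n m p q k) = Γ k) :
    (path n m p q).dropLast.map vert = (List.range (m + 1)).map fun k : ℕ => Γ k := by
  refine List.ext_getElem (by simp [length_path]) fun k h1 h2 => ?_
  simp only [List.length_map, List.length_range] at h2
  simp [getElem_path, h k (by omega)]

theorem map_path_reverse_dropLast {X : Type*} {n m p q : ℕ} {vert : ℕ → X} {Γ : ℝ → X}
    (h : ∀ k ≤ m + 1, vert (pathVertex n m p q k) = Γ k) :
    (path n m p q).reverse.dropLast.map vert =
      (List.range (m + 1)).map fun k : ℕ => Γ ((m + 1 : ℕ) - k) := by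
  refine List.ext_getElem (by simp [length_path]) fun k h1 h2 => ?_
  simp only [List.length_map, List.length_range] at h2
  simp only [List.getElem_map, List.getElem_dropLast, List.getElem_reverse, getElem_path,
    length_path, List.getElem_range]
  rw [h _ (by omega)]
  congr 1
  rw [show m + 2 - 1 - k = m + 1 - k by omega, Nat.cast_sub (by omega)]

/-- The points dividing the interval from `j` to `j + 1` into `m + 1` equal parts. -/
noncomputable def ticks (j m : ℕ) : List ℝ :=
  (List.range (m + 1)).map fun k : ℕ => (j : ℝ) + k / (m + 1 : ℕ)

theorem mem_ticks {j m : ℕ} {x : ℝ} (h : x ∈ ticks j m) : (j : ℝ) ≤ x ∧ x < j + 1 := by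
  simp only [ticks, List.mem_map, List.mem_range] at h
  obtain ⟨k, hk, rfl⟩ := h
  have hk' : (k : ℝ) < (m + 1 : ℕ) := by exact_mod_cast hk
  have hpos : (0 : ℝ) < (m + 1 : ℕ) := by positivity
  have h1 : (k : ℝ) / (m + 1 : ℕ) < 1 := (div_lt_one hpos).2 hk'
  have h2 : (0 : ℝ) ≤ (k : ℝ) / (m + 1 : ℕ) := by positivity
  constructor <;> linarith

theorem pairwise_ticks (j m : ℕ) : (ticks j m).Pairwise (· < ·) := by
  simp only [ticks, List.pairwise_map]
  refine List.pairwise_lt_range.imp fun {s t} hst => ?_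
  gcongr

end CubicTorus

/-! ### The theta graph on the torus. -/

namespace CubicTorus

open Set unitInterval

theorem brick_eq {x y x' y' : ℝ} (h1 : 0 ≤ x) (h2 : x < 1) (h3 : 0 ≤ y) (h4 : y < 1) (h5 : 0 ≤ x')
    (h6 : x' < 1) (h7 : 0 ≤ y') (h8 : y' < 1) (h : brick (x, y) = brick (x', y')) :
    x = x' ∧ y = y' := by
  have := brick_injOn (x₁ := (x, y)) (x₂ := (x', y')) ⟨⟨h1, h2⟩, h3, h4⟩ ⟨⟨h5, h6⟩, h7, h8⟩ h
  simpa using this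

theorem brick_half_ne : brick (1 / 2, 0) ≠ brick (0, 0) := by
  intro h
  have := (brick_eq (by norm_num) (by norm_num) le_rfl one_pos le_rfl one_pos le_rfl one_pos h).1
  norm_num at this

/-- The positions of the two branch vertices of the theta graph. -/
noncomputable def branch (i : ℕ) : UnitAddCircle × UnitAddCircle :=
  if i = 0 then brick (0, 0) else brick (1 / 2, 0)

open Classical in
/-- The labelling of the torus by the two branch vertices and the open unit square. -/
noncomputable def branchLabel (x : UnitAddCircle × UnitAddCircle) : Label :=
  if x = brick (0, 0) then .piece s(0, 0) else if x = brick (1 / 2, 0) then .piece s(1, 1) else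
    if x ∈ brick '' (Ioo 0 1 ×ˢ Ioo 0 1) then .cell 0 else .free

theorem isSkeleton_branch : IsSkeleton 2 [] branch branchLabel := by
  refine ⟨?_, by simp, ?_, by simp⟩
  · intro x z hz i hi
    unfold branchLabel at hz
    split_ifs at hz
    · cases hz; simp at hi; omega
    · cases hz; simp at hi; omega
  · intro i hi x
    obtain rfl | rfl : i = 0 ∨ i = 1 := by omega
    · unfold branchLabel
      rw [branch, if_pos rfl]
      split_ifs with h1 h2 <;> simp [h1]
    · unfold branchLabel
      rw [branch, if_neg one_ne_zero]
      split_ifs with h1 h2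
      · rw [h1]
        exact iff_of_false (by simp) brick_half_ne.symm
      · exact iff_of_true rfl h2
      · exact iff_of_false (by simp) h2
      · exact iff_of_false (by simp) h2

theorem branchLabel_free {x y : ℝ} (h1 : 0 ≤ x) (h2 : x < 1) (h3 : 0 ≤ y) (h4 : y < 1)
    (h5 : x = 0 ∨ y = 0) (h6 : ¬ (x = 0 ∧ y = 0)) (h7 : ¬ (x = 1 / 2 ∧ y = 0)) :
    branchLabel (brick (x, y)) = .free := by
  unfold branchLabel
  rw [if_neg, if_neg, if_neg]
  · rintro ⟨⟨x', y'⟩, ⟨hx', hy'⟩, h⟩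
    have := brick_eq hx'.1.le hx'.2 hy'.1.le hy'.2 h1 h2 h3 h4 h
    have h8 : 0 < x' := hx'.1
    have h9 : 0 < y' := hy'.1
    rcases h5 with h5 | h5 <;> linarith
  · exact fun h => h7 (brick_eq h1 h2 h3 h4 (by norm_num) (by norm_num) le_rfl one_pos h)
  · exact fun h => h6 (brick_eq h1 h2 h3 h4 le_rfl one_pos le_rfl one_pos h)

theorem branchLabel_cell {z : ℝ × ℝ} (hz : z ∈ Ioo (0 : ℝ) 1 ×ˢ Ioo (0 : ℝ) 1) :
    branchLabel (brick z) = .cell 0 := by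
  obtain ⟨x, y⟩ := z
  have h8 : 0 < y := hz.2.1
  have hne : ∀ x' : ℝ, 0 ≤ x' → x' < 1 → brick (x, y) ≠ brick (x', 0) := fun x' h1 h2 h =>
    h8.ne' (brick_eq hz.1.1.le hz.1.2 hz.2.1.le hz.2.2 h1 h2 le_rfl one_pos h).2
  unfold branchLabel
  rw [if_neg (hne _ le_rfl one_pos), if_neg (hne _ (by norm_num) (by norm_num)),
    if_pos ⟨_, hz, rfl⟩]

theorem cast_succ_pos (m : ℕ) : (0 : ℝ) < (m + 1 : ℕ) := by positivity

theorem div_succ_mem {m : ℕ} {t : ℝ} (ht : t ∈ Ioo (0 : ℝ) (m + 1 : ℕ)) :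
    0 < t / (m + 1 : ℕ) ∧ t / (m + 1 : ℕ) < 1 :=
  ⟨div_pos ht.1 (cast_succ_pos m), (div_lt_one (cast_succ_pos m)).2 ht.2⟩

theorem div_succ_inj {m : ℕ} {s t : ℝ} (h : s / (m + 1 : ℕ) = t / (m + 1 : ℕ)) : s = t :=
  (div_left_inj' (cast_succ_pos m).ne').1 h

/-- The first side of the hexagonal cell, divided into `m + 1` equal parts. -/
noncomputable def sideA (m : ℕ) (t : ℝ) : UnitAddCircle × UnitAddCircle :=
  brick (t / (m + 1 : ℕ) / 2, 0)

/-- The second side of the hexagonal cell, divided into `m + 1` equal parts. -/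
noncomputable def sideB (m : ℕ) (t : ℝ) : UnitAddCircle × UnitAddCircle :=
  brick (1 / 2 + t / (m + 1 : ℕ) / 2, 0)

/-- The third side of the hexagonal cell, divided into `m + 1` equal parts. -/
noncomputable def sideC (m : ℕ) (t : ℝ) : UnitAddCircle × UnitAddCircle :=
  brick (0, t / (m + 1 : ℕ))

/-- The bottom of the square carries sides A and B, the right edge side C. By the half shift, the
top read from right to left is A and then B, each reversed, and the left edge read downwards is C
reversed. These are the six sides of the hexagon. -/
theorem map_perimeter_ticks (a b c : ℕ) :
    (ticks 0 a ++ ticks 1 b ++ ticks 2 c ++ ticks 3 a ++ ticks 4 b ++ ticks 5 c).map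
      (fun s => brick (perimeter s)) =
    (List.range (a + 1)).map (fun k : ℕ => sideA a k) ++
    (List.range (b + 1)).map (fun k : ℕ => sideB b k) ++
    (List.range (c + 1)).map (fun k : ℕ => sideC c k) ++
    (List.range (a + 1)).map (fun k : ℕ => sideA a ((a + 1 : ℕ) - k)) ++
    (List.range (b + 1)).map (fun k : ℕ => sideB b ((b + 1 : ℕ) - k)) ++
    (List.range (c + 1)).map (fun k : ℕ => sideC c ((c + 1 : ℕ) - k)) := by
  simp only [List.map_append, ticks, List.map_map]
  have hfrac : ∀ {m k : ℕ}, k ∈ List.range (m + 1) → (0 : ℝ) ≤ k / (m + 1 : ℕ) ∧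
      (k : ℝ) / (m + 1 : ℕ) ≤ 1 := by
    intro m k hk
    have : (k : ℝ) ≤ (m + 1 : ℕ) := by exact_mod_cast (List.mem_range.1 hk).le
    exact ⟨by positivity, (div_le_one (cast_succ_pos m)).2 this⟩
  have hsub : ∀ m k : ℕ, (((m + 1 : ℕ) : ℝ) - k) / (m + 1 : ℕ) = 1 - k / (m + 1 : ℕ) := by
    intro m k
    rw [sub_div, div_self (cast_succ_pos m).ne']
  congr 1
  · congr 1
    · congr 1
      · congr 1
        · congr 1
          · refine List.map_congr_left fun k hk => ?_
            have := hfrac hk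
            simp only [Function.comp_apply, sideA]
            rw [perimeter_bottom (by push_cast at this ⊢; linarith)
              (by push_cast at this ⊢; linarith)]
            simp
          · refine List.map_congr_left fun k hk => ?_
            have := hfrac hk
            simp only [Function.comp_apply, sideB]
            rw [perimeter_bottom (by push_cast at this ⊢; linarith)
              (by push_cast at this ⊢; linarith)]
            congr 2
            push_cast
            ring
        · refine List.map_congr_left fun k hk => ?_
          have := hfrac hk
          simp only [Function.comp_apply, sideC]
          rw [perimeter_right (by push_cast at this ⊢; linarith)
            (by push_cast at this ⊢; linarith)]
          rw [← zero_add (1 : ℝ), brick_right]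
          congr 2
          push_cast
          ring
      · refine List.map_congr_left fun k hk => ?_
        have := hfrac hk
        simp only [Function.comp_apply, sideA]
        rw [perimeter_top (by push_cast at this ⊢; linarith)
          (by push_cast at this ⊢; linarith), hsub, ← brick_top]
        congr 2
        push_cast
        ring
    · refine List.map_congr_left fun k hk => ?_
      have := hfrac hk
      simp only [Function.comp_apply, sideB]
      rw [perimeter_top (by push_cast at this ⊢; linarith)
        (by push_cast at this ⊢; linarith), hsub, ← brick_right, ← brick_top]
      congr 2
      push_cast
      ring
  · refine List.map_congr_left fun k hk => ?_
    have := hfrac hk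
    simp only [Function.comp_apply, sideC]
    rw [perimeter_left (by push_cast at this ⊢; linarith)
      (by push_cast at this ⊢; linarith), hsub]
    congr 2
    push_cast
    ring

/-- Starting from the two branch points alone, the three sides are added one at a time by
`IsSkeleton.addPath`. Each is still free when its turn comes, and none enters the open square, where
`collar` parametrizes the only cell. -/
theorem theta_realizable {a b c : ℕ} (ha : 0 < a) (hb : 0 < b) (hc : 0 < c) :
    (theta a b c).Realizable (UnitAddCircle × UnitAddCircle) := by
  have hΓ₁ : Continuous (sideA a) := continuous_brick.comp (by fun_prop)
  have hΓ₂ : Continuous (sideB b) := continuous_brick.comp (by fun_prop)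
  have hΓ₃ : Continuous (sideC c) := continuous_brick.comp (by fun_prop)
  have hbr1 : brick (1, 0) = brick (0, 0) := by simpa using brick_right 0 0
  -- Because of the half shift, the upper corners of the square are the second branch point, so side
  -- C joins different branch vertices.
  have hbr2 : brick (0, 1) = brick (1 / 2, 0) := by
    rw [← brick_right 0 1, ← brick_top (1 / 2)]
    norm_num
  have e₁₀ : (sideA a) 0 = brick (0, 0) := by simp [sideA]
  have e₁₁ : (sideA a) (a + 1 : ℕ) = brick (1 / 2, 0) := by simp only [sideA, div_self (cast_succ_pos a).ne']
  have e₂₀ : (sideB b) 0 = brick (1 / 2, 0) := by simp [sideB]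
  have e₂₁ : (sideB b) (b + 1 : ℕ) = brick (0, 0) := by
    simp only [sideB, div_self (cast_succ_pos b).ne', ← hbr1]
    norm_num
  have e₃₀ : (sideC c) 0 = brick (0, 0) := by simp [sideC]
  have e₃₁ : (sideC c) (c + 1 : ℕ) = brick (1 / 2, 0) := by
    simp only [sideC, div_self (cast_succ_pos c).ne', hbr2]
  have inj₁ : InjOn (sideA a) (Ioo 0 (a + 1 : ℕ)) := by
    intro s hs t ht h
    have hs' := div_succ_mem hs
    have ht' := div_succ_mem ht
    have := (brick_eq (by linarith) (by linarith) le_rfl one_pos (by linarith) (by linarith) le_rfl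
      one_pos h).1
    exact div_succ_inj (m := a) (by linarith)
  have inj₂ : InjOn (sideB b) (Ioo 0 (b + 1 : ℕ)) := by
    intro s hs t ht h
    have hs' := div_succ_mem hs
    have ht' := div_succ_mem ht
    have := (brick_eq (by linarith) (by linarith) le_rfl one_pos (by linarith) (by linarith) le_rfl
      one_pos h).1
    exact div_succ_inj (m := b) (by linarith)
  have inj₃ : InjOn (sideC c) (Ioo 0 (c + 1 : ℕ)) := by
    intro s hs t ht h
    have hs' := div_succ_mem hs
    have ht' := div_succ_mem ht
    have := (brick_eq le_rfl one_pos (by linarith) (by linarith) le_rfl one_pos (by linarith)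
      (by linarith) h).2
    exact div_succ_inj (m := c) this
  obtain ⟨vert₁, lab₁, sk₁, v₁, v₁', l₁, c₁⟩ := isSkeleton_branch.addPath (p := 0) (q := 1) (by norm_num)
    (by norm_num) (by norm_num) ha hΓ₁ (by simp [e₁₀, branch]) (by rw [e₁₁]; simp [branch]) inj₁
    (fun t ht => by
      have ht' := div_succ_mem ht
      refine branchLabel_free (by linarith) (by linarith) le_rfl one_pos (Or.inr rfl) ?_ ?_
      · rintro ⟨h, -⟩; linarith
      · rintro ⟨h, -⟩; linarith)
  have hl₁ : ∀ {x y : ℝ}, 0 ≤ x → x < 1 → 0 ≤ y → y < 1 → (1 / 2 < x ∨ 0 < y) →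
      lab₁ (brick (x, y)) = branchLabel (brick (x, y)) := by
    intro x y h1 h2 h3 h4 h5
    refine l₁ _ ?_
    rintro ⟨t, ht, h⟩
    have ht' := div_succ_mem ht
    have := brick_eq (by linarith) (by linarith) le_rfl one_pos h1 h2 h3 h4 h
    rcases h5 with h5 | h5 <;> linarith
  obtain ⟨vert₂, lab₂, sk₂, v₂, v₂', l₂, c₂⟩ := sk₁.addPath (p := 1) (q := 0) (by omega)
    (by omega) (by norm_num) hb hΓ₂ (by rw [v₁ _ (by norm_num), e₂₀]; simp [branch])
    (by rw [v₁ _ (by norm_num), e₂₁]; simp [branch]) inj₂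
    (fun t ht => by
      have ht' := div_succ_mem ht
      refine (hl₁ (by linarith) (by linarith) le_rfl one_pos (Or.inl (by linarith))).trans ?_
      refine branchLabel_free (by linarith) (by linarith) le_rfl one_pos (Or.inr rfl) ?_ ?_
      · rintro ⟨h, -⟩; linarith
      · rintro ⟨h, -⟩; linarith)
  have hl₂ : ∀ {x y : ℝ}, 0 ≤ x → x < 1 → 0 < y → y < 1 →
      lab₂ (brick (x, y)) = branchLabel (brick (x, y)) := by
    intro x y h1 h2 h3 h4
    rw [← hl₁ h1 h2 h3.le h4 (Or.inr h3)]
    refine l₂ _ ?_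
    rintro ⟨t, ht, h⟩
    have ht' := div_succ_mem ht
    have := brick_eq (by linarith) (by linarith) le_rfl one_pos h1 h2 h3.le h4 h
    linarith
  obtain ⟨vert₃, lab₃, sk₃, v₃, v₃', -, c₃⟩ := sk₂.addPath (p := 0) (q := 1) (by omega)
    (by omega) (by norm_num) hc hΓ₃
    (by rw [v₂ _ (by omega), v₁ _ (by norm_num), e₃₀]; simp [branch])
    (by rw [v₂ _ (by omega), v₁ _ (by norm_num), e₃₁]; simp [branch]) inj₃
    (fun t ht => by
      have ht' := div_succ_mem ht
      refine (hl₂ le_rfl one_pos ht'.1 ht'.2).trans ?_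
      refine branchLabel_free le_rfl one_pos ht'.1.le ht'.2 (Or.inl rfl) ?_ ?_
      · rintro ⟨-, h⟩; linarith
      · rintro ⟨-, h⟩; linarith)
  have hv0 : vert₃ 0 = brick (0, 0) := by
    rw [v₃ _ (by omega), v₂ _ (by omega), v₁ _ (by norm_num)]; simp [branch]
  have hv1 : vert₃ 1 = brick (1 / 2, 0) := by
    rw [v₃ _ (by omega), v₂ _ (by omega), v₁ _ (by norm_num)]; simp [branch]
  have p₁ : ∀ k ≤ a + 1, vert₃ (pathVertex 2 a 0 1 k) = (sideA a) k := by
    intro k hk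
    simp only [pathVertex]
    split_ifs with h1 h2
    · rw [hv0, h1, Nat.cast_zero, e₁₀]
    · rw [v₃ _ (by omega), v₂ _ (by omega), v₁' _ (by omega)]
      congr 2
      omega
    · rw [hv1, ← e₁₁]
      congr 2
      omega
  have p₂ : ∀ k ≤ b + 1, vert₃ (pathVertex (2 + a) b 1 0 k) = (sideB b) k := by
    intro k hk
    simp only [pathVertex]
    split_ifs with h1 h2
    · rw [hv1, h1, Nat.cast_zero, e₂₀]
    · rw [v₃ _ (by omega), v₂' _ (by omega)]
      congr 2
      omega
    · rw [hv0, ← e₂₁]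
      congr 2
      omega
  have p₃ : ∀ k ≤ c + 1, vert₃ (pathVertex (2 + a + b) c 0 1 k) = (sideC c) k := by
    intro k hk
    simp only [pathVertex]
    split_ifs with h1 h2
    · rw [hv0, h1, Nat.cast_zero, e₃₀]
    · rw [v₃' _ (by omega)]
      congr 2
      omega
    · rw [hv1, ← e₃₁]
      congr 2
      omega
  have hcell₃ : ∀ x, lab₃ x = .cell 0 ↔ branchLabel x = .cell 0 := fun x =>
    (c₃ x 0).trans ((c₂ x 0).trans (c₁ x 0))
  refine ⟨vert₃, lab₃, sk₃, ?_, ?_⟩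
  · have hlt : ∀ {n m p q i N : ℕ}, i ∈ path n m p q → p < N → q < N → n + m ≤ N → i < N := by
      intro n m p q i N hi hp hq hN
      simp only [path, List.mem_cons, List.mem_append, List.mem_range'_1, List.not_mem_nil,
        or_false] at hi
      omega
    intro l hl i hi
    simp only [theta, List.mem_singleton] at hl
    subst hl
    simp only [List.mem_append] at hi
    change i < 2 + a + b + c
    rcases hi with ((((hi | hi) | hi) | hi) | hi) | hi
    · exact hlt (List.mem_of_mem_dropLast hi) (by omega) (by omega) (by omega)
    · exact hlt (List.mem_of_mem_dropLast hi) (by omega) (by omega) (by omega)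
    · exact hlt (List.mem_of_mem_dropLast hi) (by omega) (by omega) (by omega)
    · exact hlt (List.mem_reverse.1 (List.mem_of_mem_dropLast hi)) (by omega) (by omega) (by omega)
    · exact hlt (List.mem_reverse.1 (List.mem_of_mem_dropLast hi)) (by omega) (by omega) (by omega)
    · exact hlt (List.mem_reverse.1 (List.mem_of_mem_dropLast hi)) (by omega) (by omega) (by omega)
  · intro k hk
    obtain rfl : k = 0 := by simpa [theta] using hk
    refine ⟨fun z => brick (collar z), 0, 6, ticks 0 a ++ ticks 1 b ++ ticks 2 c ++ ticks 3 a ++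
      ticks 4 b ++ ticks 5 c, continuous_brick.comp continuous_collar, ?_, ?_, ?_, ?_, ?_⟩
    · intro z hz z' hz' h
      have hsub : ∀ {u : ℝ × ℝ}, u ∈ Ioo (0 : ℝ) 1 ×ˢ Ioo (0 : ℝ) 1 →
          u ∈ Ico (0 : ℝ) 1 ×ˢ Ico (0 : ℝ) 1 := fun hu =>
        ⟨Ioo_subset_Ico_self hu.1, Ioo_subset_Ico_self hu.2⟩
      exact collar_injOn hz hz' (brick_injOn (hsub (collar_mem hz)) (hsub (collar_mem hz')) h)
    · intro z hz
      exact (hcell₃ _).2 (branchLabel_cell (collar_mem hz))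
    · have key : ∀ {l l' : List ℝ} {j : ℝ}, l.Pairwise (· < ·) → l'.Pairwise (· < ·) →
          (∀ x ∈ l, x < j) → (∀ x ∈ l', j ≤ x) → (l ++ l').Pairwise (· < ·) := by
        intro l l' j h1 h2 h3 h4
        exact List.pairwise_append.2 ⟨h1, h2, fun x hx y hy => (h3 x hx).trans_le (h4 y hy)⟩
      have hub : ∀ {l : List ℝ} {j m : ℕ}, (∀ x ∈ l, x < (j : ℝ)) →
          ∀ x ∈ l ++ ticks j m, x < ((j + 1 : ℕ) : ℝ) := by
        intro l j m h x hx
        push_cast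
        rcases List.mem_append.1 hx with hx | hx
        · linarith [h x hx]
        · exact (mem_ticks hx).2
      have u0 : ∀ x ∈ ticks 0 a, x < ((1 : ℕ) : ℝ) := fun x hx => by
        simpa using (mem_ticks hx).2
      have u1 := hub (j := 1) (m := b) u0
      have u2 := hub (j := 2) (m := c) u1
      have u3 := hub (j := 3) (m := a) u2
      have u4 := hub (j := 4) (m := b) u3
      exact key (key (key (key (key (pairwise_ticks _ _) (pairwise_ticks _ _) u0
        fun x hx => (mem_ticks hx).1) (pairwise_ticks _ _) u1 fun x hx => (mem_ticks hx).1)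
        (pairwise_ticks _ _) u2 fun x hx => (mem_ticks hx).1) (pairwise_ticks _ _) u3
        fun x hx => (mem_ticks hx).1) (pairwise_ticks _ _) u4 fun x hx => (mem_ticks hx).1
    · intro x hx
      have hb' : ∀ {j m : ℕ}, j < 6 → x ∈ ticks j m → x ∈ Icc (0 : ℝ) 6 := by
        intro j m hj h
        have h1 := mem_ticks h
        have h2 : ((j + 1 : ℕ) : ℝ) ≤ ((6 : ℕ) : ℝ) := by exact_mod_cast hj
        push_cast at h2
        have h3 : (0 : ℝ) ≤ j := Nat.cast_nonneg j
        constructor <;> linarith [h1.1, h1.2]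
      simp only [List.mem_append] at hx
      rcases hx with ((((hx | hx) | hx) | hx) | hx) | hx <;> exact hb' (by norm_num) hx
    · simp only [collar_zero]
      rw [map_perimeter_ticks]
      simp only [theta, List.getElem_cons_zero, List.map_append,
        map_path_dropLast p₁, map_path_dropLast p₂, map_path_dropLast p₃,
        map_path_reverse_dropLast p₁, map_path_reverse_dropLast p₂, map_path_reverse_dropLast p₃]

end CubicTorus

/-! ### From a combinatorial drawing to an embedding. -/

namespace CubicTorus

open Set
open scoped Graph

/-- The arcs and the inner vertices of a path, given by its vertices. -/
def pieces : List ℕ → List (Sym2 ℕ)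
  | a :: b :: c :: t => s(a, b) :: s(b, b) :: pieces (b :: c :: t)
  | [a, b] => [s(a, b)]
  | _ => []

/-- Cutting a path at an inner vertex only releases the piece of that vertex. -/
theorem pieces_append {l r : List ℕ} {p : ℕ} (hl : l ≠ []) (hr : r ≠ []) :
    pieces (l ++ p :: r) = pieces (l ++ [p]) ++ s(p, p) :: pieces (p :: r) := by
  obtain ⟨c, t, rfl⟩ := List.exists_cons_of_ne_nil hr
  induction l with
  | nil => exact absurd rfl hl
  | cons a l ih =>
    match l with
    | [] => simp [pieces]
    | [b] => simp [pieces]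
    | b :: d :: l => simpa [pieces] using ih

theorem mem_of_mem_pieces : ∀ {l : List ℕ} {z : Sym2 ℕ}, z ∈ pieces l → ∀ a ∈ z, a ∈ l
  | a :: b :: c :: t, z, hz, d, hd => by
    simp only [pieces, List.mem_cons] at hz
    rcases hz with rfl | rfl | hz
    · rcases Sym2.mem_iff.1 hd with rfl | rfl <;> simp
    · rcases Sym2.mem_iff.1 hd with rfl | rfl <;> simp
    · exact List.mem_cons_of_mem _ (mem_of_mem_pieces hz d hd)
  | [a, b], z, hz, d, hd => by
    simp only [pieces, List.mem_singleton] at hz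
    subst hz
    simpa using hd
  | [a], z, hz, d, hd => by simp [pieces] at hz
  | [], z, hz, d, hd => by simp [pieces] at hz

theorem pieces_subset : ∀ {l : List ℕ} {z : Sym2 ℕ}, z ∈ pieces l →
    z ∈ links l ∨ ∃ a ∈ l, z = s(a, a)
  | a :: b :: c :: t, z, hz => by
    simp only [pieces, List.mem_cons] at hz
    rcases hz with rfl | rfl | hz
    · left; simp [links]
    · right; exact ⟨b, by simp, rfl⟩
    · rcases pieces_subset hz with h | ⟨d, hd, h⟩
      · left; exact List.mem_cons_of_mem _ h
      · right; exact ⟨d, List.mem_cons_of_mem _ hd, h⟩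
  | [a, b], z, hz => by
    left
    simpa [pieces, links] using hz
  | [a], z, hz => by simp [pieces] at hz
  | [], z, hz => by simp [pieces] at hz

theorem nodup_pieces : ∀ {l : List ℕ}, l.Nodup → (pieces l).Nodup
  | a :: b :: c :: t, h => by
    have h1 := nodup_pieces (List.nodup_cons.1 h).2
    have ha := (List.nodup_cons.1 h).1
    have hb := (List.nodup_cons.1 (List.nodup_cons.1 h).2).1
    have hab : a ≠ b := fun e => ha (by simp [e])
    simp only [pieces, List.nodup_cons, List.mem_cons, not_or]
    refine ⟨⟨?_, fun hz => ha (mem_of_mem_pieces hz a (by simp))⟩, ?_, h1⟩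
    · simpa using hab
    · intro hz
      have hbc : b ≠ c := fun e => hb (by simp [e])
      match t with
      | [] => simp [pieces, hbc] at hz
      | d :: t =>
        simp only [pieces, List.mem_cons] at hz
        rcases hz with hz | hz | hz
        · simp [hbc] at hz
        · simp [hbc] at hz
        · exact hb (mem_of_mem_pieces hz b (by simp))
  | [a, b], _ => by simp [pieces]
  | [a], _ => by simp [pieces]
  | [], _ => by simp [pieces]

theorem exists_inner_mem_of_mem_pieces {l : List ℕ} (hl : l ≠ []) {p q : ℕ} {z : Sym2 ℕ}
    (hz : z ∈ pieces (p :: (l ++ [q]))) : ∃ a ∈ z, a ∈ l := by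
  induction l generalizing p with
  | nil => exact absurd rfl hl
  | cons b l ih =>
    match l with
    | [] =>
      simp only [List.cons_append, List.nil_append, pieces, List.mem_cons, List.not_mem_nil,
        or_false] at hz
      refine ⟨b, ?_, by simp⟩
      rcases hz with rfl | rfl | rfl <;> simp
    | c :: l =>
      simp only [List.cons_append, pieces, List.mem_cons] at hz
      rcases hz with rfl | rfl | hz
      · exact ⟨b, by simp, by simp⟩
      · exact ⟨b, by simp, by simp⟩
      · obtain ⟨a, ha, ha'⟩ := ih (by simp) hz
        exact ⟨a, ha, List.mem_cons_of_mem _ ha'⟩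

/-- The piece `z` is an arc or a vertex of `M`. -/
def Mesh.HasPiece (M : Mesh) (z : Sym2 ℕ) : Prop := z ∈ M.arcs ∨ ∃ a < M.size, z = s(a, a)

/-- Arcs are concatenated along the path by `OpenArc.trans`. Only the starting vertex is required to
be absent from the pieces; the last vertex may equal it, so closed paths are covered. -/
theorem IsSkeleton.openArc_pieces {X : Type*} [TopologicalSpace X] {M : Mesh} {vert : ℕ → X}
    {lab : X → Label} (h : IsSkeleton M.size M.arcs vert lab) :
    ∀ (l : List ℕ) (a : ℕ), l ≠ [] → (s(a, a) :: pieces (a :: l)).Nodup →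
      (∀ z ∈ pieces (a :: l), M.HasPiece z) →
      OpenArc {x | ∃ z ∈ pieces (a :: l), lab x = .piece z} (vert a) (vert (l.getLastD 0)) := by
  have harc : ∀ a b, M.HasPiece s(a, b) → a ≠ b →
      OpenArc {x | lab x = .piece s(a, b)} (vert a) (vert b) := by
    rintro a b (hz | ⟨d, -, hd⟩) hab
    · exact h.openArc a b hz
    · rcases Sym2.eq_iff.1 hd with ⟨rfl, rfl⟩ | ⟨rfl, rfl⟩ <;> exact absurd rfl hab
  have hne : ∀ {a b : ℕ} {t : List (Sym2 ℕ)}, (s(a, a) :: s(a, b) :: t).Nodup → a ≠ b := by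
    rintro a b t hn rfl
    simp at hn
  intro l
  induction l with
  | nil => intro a hl; exact absurd rfl hl
  | cons b l ih =>
    intro a _ hn hz
    match l with
    | [] =>
      simp only [pieces, List.mem_singleton, exists_eq_left] at hn hz ⊢
      exact harc a b (hz _ rfl) (hne hn)
    | c :: l =>
      simp only [pieces] at hn hz
      have hn' := (List.nodup_cons.1 (List.nodup_cons.1 hn).2)
      have h1 := harc a b (hz _ (by simp)) (hne hn)
      have h2 := ih b (by simp) hn'.2 fun z hz' => hz z (by simp [hz'])
      obtain ⟨b', hb', hb''⟩ : ∃ d < M.size, s(b, b) = s(d, d) := by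
        rcases hz s(b, b) (by simp) with hb | hb
        · exact ⟨b, h.arcs_lt _ hb b (by simp), rfl⟩
        · exact hb
      obtain rfl : b = b' := by simpa using hb''
      have hvb := h.lab_eq_vertex b hb'
      have e : {x | ∃ z ∈ pieces (a :: b :: c :: l), lab x = .piece z} =
          {x | lab x = .piece s(a, b)} ∪
            ({vert b} ∪ {x | ∃ z ∈ pieces (b :: c :: l), lab x = .piece z}) := by
        ext x
        simp [pieces, hvb]
        tauto
      rw [e]
      have hb := (hvb (vert b)).2 rfl
      refine h1.trans h2 ?_ ?_ ?_
      · rw [Set.disjoint_left]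
        rintro x hx ⟨z, hz', hx'⟩
        have hx : lab x = .piece s(a, b) := hx
        rw [hx, Label.piece.injEq] at hx'
        subst hx'
        exact hn'.1 (List.mem_cons_of_mem _ hz')
      · intro hx
        have hx : lab (vert b) = .piece s(a, b) := hx
        rw [hb, Label.piece.injEq] at hx
        exact hn'.1 (by simp [← hx])
      · rintro ⟨z, hz', hx⟩
        rw [hb, Label.piece.injEq] at hx
        subst hx
        exact (List.nodup_cons.1 hn'.2).1 hz'

/-- The list of all pieces used by the vertices `V` and the paths `D`. -/
def allPieces (V : List ℕ) (D : List (List ℕ)) : List (Sym2 ℕ) :=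
  V.map (fun a => s(a, a)) ++ D.flatMap pieces

/-- The vertices `V` and the paths `D` form a drawing of a graph inside the mesh `M`. -/
structure Drawn (M : Mesh) (V : List ℕ) (D : List (List ℕ)) : Prop where
  nodup : (allPieces V D).Nodup
  hasPiece : ∀ z ∈ allPieces V D, M.HasPiece z
  two_le : ∀ l ∈ D, 2 ≤ l.length

/-- The two ends of a path. -/
def ends (l : List ℕ) : ℕ × ℕ := (l.headD 0, l.getLastD 0)

/-- The graph `K` has the vertices `v a`, for `a` in `V`, and the edges `es`, whose ends are
listed in `L`. -/
structure Presents {α β : Type*} (K : Graph α β) (v : ℕ → α) (es : List β) (V : List ℕ)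
    (L : List (ℕ × ℕ)) : Prop where
  injOn : InjOn v {a | a ∈ V}
  vertexSet : V(K) = v '' {a | a ∈ V}
  nodup : es.Nodup
  edgeSet : E(K) = {e | e ∈ es}
  isLink : List.Forall₂ (fun e z => K.IsLink e (v z.1) (v z.2)) es L
  mem : ∀ z ∈ L, z.1 ∈ V ∧ z.2 ∈ V

/-- A point has only one label, so paths with no piece in common occupy disjoint sets. The absence
of repetitions in `allPieces` thus supplies all the disjointness conditions of an embedding, and
injectivity along each edge. -/
theorem Drawn.nonempty_embedding {X : Type*} [TopologicalSpace X] {M : Mesh} {V : List ℕ}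
    {D : List (List ℕ)} (hM : M.Realizable X) (hD : Drawn M V D) {α β : Type*} {K : Graph α β}
    {v : ℕ → α} {es : List β} (hK : Presents K v es V (D.map ends)) :
    Nonempty (Embedding K X) := by
  obtain ⟨vert, lab, hs, -, -⟩ := hM
  have hnd := List.nodup_append.1 hD.nodup
  have hVlt : ∀ a ∈ V, a < M.size := by
    intro a ha
    rcases hD.hasPiece s(a, a) (List.mem_append_left _ (List.mem_map_of_mem ha)) with h | ⟨d, hd, h⟩
    · exact hs.arcs_lt _ h a (by simp)
    · obtain rfl : a = d := by simpa using h
      exact hd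
  have hlen : es.length = D.length := by simpa using hK.isLink.length_eq
  have hlink : ∀ (i : ℕ) (hi : i < es.length) (hi' : i < D.length),
      K.IsLink es[i] (v (ends D[i]).1) (v (ends D[i]).2) := by
    intro i hi hi'
    have := (List.forall₂_iff_get.1 hK.isLink).2 i hi (by simpa using hi')
    simpa using this
  have hVends : ∀ (i : ℕ) (hi' : i < D.length), (ends D[i]).1 ∈ V ∧ (ends D[i]).2 ∈ V :=
    fun i hi' => hK.mem _ (List.mem_map_of_mem (List.getElem_mem hi'))
  -- the open arcs of the edges
  let S : ℕ → Set X := fun i => {x | ∃ z ∈ pieces (D.getD i []), lab x = .piece z}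
  have hS : ∀ (i : ℕ) (hi' : i < D.length),
      OpenArc (S i) (vert (ends D[i]).1) (vert (ends D[i]).2) := by
    intro i hi'
    have hmem := List.getElem_mem hi'
    have h2 := hD.two_le _ hmem
    have h3 := (hVends i hi').1
    have h4 : (pieces D[i]).Nodup := (List.nodup_flatMap.1 hnd.2.1).1 _ hmem
    have h5 : ∀ z ∈ pieces D[i], z ∈ D.flatMap pieces := fun z hz =>
      List.mem_flatMap.2 ⟨_, hmem, hz⟩
    simp only [S, List.getD_eq_getElem _ _ hi']
    generalize D[i] = d at *
    match d, h2 with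
    | a :: b :: l, _ =>
      refine hs.openArc_pieces (b :: l) a (by simp) (List.nodup_cons.2 ⟨fun hz => ?_, h4⟩) ?_
      · exact hnd.2.2 _ (List.mem_map_of_mem h3) _ (h5 _ hz) rfl
      · exact fun z hz => hD.hasPiece z (List.mem_append_right _ (h5 z hz))
  have hSV : ∀ (i : ℕ) (hi' : i < D.length), ∀ a ∈ V, vert a ∉ S i := by
    rintro i hi' a ha ⟨z, hz, hx⟩
    rw [(hs.lab_eq_vertex a (hVlt a ha) _).2 rfl, Label.piece.injEq] at hx
    rw [List.getD_eq_getElem _ _ hi'] at hz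
    exact hnd.2.2 _ (List.mem_map_of_mem ha) _
      (List.mem_flatMap.2 ⟨_, List.getElem_mem hi', hz⟩) hx
  have hSS : ∀ (i j : ℕ), i < D.length → j < D.length → i ≠ j → Disjoint (S i) (S j) := by
    have key : ∀ (i j : ℕ), i < D.length → j < D.length → i < j → Disjoint (S i) (S j) := by
      intro i j hi hj hij
      have hd := List.pairwise_iff_getElem.1 (List.nodup_flatMap.1 hnd.2.1).2 i j hi hj hij
      rw [Set.disjoint_left]
      rintro x ⟨z, hz, hx⟩ ⟨z', hz', hx'⟩
      rw [List.getD_eq_getElem _ _ hi] at hz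
      rw [List.getD_eq_getElem _ _ hj] at hz'
      rw [hx, Label.piece.injEq] at hx'
      exact hd hz (hx' ▸ hz')
    intro i j hi hj hij
    rcases lt_or_gt_of_ne hij with h | h
    · exact key i j hi hj h
    · exact (key j i hj hi h).symm
  have hidx : ∀ e : E(K), ∃ (i : ℕ) (hi : i < es.length), es[i] = e := by
    rintro ⟨e, he⟩
    rw [hK.edgeSet] at he
    exact List.mem_iff_getElem.1 he
  choose idx hidx hes using hidx
  have hvx : ∀ x : V(K), ∃ a ∈ V, v a = x := by
    rintro ⟨x, hx⟩
    rw [hK.vertexSet] at hx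
    exact hx
  choose num hnum hv using hvx
  have hnumeq : ∀ (x : V(K)) (a : ℕ), a ∈ V → v a = x → a = num x := fun x a ha hx =>
    hK.injOn ha (hnum x) (hx.trans (hv x).symm)
  have hvinj : ∀ a ∈ V, ∀ b ∈ V, vert a = vert b → a = b := by
    intro a ha b hb hab
    have h1 := (hs.lab_eq_vertex a (hVlt a ha) _).2 rfl
    have h2 := (hs.lab_eq_vertex b (hVlt b hb) _).2 hab
    rw [h1, Label.piece.injEq] at h2
    simpa using h2
  have hidx' : ∀ e, idx e < D.length := fun e => hlen ▸ hidx e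
  choose γ hγ0 hγ1 hγinj hγS using fun e : E(K) => hS (idx e) (hidx' e)
  have hγmem : ∀ e, ∀ t ∈ Ioo (0 : unitInterval) 1, γ e t ∈ S (idx e) := fun e t ht =>
    hγS e ▸ mem_image_of_mem _ ht
  refine ⟨⟨fun x => vert (num x), γ, ?_, ?_, hγinj, ?_, ?_⟩⟩
  · intro x y hxy
    have := hvinj _ (hnum x) _ (hnum y) hxy
    exact Subtype.ext ((hv x).symm.trans (this ▸ hv y))
  · intro e x y hxy
    have h1 := hlink (idx e) (hidx e) (hidx' e)
    rw [hes e] at h1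
    have hm := hVends (idx e) (hidx' e)
    rw [hγ0, hγ1]
    rcases hxy.eq_and_eq_or_eq_and_eq h1 with ⟨h2, h3⟩ | ⟨h2, h3⟩
    · rw [hnumeq x _ hm.1 h2.symm, hnumeq y _ hm.2 h3.symm]
    · rw [hnumeq x _ hm.2 h2.symm, hnumeq y _ hm.1 h3.symm, Sym2.eq_swap]
  · intro e t ht x hx
    exact hSV (idx e) (hidx' e) (num x) (hnum x) (hx ▸ hγmem e t ht)
  · intro e f hef s hs' t ht h
    have hij : idx e ≠ idx f := by
      intro h
      apply hef
      apply Subtype.ext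
      rw [← hes e, ← hes f]
      simp [h]
    exact Set.disjoint_left.1 (hSS _ _ (hidx' e) (hidx' f) hij) (hγmem e s hs')
      (h ▸ hγmem f t ht)

end CubicTorus

/-! ### Edge lists, and the effect of adding an edge. -/

namespace CubicTorus

open Set Function
open scoped Graph

/-- Subdivide the edge number `i` by the new vertex `p`. -/
def subdivide (L : List (ℕ × ℕ)) (i p : ℕ) : List (ℕ × ℕ) :=
  L.set i ((L.getD i (0, 0)).1, p) ++ [(p, (L.getD i (0, 0)).2)]

/-- Subdivide the edges number `i` and `j` by `p` and `q`, and join these vertices. -/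
def addChord (L : List (ℕ × ℕ)) (i j p q : ℕ) : List (ℕ × ℕ) :=
  subdivide (subdivide L i p) j q ++ [(p, q)]

/-- Subdivide the edge number `i` by `p`, and attach to `p` an edge ending in a loop at `q`. -/
def addLoop (L : List (ℕ × ℕ)) (i p q : ℕ) : List (ℕ × ℕ) :=
  subdivide L i p ++ [(p, q)] ++ [(q, q)]

theorem subdivide_append (A B : List (ℕ × ℕ)) (x y p : ℕ) :
    subdivide (A ++ (x, y) :: B) A.length p = A ++ (x, p) :: B ++ [(p, y)] := by
  simp [subdivide]

section Presents

variable {α β : Type*} {G K : Graph α β} {v : ℕ → α} {es : List β} {V : List ℕ} {L : List (ℕ × ℕ)}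

theorem Presents.update (h : Presents G v es V L) {p : ℕ} (hp : p ∉ V) {u : α} :
    (∀ a ∈ V, Function.update v p u a = v a) ∧ (u ∉ V(G) →
      InjOn (Function.update v p u) {a | a ∈ V ++ [p]}) ∧
      Function.update v p u '' {a | a ∈ V ++ [p]} = insert u V(G) := by
  have h1 : ∀ a ∈ V, Function.update v p u a = v a := fun a ha =>
    Function.update_of_ne (fun e : a = p => hp (e ▸ ha)) _ _
  have h2 : Function.update v p u p = u := Function.update_self _ _ _
  refine ⟨h1, ?_, ?_⟩
  · intro hu a ha b hb hab
    have hmem : ∀ a ∈ V, v a ≠ u := fun a ha e => hu (by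
      rw [h.vertexSet, ← e]
      exact mem_image_of_mem _ ha)
    simp only [List.mem_append, List.mem_singleton, mem_ofPred_eq] at ha hb
    rcases ha with ha | rfl <;> rcases hb with hb | rfl
    · rw [h1 a ha, h1 b hb] at hab
      exact h.injOn ha hb hab
    · rw [h1 a ha, h2] at hab
      exact absurd hab (hmem a ha)
    · rw [h1 b hb, h2] at hab
      exact absurd hab.symm (hmem b hb)
    · rfl
  · rw [h.vertexSet]
    ext x
    simp only [mem_image, List.mem_append, List.mem_singleton, mem_ofPred_eq, mem_insert_iff]
    constructor
    · rintro ⟨a, ha | rfl, rfl⟩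
      · exact Or.inr ⟨a, ha, (h1 a ha).symm⟩
      · exact Or.inl h2
    · rintro (rfl | ⟨a, ha, rfl⟩)
      · exact ⟨p, Or.inr rfl, h2⟩
      · exact ⟨a, Or.inl ha, h1 a ha⟩

/-- In the list, the half at the first listed end keeps the index of the edge and the other half
comes last. The edge list `es'` does not depend on the name `p` of the new vertex, so `p` can be
chosen later to be a vertex of a drawing. -/
theorem Presents.subdivide [DecidableEq β] (h : Presents G v es V L) {e : β} {u : α}
    (hS : IsSubdivision G K e u) :
    es.idxOf e < L.length ∧ ∃ es', ∀ p ∉ V,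
      Presents K (Function.update v p u) es' (V ++ [p]) (subdivide L (es.idxOf e) p) := by
  obtain ⟨x, y, e', hxy, hu, he', hVK, hK⟩ := hS
  have hees : e ∈ es := by
    have := hxy.edge_mem
    rwa [h.edgeSet] at this
  have he'es : e' ∉ es := by rwa [h.edgeSet] at he'
  obtain ⟨A, B, rfl, hA⟩ := List.eq_append_cons_of_mem hees
  obtain ⟨L₁, L₂, hL₁, hL₂, rfl⟩ : ∃ L₁ L₂,
      List.Forall₂ (fun e z => G.IsLink e (v z.1) (v z.2)) A L₁ ∧
      List.Forall₂ (fun e z => G.IsLink e (v z.1) (v z.2)) (e :: B) L₂ ∧ L = L₁ ++ L₂ := by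
    have h1 := List.forall₂_take A.length h.isLink
    have h2 := List.forall₂_drop A.length h.isLink
    rw [List.take_left] at h1
    rw [List.drop_left] at h2
    exact ⟨_, _, h1, h2, (List.take_append_drop _ _).symm⟩
  obtain ⟨⟨x₀, y₀⟩, B', hlink, hB, rfl⟩ := List.forall₂_cons_left_iff.1 hL₂
  have hidx : (A ++ e :: B).idxOf e = L₁.length := by
    rw [List.idxOf_append_of_notMem hA, List.idxOf_cons_self, hL₁.length_eq, add_zero]
  rw [hidx]
  refine ⟨by simp, ?_⟩
  have hmemV := h.mem
  have hedge : E(K) = {f | f ∈ e' :: (A ++ e :: B)} := by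
    ext f
    rw [mem_ofPred_eq, List.mem_cons]
    have hE : f ∈ E(G) ↔ f ∈ A ++ e :: B := by rw [h.edgeSet]; rfl
    rw [← hE, Graph.edge_mem_iff_exists_isLink, Graph.edge_mem_iff_exists_isLink]
    constructor
    · rintro ⟨a, b, hab⟩
      rcases (hK f a b).1 hab with ⟨-, h1⟩ | ⟨rfl, -⟩ | ⟨rfl, -⟩
      · exact Or.inr ⟨a, b, h1⟩
      · exact Or.inr ⟨_, _, hxy⟩
      · exact Or.inl rfl
    · rintro (rfl | ⟨a, b, hab⟩)
      · exact ⟨u, y, (hK _ _ _).2 (Or.inr (Or.inr ⟨rfl, rfl⟩))⟩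
      · by_cases hfe : f = e
        · exact ⟨x, u, (hK _ _ _).2 (Or.inr (Or.inl ⟨hfe, rfl⟩))⟩
        · exact ⟨a, b, (hK _ _ _).2 (Or.inl ⟨hfe, hab⟩)⟩
  have hnodup := h.nodup
  have hne : ∀ f ∈ A ++ B, f ≠ e := by
    rintro f hf rfl
    have := List.nodup_middle.1 hnodup
    exact (List.nodup_cons.1 this).1 hf
  have hxu : K.IsLink e x u := (hK _ _ _).2 (Or.inr (Or.inl ⟨rfl, rfl⟩))
  have huy : K.IsLink e' u y := (hK _ _ _).2 (Or.inr (Or.inr ⟨rfl, rfl⟩))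
  -- The subdivision may run against the listed orientation; then `e'` is the first half and `e` the
  -- second.
  have hcases : (∃ e₁ e₂, [e₁, e₂].Perm [e, e'] ∧ K.IsLink e₁ (v x₀) u ∧ K.IsLink e₂ u (v y₀)) := by
    rcases hxy.eq_and_eq_or_eq_and_eq hlink with ⟨rfl, rfl⟩ | ⟨rfl, rfl⟩
    · exact ⟨e, e', .refl _, hxu, huy⟩
    · exact ⟨e', e, .swap _ _ _, huy.symm, hxu.symm⟩
  obtain ⟨e₁, e₂, hperm, hl₁, hl₂⟩ := hcases
  have hperm' : (A ++ e₁ :: B ++ [e₂]).Perm (e' :: (A ++ e :: B)) := by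
    have h1 : (A ++ e₁ :: B ++ [e₂]).Perm ([e₁, e₂] ++ (A ++ B)) := by
      refine (List.perm_append_singleton _ _).trans ?_
      refine (List.Perm.cons _ List.perm_middle).trans ?_
      exact .swap _ _ _
    refine h1.trans ((hperm.append_right _).trans ?_)
    refine (List.Perm.swap _ _ _).trans ?_
    exact .cons _ (List.perm_middle (l₁ := A)).symm
  refine ⟨A ++ e₁ :: B ++ [e₂], fun p hp => ?_⟩
  obtain ⟨hup, hinj, himg⟩ := h.update hp (u := u)
  have hpp : Function.update v p u p = u := Function.update_self _ _ _
  have hx₀ : x₀ ∈ V := (hmemV (x₀, y₀) (by simp)).1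
  have hy₀ : y₀ ∈ V := (hmemV (x₀, y₀) (by simp)).2
  have hold : ∀ {C : List β} {C' : List (ℕ × ℕ)}, (∀ f ∈ C, f ≠ e) → (∀ z ∈ C', z.1 ∈ V ∧ z.2 ∈ V) →
      List.Forall₂ (fun e z => G.IsLink e (v z.1) (v z.2)) C C' →
      List.Forall₂ (fun e z => K.IsLink e (Function.update v p u z.1) (Function.update v p u z.2))
        C C' := by
    intro C C' hC hC' hf
    induction hf with
    | nil => exact .nil
    | @cons f z _ _ h1 _ ih =>
      refine .cons ?_ (ih (fun f hf => hC f (by simp [hf])) fun z hz => hC' z (by simp [hz]))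
      have hz := hC' z (by simp)
      rw [hup _ hz.1, hup _ hz.2]
      exact (hK _ _ _).2 (Or.inl ⟨hC f (by simp), h1⟩)
  rw [subdivide_append]
  refine ⟨hinj hu, ?_, ?_, ?_, ?_, ?_⟩
  · rw [hVK, himg]
  · exact hperm'.nodup_iff.2 (List.nodup_cons.2 ⟨he'es, hnodup⟩)
  · rw [hedge]
    ext f
    exact hperm'.mem_iff.symm
  · refine List.rel_append (List.rel_append ?_ (.cons ?_ ?_)) (.cons ?_ .nil)
    · exact hold (fun f hf => hne f (by simp [hf])) (fun z hz => hmemV z (by simp [hz])) hL₁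
    · rw [hup x₀ hx₀, hpp]
      exact hl₁
    · exact hold (fun f hf => hne f (by simp [hf])) (fun z hz => hmemV z (by simp [hz])) hB
    · rw [hup y₀ hy₀, hpp]
      exact hl₂
  · intro z hz
    simp only [List.mem_append, List.mem_cons, List.not_mem_nil, or_false] at hz ⊢
    rcases hz with (hz | rfl | hz) | rfl
    · have := hmemV z (by simp [hz]); tauto
    · tauto
    · have := hmemV z (by simp [hz]); tauto
    · tauto

theorem Presents.join (h : Presents G v es V L) {f : β} {a b : ℕ} (ha : a ∈ V) (hb : b ∈ V)
    (hJ : IsJoin G K f (v a) (v b)) : Presents K v (es ++ [f]) V (L ++ [(a, b)]) := by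
  obtain ⟨hf, hV, hK⟩ := hJ
  have hmem : ∀ a ∈ V, v a ∈ V(G) := fun a ha => by
    rw [h.vertexSet]
    exact mem_image_of_mem _ ha
  refine ⟨h.injOn, ?_, ?_, ?_, ?_, ?_⟩
  · rw [hV, insert_eq_of_mem (hmem b hb), insert_eq_of_mem (hmem a ha), h.vertexSet]
  · rw [h.edgeSet] at hf
    have hf : f ∉ es := hf
    rw [List.nodup_append_comm]
    exact List.nodup_cons.2 ⟨hf, h.nodup⟩
  · ext g
    have hE : g ∈ E(G) ↔ g ∈ es := by rw [h.edgeSet]; rfl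
    simp only [mem_ofPred_eq, List.mem_append, List.mem_singleton, ← hE,
      Graph.edge_mem_iff_exists_isLink, hK]
    constructor
    · rintro ⟨x, y, h1 | ⟨h1, -⟩⟩
      · exact Or.inl ⟨x, y, h1⟩
      · exact Or.inr h1
    · rintro (⟨x, y, h1⟩ | h1)
      · exact ⟨x, y, Or.inl h1⟩
      · exact ⟨_, _, Or.inr ⟨h1, rfl⟩⟩
  · refine List.rel_append (h.isLink.imp fun e z h1 => (hK _ _ _).2 (Or.inl h1)) (.cons ?_ .nil)
    exact (hK _ _ _).2 (Or.inr ⟨rfl, rfl⟩)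
  · intro z hz
    simp only [List.mem_append, List.mem_singleton] at hz
    rcases hz with hz | rfl
    · exact h.mem z hz
    · exact ⟨ha, hb⟩

theorem Presents.joinNew (h : Presents G v es V L) {f : β} {a p : ℕ} {u : α} (ha : a ∈ V)
    (hp : p ∉ V) (hu : u ∉ V(G)) (hJ : IsJoin G K f (v a) u) :
    Presents K (Function.update v p u) (es ++ [f]) (V ++ [p]) (L ++ [(a, p)]) := by
  obtain ⟨hf, hV, hK⟩ := hJ
  obtain ⟨hup, hinj, himg⟩ := h.update hp (u := u)
  have hva : v a ∈ insert u V(G) := by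
    rw [h.vertexSet]
    exact Or.inr (mem_image_of_mem _ ha)
  refine ⟨hinj hu, ?_, ?_, ?_, ?_, ?_⟩
  · rw [hV, himg, insert_eq_of_mem hva]
  · rw [h.edgeSet] at hf
    have hf : f ∉ es := hf
    rw [List.nodup_append_comm]
    exact List.nodup_cons.2 ⟨hf, h.nodup⟩
  · ext g
    have hE : g ∈ E(G) ↔ g ∈ es := by rw [h.edgeSet]; rfl
    simp only [mem_ofPred_eq, List.mem_append, List.mem_singleton, ← hE,
      Graph.edge_mem_iff_exists_isLink, hK]
    constructor
    · rintro ⟨x, y, h1 | ⟨h1, -⟩⟩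
      · exact Or.inl ⟨x, y, h1⟩
      · exact Or.inr h1
    · rintro (⟨x, y, h1⟩ | h1)
      · exact ⟨x, y, Or.inl h1⟩
      · exact ⟨_, _, Or.inr ⟨h1, rfl⟩⟩
  · have hold : ∀ {C : List β} {C' : List (ℕ × ℕ)}, (∀ z ∈ C', z.1 ∈ V ∧ z.2 ∈ V) →
        List.Forall₂ (fun e z => G.IsLink e (v z.1) (v z.2)) C C' →
        List.Forall₂ (fun e z => K.IsLink e (Function.update v p u z.1)
          (Function.update v p u z.2)) C C' := by
      intro C C' hC' hf
      induction hf with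
      | nil => exact .nil
      | @cons f z _ _ h1 _ ih =>
        refine .cons ?_ (ih fun z hz => hC' z (by simp [hz]))
        have hz := hC' z (by simp)
        rw [hup _ hz.1, hup _ hz.2]
        exact (hK _ _ _).2 (Or.inl h1)
    refine List.rel_append (hold h.mem h.isLink) (.cons ?_ .nil)
    rw [hup a ha, Function.update_self]
    exact (hK _ _ _).2 (Or.inr ⟨rfl, rfl⟩)
  · intro z hz
    simp only [List.mem_append, List.mem_singleton] at hz ⊢
    rcases hz with hz | rfl
    · have := h.mem z hz
      tauto
    · tauto

theorem length_subdivide (L : List (ℕ × ℕ)) (i p : ℕ) :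
    (CubicTorus.subdivide L i p).length = L.length + 1 := by
  simp [CubicTorus.subdivide]

/-- Joining two edges and subdividing one edge twice have the same form: after cutting edge `i`, the
second cut is made in edge `j` of the lengthened list, whose last entry is the second half of edge
`i`. -/
theorem Presents.addEdge (h : Presents G v es V L) (hK : IsAddEdge G K) :
    (∃ i < L.length, ∃ j < L.length + 1, ∀ p ∉ V, ∀ q ∉ V, p ≠ q →
      ∃ v' es', Presents K v' es' (V ++ [p] ++ [q]) (addChord L i j p q)) ∨
    ∃ i < L.length, ∀ p ∉ V, ∀ q ∉ V, p ≠ q →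
      ∃ v' es', Presents K v' es' (V ++ [p] ++ [q]) (addLoop L i p q) := by
  classical
  have chord : ∀ {e₁ e₂ f : β} {u w : α} {S T : Graph α β}, IsSubdivision G S e₁ u →
      IsSubdivision S T e₂ w → IsJoin T K f u w → ∃ i < L.length, ∃ j < L.length + 1,
      ∀ p ∉ V, ∀ q ∉ V, p ≠ q →
        ∃ v' es', Presents K v' es' (V ++ [p] ++ [q]) (addChord L i j p q) := by
    intro e₁ e₂ f u w S T hS hT hJ
    obtain ⟨hi, es₁, h₁⟩ := h.subdivide hS
    -- Some unused name is needed to read off the index of the second cut; the index itself does not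
    -- depend on it.
    obtain ⟨p₀, hp₀⟩ : ∃ p, p ∉ V := Infinite.exists_notMem_finset V.toFinset |>.imp (by simp)
    have hj := ((h₁ p₀ hp₀).subdivide hT).1
    rw [length_subdivide] at hj
    refine ⟨_, hi, _, hj, fun p hp q hq hpq => ?_⟩
    have hq' : q ∉ V ++ [p] := by simp [hq, hpq.symm]
    obtain ⟨-, es₂, h₂⟩ := (h₁ p hp).subdivide hT
    refine ⟨_, _, (h₂ q hq').join (f := f) (a := p) (b := q) (by simp) (by simp) ?_⟩
    simpa [Function.update_of_ne hpq] using hJ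
  cases hK with
  | pendantLoop e₁ f l u w S T hS hv hT hK =>
    right
    obtain ⟨hi, es₁, h₁⟩ := h.subdivide hS
    refine ⟨_, hi, fun p hp q hq hpq => ?_⟩
    have hq' : q ∉ V ++ [p] := by simp [hq, hpq.symm]
    have h₂ := (h₁ p hp).joinNew (f := f) (a := p) (p := q) (u := w) (K := T) (by simp) hq' hv
      (by simpa using hT)
    refine ⟨_, _, h₂.join (f := l) (a := q) (b := q) (by simp) (by simp) ?_⟩
    simpa using hK
  | sameEdge e₁ f u w S T hS hT hK => exact Or.inl (chord hS hT hK)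
  | twoEdges e₁ e₂ f u w S T _ _ _ hS hT hK => exact Or.inl (chord hS hT hK)

end Presents

end CubicTorus

/-! ### Renumbering edge lists, and isomorphism with explicit graphs. -/

namespace CubicTorus

open Set Function
open scoped Graph

section Presents

variable {α β : Type*} {K : Graph α β} {v : ℕ → α} {es : List β} {V : List ℕ} {L : List (ℕ × ℕ)}

/-- The ends of an edge, in increasing order. -/
def sortEnds (z : ℕ × ℕ) : ℕ × ℕ := (min z.1 z.2, max z.1 z.2)

theorem sortEnds_cases (z : ℕ × ℕ) : sortEnds z = z ∨ sortEnds z = z.swap := by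
  unfold sortEnds
  rcases le_total z.1 z.2 with h | h
  · left; rw [min_eq_left h, max_eq_right h]
  · right; rw [min_eq_right h, max_eq_left h]; rfl

/-- Presentations of a graph may be relabelled, and their edges permuted and reversed. -/
theorem Presents.transfer (h : Presents K v es V L) (f : ℕ → ℕ) {V' : List ℕ} {L' : List (ℕ × ℕ)}
    (hf : (V.map f).Nodup) (hV : V'.Perm (V.map f))
    (hL : (L'.map sortEnds).Perm ((L.map (Prod.map f f)).map sortEnds)) :
    ∃ v' es', Presents K v' es' V' L' := by
  have hf : InjOn f {a | a ∈ V} := List.inj_on_of_nodup_map hf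
  obtain ⟨g, hg⟩ : ∃ g : ℕ → ℕ, ∀ a ∈ V, g (f a) = a :=
    ⟨invFunOn f {a | a ∈ V}, fun a ha => hf.leftInvOn_invFunOn ha⟩
  have hmem : ∀ a, a ∈ V' ↔ ∃ b ∈ V, f b = a := fun a => by rw [hV.mem_iff, List.mem_map]
  have hsort : ∀ (e : β) (z : ℕ × ℕ), K.IsLink e (v (g (sortEnds z).1)) (v (g (sortEnds z).2)) ↔
      K.IsLink e (v (g z.1)) (v (g z.2)) := by
    intro e z
    rcases sortEnds_cases z with h | h <;> rw [h]
    exact ⟨fun h => h.symm, fun h => h.symm⟩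
  have h1 : List.Forall₂ (fun z e => K.IsLink e (v (g z.1)) (v (g z.2)))
      ((L.map (Prod.map f f)).map sortEnds) es := by
    rw [List.forall₂_map_left_iff, List.forall₂_map_left_iff]
    simp only [hsort]
    have h2 : List.Forall₂ (fun z e => (z.1 ∈ V ∧ z.2 ∈ V) ∧ K.IsLink e (v z.1) (v z.2)) L es := by
      have h3 := h.isLink.flip
      have h4 := h.mem
      clear * - h3 h4
      induction h3 with
      | nil => exact .nil
      | cons h5 _ ih => exact .cons ⟨h4 _ (by simp), h5⟩ (ih fun z hz => h4 z (by simp [hz]))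
    refine h2.imp fun z e h3 => ?_
    simpa [hg _ h3.1.1, hg _ h3.1.2] using h3.2
  -- The edges are permuted along with the list of their ends.
  obtain ⟨es', h2, h3⟩ := List.perm_comp_forall₂ hL h1
  refine ⟨v ∘ g, es', ⟨?_, ?_, h3.nodup_iff.2 h.nodup, ?_, ?_, ?_⟩⟩
  · intro a ha b hb hab
    obtain ⟨a', ha', rfl⟩ := (hmem _).1 ha
    obtain ⟨b', hb', rfl⟩ := (hmem _).1 hb
    simp only [comp_apply, hg a' ha', hg b' hb'] at hab
    rw [h.injOn ha' hb' hab]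
  · rw [h.vertexSet]
    ext x
    constructor
    · rintro ⟨a, ha, rfl⟩
      exact ⟨f a, (hmem _).2 ⟨a, ha, rfl⟩, by simp [hg a ha]⟩
    · rintro ⟨b, hb, rfl⟩
      obtain ⟨a, ha, rfl⟩ := (hmem b).1 hb
      exact ⟨a, ha, by simp [hg a ha]⟩
  · rw [h.edgeSet]
    ext e
    exact h3.mem_iff.symm
  · have h4 := (List.forall₂_map_left_iff.1 h2).flip
    exact h4.imp fun e z h5 => (hsort e z).1 h5
  · intro z hz
    have h4 : sortEnds z ∈ (L.map (Prod.map f f)).map sortEnds :=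
      hL.mem_iff.1 (List.mem_map_of_mem hz)
    obtain ⟨w, hw, hwz⟩ := List.mem_map.1 h4
    obtain ⟨u, hu, rfl⟩ := List.mem_map.1 hw
    have h5 := h.mem u hu
    have h6 : f u.1 ∈ V' ∧ f u.2 ∈ V' :=
      ⟨(hmem _).2 ⟨_, h5.1, rfl⟩, (hmem _).2 ⟨_, h5.2, rfl⟩⟩
    rcases sortEnds_cases z with e1 | e1 <;>
    rcases sortEnds_cases (Prod.map f f u) with e2 | e2 <;>
    rw [e1, e2] at hwz <;> simp only [Prod.ext_iff, Prod.fst_swap, Prod.snd_swap, Prod.map_fst,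
      Prod.map_snd] at hwz <;> rw [← hwz.1, ← hwz.2] <;> tauto

theorem Presents.isomorphic {n m : ℕ} (h : Presents K v es (List.range n) L)
    {e : Fin m → Sym2 (Fin n)}
    (hL : L.map (fun z => s(z.1, z.2)) = (List.ofFn e).map (Sym2.map Fin.val)) :
    Isomorphic K (ofEnds e) := by
  have hlen : L.length = m := by simpa using congrArg List.length hL
  have hlen' : es.length = m := h.isLink.length_eq.trans hlen
  have hvmem : ∀ a : Fin n, v a ∈ V(K) := fun a => by
    rw [h.vertexSet]
    exact ⟨a, by simp, rfl⟩
  have hemem : ∀ i : Fin m, es[i] ∈ E(K) := fun i => by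
    rw [h.edgeSet]
    exact List.getElem_mem _
  let φ : V(ofEnds e) → V(K) := fun a => ⟨v a.1, hvmem a.1⟩
  let ψ : E(ofEnds e) → E(K) := fun i => ⟨es[i.1], hemem i.1⟩
  have hvinj : ∀ a b : Fin n, v a = v b → a = b := fun a b hab =>
    Fin.ext (h.injOn (by simp) (by simp) hab)
  have hφ : Bijective φ := by
    constructor
    · intro a b hab
      exact Subtype.ext (hvinj _ _ (congrArg Subtype.val hab))
    · rintro ⟨x, hx⟩
      have hx' := hx
      rw [h.vertexSet] at hx'
      obtain ⟨a, ha, rfl⟩ := hx'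
      exact ⟨⟨⟨a, by simpa using ha⟩, trivial⟩, rfl⟩
  have hψ : Bijective ψ := by
    constructor
    · intro i j hij
      have h1 : es[i.1] = es[j.1] := congrArg Subtype.val hij
      exact Subtype.ext (Fin.ext ((h.nodup.getElem_inj_iff).1 h1))
    · rintro ⟨f, hf⟩
      have hf' := hf
      rw [h.edgeSet] at hf'
      obtain ⟨i, hi, rfl⟩ := List.mem_iff_getElem.1 hf'
      refine ⟨⟨⟨i, by omega⟩, ?_⟩, rfl⟩
      rw [Graph.edge_mem_iff_exists_isLink]
      obtain ⟨x, y⟩ := Sym2.exists.1 ⟨e ⟨i, by omega⟩, rfl⟩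
      obtain ⟨y, hxy⟩ := y
      exact ⟨x, y, hxy⟩
  have key : ∀ (i : Fin m) (a b : Fin n), K.IsLink es[i] (v a) (v b) ↔ e i = s(a, b) := by
    intro i a b
    have h1 := (List.forall₂_iff_get.1 h.isLink).2 i (by omega) (by omega)
    simp only [List.get_eq_getElem] at h1
    have h2 : s((L[(i : ℕ)]'(by omega)).1, (L[(i : ℕ)]'(by omega)).2) = (e i).map Fin.val := by
      have h3 : (L.map (fun z => s(z.1, z.2)))[(i : ℕ)]'(by simp; omega) =
          ((List.ofFn e).map (Sym2.map Fin.val))[(i : ℕ)]'(by simp) := by simp only [hL]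
      simpa using h3
    have hL1 := h.mem _ (List.getElem_mem (show (i : ℕ) < L.length by omega))
    have hiff : K.IsLink es[i] (v a) (v b) ↔
        s((L[(i : ℕ)]'(by omega)).1, (L[(i : ℕ)]'(by omega)).2) = s((a : ℕ), (b : ℕ)) := by
      have ha : (a : ℕ) ∈ List.range n := by simp
      have hb : (b : ℕ) ∈ List.range n := by simp
      constructor
      · intro h4
        rcases h4.eq_and_eq_or_eq_and_eq h1 with ⟨h5, h6⟩ | ⟨h5, h6⟩
        · rw [h.injOn ha hL1.1 h5, h.injOn hb hL1.2 h6]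
        · rw [h.injOn ha hL1.2 h5, h.injOn hb hL1.1 h6, Sym2.eq_swap]
      · intro h4
        rcases Sym2.eq_iff.1 h4 with ⟨h5, h6⟩ | ⟨h5, h6⟩
        · rw [← h5, ← h6]; exact h1
        · rw [← h5, ← h6]; exact h1.symm
    rw [hiff, h2]
    rw [show s((a : ℕ), (b : ℕ)) = (s(a, b)).map Fin.val from rfl]
    exact (Sym2.map.injective Fin.val_injective).eq_iff
  refine ⟨(Equiv.ofBijective φ hφ).symm, (Equiv.ofBijective ψ hψ).symm, fun f x y => ?_⟩
  obtain ⟨i, rfl⟩ := hψ.2 f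
  obtain ⟨a, rfl⟩ := hφ.2 x
  obtain ⟨b, rfl⟩ := hφ.2 y
  rw [show φ a = Equiv.ofBijective φ hφ a from rfl, show φ b = Equiv.ofBijective φ hφ b from rfl,
    show ψ i = Equiv.ofBijective ψ hψ i from rfl, Equiv.symm_apply_apply, Equiv.symm_apply_apply,
    Equiv.symm_apply_apply]
  exact key i.1 a.1 b.1

end Presents

/-- The edges of `G₁`. -/
def edgesG1 : List (ℕ × ℕ) :=
  [(0, 3), (1, 4), (2, 5), (0, 6), (0, 7), (1, 6), (1, 7), (2, 6), (2, 7),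
    (3, 8), (3, 9), (4, 8), (4, 9), (5, 8), (5, 9)]

theorem exists_presents_of_isomorphic {α β : Type*} {K : Graph α β} (h : Isomorphic K G1) :
    ∃ v es, Presents K v es (List.range 10) edgesG1 := by
  obtain ⟨φ, ψ, h⟩ := h
  let x : Fin 10 → V(K) := fun a => φ.symm ⟨a, trivial⟩
  have hE : ∀ i : Fin 15, i ∈ E(G1) := by
    intro i
    rw [Graph.edge_mem_iff_exists_isLink]
    refine ⟨Fin.ofNat 10 (edgesG1.getD i 0).1, Fin.ofNat 10 (edgesG1.getD i 0).2, ?_⟩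
    revert i
    unfold G1 ofEnds
    decide
  let y : Fin 15 → E(K) := fun i => ψ.symm ⟨i, hE i⟩
  have hxinj : Injective x := fun a b hab => by
    have := φ.symm.injective hab
    exact congrArg Subtype.val this
  have hyinj : Injective y := fun a b hab => by
    have := ψ.symm.injective hab
    exact congrArg Subtype.val this
  refine ⟨fun a => x (Fin.ofNat 10 a), List.ofFn fun i => (y i : β), ?_, ?_, ?_, ?_, ?_, ?_⟩
  · intro a ha b hb hab
    have := congrArg Fin.val (hxinj (Subtype.ext hab))
    simp only [List.mem_range, mem_ofPred_eq] at ha hb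
    simpa [Nat.mod_eq_of_lt ha, Nat.mod_eq_of_lt hb] using this
  · ext u
    constructor
    · intro hu
      refine ⟨(φ ⟨u, hu⟩).1, by simp, ?_⟩
      have e : (⟨(φ ⟨u, hu⟩).1, trivial⟩ : V(G1)) = φ ⟨u, hu⟩ := rfl
      simp [x, e]
    · rintro ⟨a, -, rfl⟩
      exact (x _).2
  · rw [List.nodup_ofFn]
    exact Subtype.val_injective.comp hyinj
  · ext f
    rw [mem_ofPred_eq, List.mem_ofFn]
    constructor
    · intro hf
      refine ⟨(ψ ⟨f, hf⟩).1, ?_⟩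
      simp [y]
    · rintro ⟨i, rfl⟩
      exact (y i).2
  · rw [List.forall₂_iff_get]
    refine ⟨by simp [edgesG1], fun i hi hi' => ?_⟩
    have hi15 : i < 15 := by simpa using hi
    have := (h (y ⟨i, hi15⟩) (x (Fin.ofNat 10 (edgesG1[i]).1)) (x (Fin.ofNat 10 (edgesG1[i]).2))).2
      (by
        simp only [x, y, Equiv.apply_symm_apply]
        have hall : ∀ i : Fin 15, G1.IsLink i (Fin.ofNat 10 (edgesG1.getD i 0).1)
            (Fin.ofNat 10 (edgesG1.getD i 0).2) := by
          unfold G1 ofEnds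
          decide
        have := hall ⟨i, hi15⟩
        rwa [List.getD_eq_getElem _ _ hi'] at this)
    simp only [List.get_eq_getElem, List.getElem_ofFn]
    exact this
  · decide

end CubicTorus

/-! ### Cutting paths and extending a drawing. -/

namespace CubicTorus

open Set Function
open scoped Graph

/-- The vertex `p` occurs on the path `d`, first at a position which is not the first or last. -/
def Inner (p : ℕ) (d : List ℕ) : Prop := 0 < d.idxOf p ∧ d.idxOf p + 1 < d.length

instance (p : ℕ) (d : List ℕ) : Decidable (Inner p d) := inferInstanceAs (Decidable (_ ∧ _))

theorem Inner.mem {p : ℕ} {d : List ℕ} (h : Inner p d) : p ∈ d :=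
  List.idxOf_lt_length_iff.1 (by have := h.2; omega)

theorem Inner.exists_append {p : ℕ} {d : List ℕ} (h : Inner p d) :
    ∃ l r, d = l ++ p :: r ∧ l ≠ [] ∧ r ≠ [] ∧ d.take (d.idxOf p + 1) = l ++ [p] ∧
      d.drop (d.idxOf p) = p :: r := by
  obtain ⟨l, r, rfl, hl⟩ := List.eq_append_cons_of_mem h.mem
  have e : (l ++ p :: r).idxOf p = l.length := by
    rw [List.idxOf_append_of_notMem hl, List.idxOf_cons_self, add_zero]
  obtain ⟨h1, h2⟩ := h
  rw [e] at h1 h2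
  refine ⟨l, r, rfl, List.length_pos_iff.1 h1, ?_, ?_, ?_⟩
  · rintro rfl
    simp at h2
  · rw [e, List.take_append]
    simp
  · rw [e, List.drop_left]

theorem Inner.mem_pieces {p : ℕ} {d : List ℕ} (h : Inner p d) : s(p, p) ∈ pieces d := by
  obtain ⟨l, r, rfl, hl, hr, -, -⟩ := h.exists_append
  simp [pieces_append hl hr]

/-- Cut the path number `i` of `D` at its vertex `p`. -/
def splitPath (D : List (List ℕ)) (i p : ℕ) : List (List ℕ) :=
  D.set i ((D.getD i []).take ((D.getD i []).idxOf p + 1)) ++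
    [(D.getD i []).drop ((D.getD i []).idxOf p)]

theorem lt_length_of_inner {D : List (List ℕ)} {i p : ℕ} (hp : Inner p (D.getD i [])) :
    i < D.length := by
  by_contra hi
  rw [List.getD_eq_default _ _ (not_lt.1 hi)] at hp
  simpa using hp.mem

/-- The total list of pieces only gets permuted: the piece of `p` moves from the interior of a path
to the vertices. -/
theorem Drawn.splitPath {M : Mesh} {V : List ℕ} {D : List (List ℕ)} (h : Drawn M V D) {i p : ℕ}
    (hp : Inner p (D.getD i [])) : Drawn M (V ++ [p]) (splitPath D i p) := by
  have hi := lt_length_of_inner hp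
  obtain ⟨l, r, hd, hl, hr, e1, e2⟩ := hp.exists_append
  rw [CubicTorus.splitPath, e1, e2]
  rw [List.getD_eq_getElem _ _ hi] at hd
  have hD : D = D.take i ++ (l ++ p :: r) :: D.drop (i + 1) := by
    rw [← hd, List.getElem_cons_drop, List.take_append_drop]
  have hD' : D.set i (l ++ [p]) = D.take i ++ (l ++ [p]) :: D.drop (i + 1) := by
    rw [List.set_eq_take_append_cons_drop, if_pos hi]
  have hperm : (allPieces (V ++ [p]) (D.set i (l ++ [p]) ++ [p :: r])).Perm (allPieces V D) := by
    rw [hD']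
    nth_rewrite 3 [hD]
    rw [List.perm_iff_count]
    intro z
    simp only [allPieces, List.map_append, List.flatMap_append, List.flatMap_cons,
      List.flatMap_nil, pieces_append hl hr, List.count_append, List.count_cons, List.map_cons,
      List.map_nil, List.count_nil]
    omega
  refine ⟨hperm.nodup_iff.2 h.nodup, fun z hz => h.hasPiece z (hperm.mem_iff.1 hz), ?_⟩
  have h1 := List.length_pos_iff.2 hl
  have h2 := List.length_pos_iff.2 hr
  intro d hd
  rcases List.mem_append.1 hd with hd | hd
  · rcases List.mem_or_eq_of_mem_set hd with hd | rfl
    · exact h.two_le d hd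
    · simp; omega
  · obtain rfl : d = p :: r := by simpa using hd
    simp; omega

/-- Cutting a path and subdividing an edge follow the same index convention, which keeps drawings
and edge lists in step. -/
theorem ends_splitPath {D : List (List ℕ)} {i p : ℕ} (hp : Inner p (D.getD i [])) :
    (splitPath D i p).map ends = subdivide (D.map ends) i p := by
  have hi := lt_length_of_inner hp
  obtain ⟨l, r, hd, hl, hr, e1, e2⟩ := hp.exists_append
  rw [splitPath, e1, e2, subdivide]
  have h1 : (D.map ends).getD i (0, 0) = ends (l ++ p :: r) := by
    rw [← hd]
    simp [hi]
  rw [h1]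
  obtain ⟨a, l, rfl⟩ := List.exists_cons_of_ne_nil hl
  obtain ⟨c, r, rfl⟩ := List.exists_cons_of_ne_nil hr
  rw [List.map_append, List.map_set]
  simp [ends, List.getLast?_cons, List.getLast?_append]

theorem Drawn.notMem {M : Mesh} {V : List ℕ} {D : List (List ℕ)} (h : Drawn M V D) {i p : ℕ}
    (hp : Inner p (D.getD i [])) : p ∉ V := by
  have hi := lt_length_of_inner hp
  have hm := hp.mem_pieces
  rw [List.getD_eq_getElem _ _ hi] at hm
  intro hV
  exact (List.nodup_append.1 h.nodup).2.2 _ (List.mem_map_of_mem hV) _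
    (List.mem_flatMap.2 ⟨_, List.getElem_mem hi, hm⟩) rfl

/-- Every new piece involves a vertex that `M` lacks, hence differs from every old piece. -/
theorem Drawn.extend {M M' : Mesh} {V V' : List ℕ} {D D' : List (List ℕ)} (h : Drawn M V D)
    (hM : ∀ z, M.HasPiece z → (∀ a ∈ z, a < M.size) ∧ M'.HasPiece z)
    (hn : (allPieces V' D').Nodup)
    (hz : ∀ z ∈ allPieces V' D', M'.HasPiece z ∧ ∃ a ∈ z, M.size ≤ a)
    (hl : ∀ l ∈ D', 2 ≤ l.length) : Drawn M' (V ++ V') (D ++ D') := by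
  have hperm : (allPieces (V ++ V') (D ++ D')).Perm (allPieces V D ++ allPieces V' D') := by
    rw [List.perm_iff_count]
    intro z
    simp only [allPieces, List.map_append, List.flatMap_append, List.count_append]
    omega
  refine ⟨hperm.nodup_iff.2 (List.nodup_append.2 ⟨h.nodup, hn, ?_⟩), ?_, ?_⟩
  · rintro z hz1 _ hz2 rfl
    obtain ⟨a, ha, hle⟩ := (hz z hz2).2
    exact absurd ((hM z (h.hasPiece z hz1)).1 a ha) (not_lt.2 hle)
  · intro z hz1
    rcases List.mem_append.1 (hperm.mem_iff.1 hz1) with h1 | h1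
    · exact (hM z (h.hasPiece z h1)).2
    · exact (hz z h1).1
  · intro l hl1
    rcases List.mem_append.1 hl1 with h1 | h1
    · exact h.two_le l h1
    · exact hl l h1

/-- All vertices of arcs and cells of `M` are smaller than its size. -/
def Mesh.Bounded (M : Mesh) : Prop := ∀ z ∈ M.arcs, ∀ a ∈ z, a < M.size

theorem Mesh.Realizable.bounded {X : Type*} [TopologicalSpace X] {M : Mesh}
    (h : M.Realizable X) : M.Bounded := by
  obtain ⟨vert, lab, hs, -⟩ := h
  exact hs.arcs_lt

theorem Mesh.Bounded.lt {M : Mesh} (h : M.Bounded) {z : Sym2 ℕ} (hz : M.HasPiece z) :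
    ∀ a ∈ z, a < M.size := by
  rcases hz with hz | ⟨b, hb, rfl⟩
  · exact h z hz
  · simpa using hb

theorem Mesh.HasPiece.chord {M : Mesh} {z : Sym2 ℕ} (h : M.HasPiece z) (k m : ℕ)
    (l₁ : List ℕ) (p : ℕ) (l₂ : List ℕ) (q : ℕ) (l₃ : List ℕ) :
    (M.chord k m l₁ p l₂ q l₃).HasPiece z := by
  rcases h with h | ⟨a, ha, rfl⟩
  · exact Or.inl (List.mem_append_left _ h)
  · exact Or.inr ⟨a, ha.trans_le (Nat.le_add_right _ _), rfl⟩

/-- If two vertices `p` and `q` lie on a common cell, then a new path between them, with one inner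
vertex, can be drawn. -/
theorem Mesh.Realizable.exists_chord {X : Type*} [TopologicalSpace X] {M : Mesh}
    (h : M.Realizable X) {c : List ℕ} (hc : c ∈ M.cells) {p q : ℕ} (hp : p ∈ c) (hq : q ∈ c)
    (hpq : p ≠ q) : ∃ M' : Mesh, M'.Realizable X ∧ (∀ z, M.HasPiece z → M'.HasPiece z) ∧
      M'.HasPiece s(p, M.size) ∧ M'.HasPiece s(M.size, M.size) ∧ M'.HasPiece s(M.size, q) := by
  obtain ⟨k, hk, rfl⟩ := List.mem_iff_getElem.1 hc
  have key : ∀ {p q : ℕ} {l₁ l₂ l₃ : List ℕ}, p ≠ q → M.cells[k] = l₁ ++ p :: (l₂ ++ q :: l₃) →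
      ∃ M' : Mesh, M'.Realizable X ∧ (∀ z, M.HasPiece z → M'.HasPiece z) ∧
      M'.HasPiece s(p, M.size) ∧ M'.HasPiece s(M.size, M.size) ∧ M'.HasPiece s(M.size, q) := by
    intro p q l₁ l₂ l₃ hpq he
    refine ⟨_, h.chord hk he one_pos hpq, fun z hz => hz.chord .., Or.inl ?_, Or.inr ?_, Or.inl ?_⟩
    · simp [Mesh.chord, path, links]
    · exact ⟨M.size, by simp [Mesh.chord], rfl⟩
    · simp [Mesh.chord, path, links]
  obtain ⟨l, r, he, hl⟩ := List.eq_append_cons_of_mem hp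
  rw [he] at hq
  rcases List.mem_append.1 hq with hq | hq
  · obtain ⟨l₁, l₂, rfl, -⟩ := List.eq_append_cons_of_mem hq
    obtain ⟨M', h1, h2, h3, h4, h5⟩ := key hpq.symm (l₁ := l₁) (l₂ := l₂) (l₃ := r) (by simp [he])
    exact ⟨M', h1, h2, Sym2.eq_swap ▸ h5, h4, Sym2.eq_swap ▸ h3⟩
  · obtain ⟨l₂, l₃, rfl, -⟩ := List.eq_append_cons_of_mem ((List.mem_cons.1 hq).resolve_left hpq.symm)
    exact key hpq he

/-- If a vertex `p` lies on a cell with another vertex, then a new cycle through four vertices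
joined to `p` by an arc can be drawn. -/
theorem Mesh.Realizable.exists_lollipop {X : Type*} [TopologicalSpace X] {M : Mesh}
    (h : M.Realizable X) {c : List ℕ} (hc : c ∈ M.cells) {p q : ℕ} (hp : p ∈ c) (hq : q ∈ c)
    (hpq : p ≠ q) : ∃ (M' : Mesh) (a b c d : ℕ), M'.Realizable X ∧
      (∀ z, M.HasPiece z → M'.HasPiece z) ∧ (∀ x ∈ [a, b, c, d], M.size ≤ x ∧ x < M'.size) ∧
      [a, b, c, d].Nodup ∧ M'.HasPiece s(p, a) ∧ M'.HasPiece s(a, b) ∧ M'.HasPiece s(b, c) ∧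
      M'.HasPiece s(c, d) ∧ M'.HasPiece s(d, a) := by
  obtain ⟨k, hk, rfl⟩ := List.mem_iff_getElem.1 hc
  let n := M.size
  have key : ∀ {p q : ℕ} {l₁ l₂ l₃ : List ℕ}, p ≠ q → M.cells[k] = l₁ ++ p :: (l₂ ++ q :: l₃) →
      ∃ M' : Mesh, M'.Realizable X ∧ (∀ z, M.HasPiece z → M'.HasPiece z) ∧ M'.size = n + 4 ∧
        M'.HasPiece s(p, n) ∧ M'.HasPiece s(n, n + 1) ∧ M'.HasPiece s(n + 1, n + 2) ∧
        M'.HasPiece s(n + 2, q) ∧ M'.HasPiece s(n, n + 3) ∧ M'.HasPiece s(n + 3, n + 2) := by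
    intro p q l₁ l₂ l₃ hpq he
    have h1 := h.chord hk he (m := 3) (by norm_num) hpq
    -- The second chord bypasses `n + 1` and closes the cycle `n, n + 1, n + 2, n + 3`. The stretch
    -- from `n + 2` to `q` is left out of the drawn graph.
    have h2 := h1.chord (k := M.cells.length) (p := n) (q := n + 2) (l₁ := l₁ ++ [p])
      (l₂ := [n + 1]) (l₃ := q :: l₃) (m := 1) (by simp [Mesh.chord])
      (by simp [Mesh.chord, List.range', n]) one_pos (by omega)
    refine ⟨_, h2, fun z hz => (hz.chord ..).chord .., rfl, ?_⟩
    refine ⟨Or.inl ?_, Or.inl ?_, Or.inl ?_, Or.inl ?_, Or.inl ?_, Or.inl ?_⟩ <;>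
      simp [Mesh.chord, path, links, List.range', n]
  obtain ⟨l, r, he, hl⟩ := List.eq_append_cons_of_mem hp
  rw [he] at hq
  rcases List.mem_append.1 hq with hq | hq
  · obtain ⟨l₁, l₂, rfl, -⟩ := List.eq_append_cons_of_mem hq
    obtain ⟨M', h1, h2, h3, h4, h5, h6, h7, h8, h9⟩ :=
      key hpq.symm (l₁ := l₁) (l₂ := l₂) (l₃ := r) (by simp [he])
    -- Here the chord was drawn starting from `q`, so `n + 2` is the vertex next to `p`, and the
    -- cycle is read backwards.
    refine ⟨M', n + 2, n + 1, n, n + 3, h1, h2, ?_, by simp, Sym2.eq_swap ▸ h7, Sym2.eq_swap ▸ h6,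
      Sym2.eq_swap ▸ h5, h8, h9⟩
    simp only [List.mem_cons, List.not_mem_nil, or_false]
    intro x hx
    omega
  · obtain ⟨l₂, l₃, rfl, -⟩ := List.eq_append_cons_of_mem ((List.mem_cons.1 hq).resolve_left hpq.symm)
    obtain ⟨M', h1, h2, h3, h4, h5, h6, h7, h8, h9⟩ := key hpq he
    refine ⟨M', n, n + 1, n + 2, n + 3, h1, h2, ?_, by simp, h4, h5, h6, Sym2.eq_swap ▸ h9,
      Sym2.eq_swap ▸ h8⟩
    simp only [List.mem_cons, List.not_mem_nil, or_false]
    intro x hx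
    omega

end CubicTorus

/-! ### Cofacial edges can be joined. -/

namespace CubicTorus

open Set Function
open scoped Graph

section Extension

variable {M : Mesh} {V : List ℕ} {D : List (List ℕ)}

theorem getD_splitPath_of_ne {i j p : ℕ} (hij : i ≠ j) (hj : j < D.length) :
    (splitPath D i p).getD j [] = D.getD j [] := by
  rw [splitPath, List.getD_append _ _ _ _ (by simpa using hj)]
  simp [hj, hij]

theorem getD_splitPath_self {i p : ℕ} (hi : i < D.length) :
    (splitPath D i p).getD i [] = (D.getD i []).take ((D.getD i []).idxOf p + 1) := by
  rw [splitPath, List.getD_append _ _ _ _ (by simpa using hi)]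
  simp [hi]

theorem getD_splitPath_last {i p : ℕ} :
    (splitPath D i p).getD D.length [] = (D.getD i []).drop ((D.getD i []).idxOf p) := by
  rw [splitPath, List.getD_append_right _ _ _ _ (by simp)]
  simp

theorem Inner.take {p q : ℕ} {d : List ℕ} (hq : Inner q d) (hp : Inner p d)
    (h : d.idxOf q < d.idxOf p) : Inner q (d.take (d.idxOf p + 1)) := by
  have h1 : q ∈ d.take (d.idxOf p + 1) := by
    rw [List.mem_take_iff_idxOf_lt hq.mem]
    omega
  have h2 : d.idxOf q = (d.take (d.idxOf p + 1)).idxOf q := by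
    nth_rewrite 1 [← List.take_append_drop (d.idxOf p + 1) d]
    exact List.idxOf_append_of_mem h1
  refine ⟨h2 ▸ hq.1, ?_⟩
  rw [← h2, List.length_take]
  have := hp.2
  omega

theorem Inner.drop {p q : ℕ} {d : List ℕ} (hq : Inner q d)
    (h : d.idxOf p < d.idxOf q) : Inner q (d.drop (d.idxOf p)) := by
  have h1 : q ∉ d.take (d.idxOf p) := by
    rw [List.mem_take_iff_idxOf_lt hq.mem]
    omega
  have h2 : d.idxOf q = min (d.idxOf p) d.length + (d.drop (d.idxOf p)).idxOf q := by
    nth_rewrite 1 [← List.take_append_drop (d.idxOf p) d]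
    rw [List.idxOf_append_of_notMem h1, List.length_take]
  have := hq.2
  rw [min_eq_left (by omega)] at h2
  refine ⟨by omega, ?_⟩
  rw [List.length_drop]
  omega

/-- Some cell of `M` contains an inner vertex of `d` and a different inner vertex of `d'`. -/
def Mesh.Cofacial (M : Mesh) (d d' : List ℕ) : Prop :=
  ∃ c ∈ M.cells, ∃ p ∈ c, ∃ q ∈ c, p ≠ q ∧ Inner p d ∧ Inner q d'

theorem Mesh.Cofacial.symm {M : Mesh} {d d' : List ℕ} (h : M.Cofacial d d') : M.Cofacial d' d := by
  obtain ⟨c, hc, p, hp, q, hq, hpq, h1, h2⟩ := h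
  exact ⟨c, hc, q, hq, p, hp, hpq.symm, h2, h1⟩

/-- The index of the path on which the vertex that cuts the path number `j` lies before the path
number `i` was cut. -/
def parentIndex (D : List (List ℕ)) (i j : ℕ) : ℕ := if j = D.length then i else j

variable {α β : Type*} {K : Graph α β} {X : Type*} [TopologicalSpace X]

/-- After cutting path `i` at `p` and the appropriate path at `q`, a chord through the common cell
is the new edge. If both cuts fall on the same original path, `j` prescribes their order; as joining
is symmetric, the roles of `p` and `q` can be exchanged to match it. -/
theorem Drawn.nonempty_embedding_addChord (hM : M.Realizable X) (hD : Drawn M V D) {i j : ℕ}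
    (hi : i < D.length) (hj : j < D.length + 1)
    (hK : ∀ p ∉ V, ∀ q ∉ V, p ≠ q →
      ∃ (v : ℕ → α) (es : List β), Presents K v es (V ++ [p] ++ [q]) (addChord (D.map ends) i j p q))
    (hc : M.Cofacial (D.getD i []) (D.getD (parentIndex D i j) [])) :
    Nonempty (Embedding K X) := by
  have key : ∀ {c : List ℕ} {p q : ℕ}, c ∈ M.cells → p ∈ c → q ∈ c → p ≠ q →
      Inner p (D.getD i []) → Inner q ((CubicTorus.splitPath D i p).getD j []) → q ∉ V →
      Nonempty (Embedding K X) := by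
    intro c p q hc hp hq hpq hpi hqj hqV
    have h1 := (hD.splitPath hpi).splitPath hqj
    obtain ⟨v, es, h2⟩ := hK p (hD.notMem hpi) q hqV hpq
    obtain ⟨M', h3, h4, h5, h6, h7⟩ := hM.exists_chord hc hp hq hpq
    have hpn : p < M.size := by
      have := hM.bounded.lt (h1.hasPiece s(p, p) (by simp [allPieces])) p (by simp)
      exact this
    have hqn : q < M.size := by
      have := hM.bounded.lt (h1.hasPiece s(q, q) (by simp [allPieces])) q (by simp)
      exact this
    have h8 := h1.extend (M' := M') (V' := []) (D' := [[p, M.size, q]])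
      (fun z hz => ⟨hM.bounded.lt hz, h4 z hz⟩)
      (by simp [allPieces, pieces]; omega)
      (by
        intro z hz
        simp only [allPieces, List.map_nil, List.flatMap_cons, List.flatMap_nil, pieces,
          List.nil_append, List.append_nil, List.mem_cons, List.not_mem_nil, or_false] at hz
        rcases hz with rfl | rfl | rfl
        · exact ⟨h5, M.size, by simp, le_rfl⟩
        · exact ⟨h6, M.size, by simp, le_rfl⟩
        · exact ⟨h7, M.size, by simp, le_rfl⟩)
      (by simp)
    refine h8.nonempty_embedding h3 (v := v) (es := es) ?_
    rw [List.append_nil, List.map_append, ends_splitPath hqj, ends_splitPath hpi]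
    exact h2
  obtain ⟨c, hc, p, hp, q, hq, hpq, hpi, hqj⟩ := hc
  have hqV : q ∉ V := hD.notMem hqj
  have hidx : (D.getD i []).idxOf p ≠ (D.getD i []).idxOf q := fun h =>
    hpq ((List.idxOf_inj hpi.mem).1 h)
  by_cases hjl : j = D.length
  · subst hjl
    rw [parentIndex, if_pos rfl] at hqj
    -- The second cut is to lie beyond the first, so the earlier vertex is cut first.
    rcases lt_or_gt_of_ne hidx with h | h
    · exact key hc hp hq hpq hpi (by rw [getD_splitPath_last]; exact hqj.drop h) hqV
    · exact key hc hq hp hpq.symm hqj (by rw [getD_splitPath_last]; exact hpi.drop h)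
        (hD.notMem hpi)
  · rw [parentIndex, if_neg hjl] at hqj
    by_cases hij : i = j
    · subst hij
      -- The second cut is to lie in the initial part, so the later vertex is cut first.
      rcases lt_or_gt_of_ne hidx with h | h
      · exact key hc hq hp hpq.symm hqj (by rw [getD_splitPath_self hi]; exact hpi.take hqj h)
          (hD.notMem hpi)
      · exact key hc hp hq hpq hpi (by rw [getD_splitPath_self hi]; exact hqj.take hpi h) hqV
    · exact key hc hp hq hpq hpi
        (by rw [getD_splitPath_of_ne hij (by omega)]; exact hqj) hqV

theorem Drawn.nonempty_embedding_addLoop (hM : M.Realizable X) (hD : Drawn M V D) {i : ℕ}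
    (hK : ∀ p ∉ V, ∀ q ∉ V, p ≠ q →
      ∃ (v : ℕ → α) (es : List β), Presents K v es (V ++ [p] ++ [q]) (addLoop (D.map ends) i p q))
    (hc : M.Cofacial (D.getD i []) (D.getD i [])) : Nonempty (Embedding K X) := by
  -- The vertex `q` only serves as the far end of the auxiliary chord that carries the loop.
  obtain ⟨c, hc, p, hp, q, hq, hpq, hpi, -⟩ := hc
  obtain ⟨M', a, b, c, d, h1, h2, h3, h4, h5, h6, h7, h8, h9⟩ := hM.exists_lollipop hc hp hq hpq
  have hD' := hD.splitPath hpi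
  have hbd := hM.bounded
  have hpn : p < M.size := hbd.lt (hD'.hasPiece s(p, p) (by simp [allPieces])) p (by simp)
  simp only [List.forall_mem_cons, List.not_mem_nil, false_imp_iff, implies_true, and_true] at h3
  obtain ⟨ha, hb, hc', hd⟩ := h3
  have haV : a ∉ V := fun hV => by
    have := hbd.lt (hD.hasPiece s(a, a) (by simp [allPieces, hV])) a (by simp)
    omega
  obtain ⟨v, es, hv⟩ := hK p (hD.notMem hpi) a haV (by omega)
  have h10 := hD'.extend (M' := M') (V' := [a]) (D' := [[p, a], [a, b, c, d, a]])
    (fun z hz => ⟨hbd.lt hz, h2 z hz⟩)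
    (by
      simp only [List.nodup_cons, List.mem_cons, List.not_mem_nil, or_false] at h4
      simp [allPieces, pieces]
      omega)
    (by
      intro z hz
      simp only [allPieces, List.map_cons, List.map_nil, List.flatMap_cons, List.flatMap_nil, pieces,
        List.append_nil, List.cons_append, List.nil_append, List.mem_cons, List.not_mem_nil,
        or_false] at hz
      rcases hz with rfl | rfl | rfl | rfl | rfl | rfl | rfl | rfl | rfl
      · exact ⟨Or.inr ⟨a, ha.2, rfl⟩, a, by simp, ha.1⟩
      · exact ⟨h5, a, by simp, ha.1⟩
      · exact ⟨h6, a, by simp, ha.1⟩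
      · exact ⟨Or.inr ⟨b, hb.2, rfl⟩, b, by simp, hb.1⟩
      · exact ⟨h7, b, by simp, hb.1⟩
      · exact ⟨Or.inr ⟨c, hc'.2, rfl⟩, c, by simp, hc'.1⟩
      · exact ⟨h8, c, by simp, hc'.1⟩
      · exact ⟨Or.inr ⟨d, hd.2, rfl⟩, d, by simp, hd.1⟩
      · exact ⟨h9, d, by simp, hd.1⟩)
    (by simp)
  refine h10.nonempty_embedding h1 (v := v) (es := es) ?_
  rw [List.map_append, ends_splitPath hpi]
  simpa [addLoop, ends] using hv

end Extension

end CubicTorus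

/-! ### Drawings of given edge lists, built by explicit chords and pendant loops. -/

namespace CubicTorus

open Set Function
open scoped Graph

/-- Draw a chord, with `m` new vertices on it, through the cell `k`, from its vertex number `a` to
its vertex number `b`. -/
def Mesh.chordAt (M : Mesh) (k a b m : ℕ) : Mesh :=
  M.chord k m ((M.cells.getD k []).take a) ((M.cells.getD k []).getD a 0)
    (((M.cells.getD k []).drop (a + 1)).take (b - (a + 1))) ((M.cells.getD k []).getD b 0)
    ((M.cells.getD k []).drop (b + 1))

theorem eq_take_append_drop {c : List ℕ} {a b : ℕ} (hab : a < b) (hb : b < c.length) :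
    c = c.take a ++ c.getD a 0 :: ((c.drop (a + 1)).take (b - (a + 1)) ++
      c.getD b 0 :: c.drop (b + 1)) := by
  have h1 : c.drop (b + 1) = (c.drop (a + 1)).drop (b - (a + 1) + 1) := by
    rw [List.drop_drop]
    congr 1
    omega
  have h2 : c.getD b 0 = (c.drop (a + 1))[b - (a + 1)]'(by simp; omega) := by
    rw [List.getD_eq_getElem _ _ hb, List.getElem_drop]
    congr 1
    omega
  rw [h1, h2, List.getElem_cons_drop, List.take_append_drop, List.getD_eq_getElem _ _ (hab.trans hb),
    List.getElem_cons_drop, List.take_append_drop]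

theorem Mesh.Realizable.chordAt {X : Type*} [TopologicalSpace X] {M : Mesh} (h : M.Realizable X)
    {k a b m : ℕ} (hab : a < b) (hb : b < (M.cells.getD k []).length) (hm : 0 < m)
    (hne : (M.cells.getD k []).getD a 0 ≠ (M.cells.getD k []).getD b 0) :
    (M.chordAt k a b m).Realizable X := by
  have hk : k < M.cells.length := by
    by_contra hk
    rw [List.getD_eq_default _ _ (not_lt.1 hk)] at hb
    simp at hb
  refine h.chord hk ?_ hm hne
  rw [← eq_take_append_drop hab hb, List.getD_eq_getElem _ _ hk]

theorem pieces_reverse (l : List ℕ) : (pieces l.reverse).Perm (pieces l) := by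
  induction l with
  | nil => rfl
  | cons a l ih =>
    match l with
    | [] => rfl
    | [b] => simp [pieces, Sym2.eq_swap]
    | b :: c :: t =>
      rw [List.reverse_cons, List.reverse_cons, List.append_assoc, List.singleton_append,
        pieces_append (by simp) (by simp), ← List.reverse_cons]
      simp only [pieces]
      refine List.perm_append_comm.trans ?_
      rw [Sym2.eq_swap (a := b) (b := a)]
      simp only [List.cons_append, List.nil_append]
      exact (List.Perm.swap _ _ _).trans ((ih.cons _).cons _)

theorem map_range_getD {α : Type*} (l : List α) (d : α) :
    (List.range l.length).map (fun a => l.getD a d) = l := by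
  refine List.ext_getElem (by simp) fun i h1 h2 => ?_
  simp [h2]

/-- List paths of `D`: those with the given indices, reversed where the flag is set. -/
def selectPaths (D : List (List ℕ)) (js : List (ℕ × Bool)) : List (List ℕ) :=
  js.map fun z => if z.2 then (D.getD z.1 []).reverse else D.getD z.1 []

theorem Drawn.selectPaths {M : Mesh} {V V' : List ℕ} {D : List (List ℕ)} (h : Drawn M V D)
    {js : List (ℕ × Bool)} (hV : V'.Perm V) (hjs : (js.map Prod.fst).Perm (List.range D.length)) :
    Drawn M V' (selectPaths D js) := by
  have hperm : ((CubicTorus.selectPaths D js).flatMap pieces).Perm (D.flatMap pieces) := by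
    have h1 : ((CubicTorus.selectPaths D js).flatMap pieces).Perm
        (((js.map Prod.fst).map (fun i => D.getD i [])).flatMap pieces) := by
      rw [CubicTorus.selectPaths, List.flatMap_map, List.map_map, List.flatMap_map]
      refine List.Perm.flatMap_left _ fun z _ => ?_
      simp only [Function.comp_apply]
      split_ifs
      · exact pieces_reverse _
      · rfl
    refine h1.trans ?_
    nth_rewrite 2 [← map_range_getD D []]
    exact (hjs.map _).flatMap_right _
  have hall : (allPieces V' (CubicTorus.selectPaths D js)).Perm (allPieces V D) :=
    (hV.map _).append hperm
  refine ⟨hall.nodup_iff.2 h.nodup, fun z hz => h.hasPiece z (hall.mem_iff.1 hz), ?_⟩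
  intro l hl
  obtain ⟨z, hz, rfl⟩ := List.mem_map.1 hl
  have hz' : z.1 < D.length := List.mem_range.1 (hjs.mem_iff.1 (List.mem_map_of_mem hz))
  have := h.two_le _ (List.getElem_mem hz')
  rw [List.getD_eq_getElem _ _ hz']
  split_ifs <;> simpa

theorem addChord_map (f : ℕ → ℕ) {L : List (ℕ × ℕ)} {i j : ℕ} (p q : ℕ) (hi : i < L.length)
    (hj : j < L.length + 1) : (addChord L i j p q).map (Prod.map f f) =
      addChord (L.map (Prod.map f f)) i j (f p) (f q) := by
  have h : ∀ {L : List (ℕ × ℕ)} {i : ℕ} (p : ℕ), i < L.length →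
      (subdivide L i p).map (Prod.map f f) = subdivide (L.map (Prod.map f f)) i (f p) := by
    intro L i p hi
    simp [subdivide, List.map_set, hi]
  rw [addChord, addChord, List.map_append, h q (by simpa [subdivide] using hj), h p hi]
  rfl

theorem addLoop_map (f : ℕ → ℕ) {L : List (ℕ × ℕ)} {i : ℕ} (p q : ℕ) (hi : i < L.length) :
    (addLoop L i p q).map (Prod.map f f) = addLoop (L.map (Prod.map f f)) i (f p) (f q) := by
  simp [addLoop, subdivide, List.map_set, hi]

theorem lt_of_mem_subdivide {L : List (ℕ × ℕ)} {i p N : ℕ} (hi : i < L.length) (hp : p < N)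
    (hL : ∀ z ∈ L, z.1 < N ∧ z.2 < N) : ∀ z ∈ subdivide L i p, z.1 < N ∧ z.2 < N := by
  intro z hz
  have h := hL _ (List.getElem_mem hi)
  simp only [subdivide, List.getD_eq_getElem _ _ hi, List.mem_append, List.mem_singleton] at hz
  rcases hz with hz | rfl
  · rcases List.mem_or_eq_of_mem_set hz with hz | rfl
    · exact hL z hz
    · exact ⟨h.1, hp⟩
  · exact ⟨hp, h.2⟩

/-- The paths `D` in `M` form a drawing on the torus of the graph with the edge list `L`, in
which the vertex `a` is drawn at the vertex number `a` of `vs`. -/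
structure Draws (M : Mesh) (vs : List ℕ) (D : List (List ℕ)) (L : List (ℕ × ℕ)) : Prop where
  realizable : M.Realizable (UnitAddCircle × UnitAddCircle)
  drawn : Drawn M vs D
  ends_eq : D.map ends = L.map (Prod.map (vs.getD · 0) (vs.getD · 0))
  lt : ∀ z ∈ L, z.1 < vs.length ∧ z.2 < vs.length

section Draws

variable {M : Mesh} {vs : List ℕ} {D : List (List ℕ)} {L : List (ℕ × ℕ)}

theorem Draws.length_eq (h : Draws M vs D L) : D.length = L.length := by
  simpa using congrArg List.length h.ends_eq

theorem Draws.map_ends (h : Draws M vs D L) {f : ℕ → ℕ}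
    (hf : ∀ a < vs.length, f a = vs.getD a 0) : L.map (Prod.map f f) = D.map ends := by
  rw [h.ends_eq]
  refine List.map_congr_left fun z hz => ?_
  simp only [Prod.map, hf _ (h.lt z hz).1, hf _ (h.lt z hz).2]

theorem drawn_path {M M' : Mesh} {V : List ℕ} {D : List (List ℕ)} (h : Drawn M V D)
    (hM : M.Bounded) {n m p q : ℕ} (hn : n = M.size) (hm : 0 < m) (hp : p < M.size)
    (hq : q < M.size) (hpq : p ≠ q) (hs : M'.size = M.size + m)
    (ha : M'.arcs = M.arcs ++ links (path n m p q)) : Drawn M' V (D ++ [path n m p q]) := by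
  subst hn
  have hnd : (path M.size m p q).Nodup := by
    rw [path, List.nodup_cons, List.nodup_append]
    refine ⟨?_, List.nodup_range', List.nodup_singleton q, ?_⟩
    · simp only [List.mem_append, List.mem_range'_1, List.mem_singleton]
      omega
    · intro a ha b hb
      rw [List.mem_range'_1] at ha
      rw [List.mem_singleton] at hb
      omega
  rw [← List.append_nil V]
  refine h.extend ?_ ?_ ?_ (by simp [length_path])
  · rintro z hz
    refine ⟨hM.lt hz, ?_⟩
    rcases hz with hz | ⟨a, ha', rfl⟩
    · exact Or.inl (by rw [ha]; exact List.mem_append_left _ hz)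
    · exact Or.inr ⟨a, by omega, rfl⟩
  · simpa [allPieces] using nodup_pieces hnd
  · intro z hz
    simp only [allPieces, List.map_nil, List.nil_append, List.flatMap_cons, List.flatMap_nil,
      List.append_nil] at hz
    constructor
    · rcases pieces_subset hz with h1 | ⟨a, h1, rfl⟩
      · exact Or.inl (by rw [ha]; exact List.mem_append_right _ h1)
      · refine Or.inr ⟨a, ?_, rfl⟩
        simp only [path, List.mem_cons, List.mem_append, List.mem_range'_1, List.not_mem_nil,
          or_false] at h1
        omega
    · obtain ⟨a, h1, h2⟩ := exists_inner_mem_of_mem_pieces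
        (by simp; omega) hz
      exact ⟨a, h1, (List.mem_range'_1.1 h2).1⟩

theorem Drawn.lt_of_inner {M : Mesh} {V : List ℕ} {D : List (List ℕ)} (h : Drawn M V D)
    (hM : M.Bounded) {i p : ℕ} (hp : Inner p (D.getD i [])) : p < M.size :=
  hM.lt ((h.splitPath hp).hasPiece s(p, p) (by simp [allPieces])) p (by simp)

/-- Apart from `h`, the hypotheses concern concrete numbers and lists only, so for explicit drawings
they can be evaluated. -/
theorem Draws.chordAt (h : Draws M vs D L) {n i j k a b m p q : ℕ} (hn : vs.length = n)
    (hab : a < b) (hb : b < (M.cells.getD k []).length) (hm : 0 < m)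
    (hp : (M.cells.getD k []).getD a 0 = p) (hq : (M.cells.getD k []).getD b 0 = q)
    (hpq : p ≠ q) (hpi : Inner p (D.getD i [])) (hqj : Inner q ((splitPath D i p).getD j [])) :
    Draws (M.chordAt k a b m) (vs ++ [p] ++ [q])
      (splitPath (splitPath D i p) j q ++ [path M.size m p q]) (addChord L i j n (n + 1)) := by
  subst hn
  have hbd := h.realizable.bounded
  have h1 := h.drawn.splitPath hpi
  have h2 := h1.splitPath hqj
  have hi : i < L.length := h.length_eq ▸ lt_length_of_inner hpi
  have hj : j < L.length + 1 := by
    have := lt_length_of_inner hqj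
    simpa [splitPath, h.length_eq] using this
  refine ⟨h.realizable.chordAt hab hb hm (by rwa [hp, hq]), ?_, ?_, ?_⟩
  · refine drawn_path h2 hbd rfl hm (h.drawn.lt_of_inner hbd hpi) (h1.lt_of_inner hbd hqj) hpq rfl ?_
    rw [Mesh.chordAt, Mesh.chord, hp, hq]
  · rw [addChord_map _ _ _ hi hj, h.map_ends, List.map_append, ends_splitPath hqj,
      ends_splitPath hpi, addChord]
    · simp [ends, path, List.getLast?_cons]
    · intro a ha
      simp [List.getElem?_append_left ha, ha]
  · intro z hz
    have hlt : ∀ z ∈ L, z.1 < vs.length + 2 ∧ z.2 < vs.length + 2 := fun z hz => by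
      have := h.lt z hz
      omega
    suffices z.1 < vs.length + 2 ∧ z.2 < vs.length + 2 by simpa
    rcases List.mem_append.1 hz with hz | hz
    · exact lt_of_mem_subdivide (by simpa [subdivide] using hj) (by omega)
        (lt_of_mem_subdivide hi (by omega) hlt) z hz
    · rw [List.mem_singleton] at hz
      subst hz
      simp

/-- Draw a small loop, joined to the vertex `p` number `a` of the cell `k` by a path, next to the
arc from `p` to the following vertex of the cell. -/
def Mesh.lollipop (M : Mesh) (k a : ℕ) : Mesh :=
  (M.chordAt k a (a + 1) 7).chord M.cells.length 2
    ((M.cells.getD k []).take a ++ [(M.cells.getD k []).getD a 0, M.size, M.size + 1])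
    (M.size + 2) [M.size + 3, M.size + 4] (M.size + 5)
    ((M.size + 6) :: (M.cells.getD k []).getD (a + 1) 0 :: (M.cells.getD k []).drop (a + 2))

/-- The stem and the loop lie on a chord and a second chord over part of it; the stretch through
`M.size + 6` back to the boundary is not part of the graph. The loop is traversed starting with
`M.size + 7` and `M.size + 8`, which lie on the large remaining cell, because the first two inner
vertices of each path are the ones tested in `Picture.Meets`. -/
theorem Draws.lollipop (h : Draws M vs D L) {n i k a p : ℕ} (hn : vs.length = n)
    (ha : a + 1 < (M.cells.getD k []).length) (hp : (M.cells.getD k []).getD a 0 = p)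
    (hpq : p ≠ (M.cells.getD k []).getD (a + 1) 0) (hpi : Inner p (D.getD i [])) :
    Draws (M.lollipop k a) (vs ++ [p] ++ [M.size + 2])
      (splitPath D i p ++ [[p, M.size, M.size + 1, M.size + 2]] ++
        [[M.size + 2, M.size + 7, M.size + 8, M.size + 5, M.size + 4, M.size + 3, M.size + 2]])
      (addLoop L i n (n + 1)) := by
  subst hn
  have hbd := h.realizable.bounded
  have h1 := h.drawn.splitPath hpi
  have hi : i < L.length := h.length_eq ▸ lt_length_of_inner hpi
  have hps := h.drawn.lt_of_inner hbd hpi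
  refine ⟨?_, ?_, ?_, ?_⟩
  · refine (h.realizable.chordAt (Nat.lt_succ_self a) ha (by omega) (by rwa [hp])).chord
      (by simp [Mesh.chordAt, Mesh.chord]) ?_ (by omega) (by omega)
    simp [Mesh.chordAt, Mesh.chord, List.range']
  · rw [List.append_assoc (splitPath D i p)]
    refine h1.extend (fun z hz => ⟨hbd.lt hz, (hz.chord ..).chord ..⟩) ?_ ?_ (by simp)
    · simp [allPieces, pieces]
      omega
    · have harc : ∀ z ∈ links (path M.size 7 p ((M.cells.getD k []).getD (a + 1) 0)) ++
          links (path (M.size + 7) 2 (M.size + 2) (M.size + 5)), (M.lollipop k a).HasPiece z := by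
        intro z hz
        left
        simp only [Mesh.lollipop, Mesh.chordAt, Mesh.chord, hp, List.append_assoc]
        exact List.mem_append_right _ hz
      have hver : ∀ d < 9, (M.lollipop k a).HasPiece s(M.size + d, M.size + d) := fun d hd =>
        Or.inr ⟨M.size + d, by simp only [Mesh.lollipop, Mesh.chordAt, Mesh.chord]; omega, rfl⟩
      intro z hz
      simp only [allPieces, List.map_cons, List.map_nil, List.flatMap_cons, List.flatMap_nil,
        pieces, List.append_nil, List.cons_append, List.nil_append, List.mem_cons,
        List.not_mem_nil, or_false] at hz
      simp only [links, path, List.range', List.cons_append, List.nil_append, List.tail_cons,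
        List.zipWith_cons_cons, List.zipWith_nil_right, List.mem_cons, List.not_mem_nil,
        or_false] at harc
      rcases hz with rfl | rfl | rfl | rfl | rfl | rfl | rfl | rfl | rfl | rfl | rfl | rfl | rfl |
        rfl | rfl | rfl | rfl
      all_goals
        refine ⟨?_, by simp⟩
        first
        | exact hver 0 (by omega)
        | exact hver _ (by omega)
        | exact harc _ (by simp)
  · rw [addLoop_map _ _ _ hi, h.map_ends, List.map_append, List.map_append, ends_splitPath hpi,
      addLoop]
    · simp [ends]
    · intro a ha
      simp [List.getElem?_append_left ha, ha]
  · intro z hz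
    have hlt : ∀ z ∈ L, z.1 < vs.length + 2 ∧ z.2 < vs.length + 2 := fun z hz => by
      have := h.lt z hz
      omega
    suffices z.1 < vs.length + 2 ∧ z.2 < vs.length + 2 by simpa
    simp only [addLoop, List.mem_append, List.mem_singleton] at hz
    rcases hz with (hz | rfl) | rfl
    · exact lt_of_mem_subdivide hi (by omega) hlt z hz
    · simp
    · simp

end Draws

end CubicTorus

/-! ### Toroidality from cofacial edges, and the drawing of `G1`. -/

namespace CubicTorus

open Set Function
open scoped Graph

theorem Drawn.nodup_vertices {M : Mesh} {V : List ℕ} {D : List (List ℕ)} (h : Drawn M V D) :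
    V.Nodup :=
  List.Nodup.of_map _ (List.nodup_append.1 h.nodup).1

section Draws

variable {M : Mesh} {vs : List ℕ} {D : List (List ℕ)} {L : List (ℕ × ℕ)} {α β : Type*}
  {K : Graph α β} {v : ℕ → α} {es : List β}

theorem Presents.relabel (hK : Presents K v es (List.range vs.length) L) (hvs : vs.Nodup) :
    ∃ v' es', Presents K v' es' vs (L.map (Prod.map (vs.getD · 0) (vs.getD · 0))) := by
  refine hK.transfer (vs.getD · 0) ?_ ?_ (List.Perm.refl _)
  · rwa [map_range_getD]
  · rw [map_range_getD]

theorem Draws.toroidal_addChord (h : Draws M vs D L) {n i j : ℕ} (hn : vs.length = n)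
    (hi : i < L.length) (hj : j < L.length + 1)
    (hK : Presents K v es (List.range (n + 2)) (addChord L i j n (n + 1)))
    (hc : M.Cofacial (D.getD i []) (D.getD (if j = L.length then i else j) [])) : Toroidal K := by
  subst hn
  have hl := h.length_eq
  refine h.drawn.nonempty_embedding_addChord h.realizable (i := i) (j := j) (by omega) (by omega)
    ?_ (by rwa [parentIndex, hl])
  intro p hp q hq hpq
  have hnd : (vs ++ [p] ++ [q]).Nodup := by
    simp only [List.nodup_append, h.drawn.nodup_vertices]
    simp
    grind
  have hlen : (vs ++ [p] ++ [q]).length = vs.length + 2 := by simp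
  rw [← hlen] at hK
  obtain ⟨v', es', h'⟩ := hK.relabel hnd
  refine ⟨v', es', ?_⟩
  rw [addChord_map _ _ _ hi hj, h.map_ends] at h'
  · simpa using h'
  · intro a ha
    simp [List.getElem?_append_left ha, ha]

theorem Draws.toroidal_addLoop (h : Draws M vs D L) {n i : ℕ} (hn : vs.length = n)
    (hi : i < L.length) (hK : Presents K v es (List.range (n + 2)) (addLoop L i n (n + 1)))
    (hc : M.Cofacial (D.getD i []) (D.getD i [])) : Toroidal K := by
  subst hn
  refine h.drawn.nonempty_embedding_addLoop h.realizable (i := i) ?_ hc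
  intro p hp q hq hpq
  have hnd : (vs ++ [p] ++ [q]).Nodup := by
    simp only [List.nodup_append, h.drawn.nodup_vertices]
    simp
    grind
  have hlen : (vs ++ [p] ++ [q]).length = vs.length + 2 := by simp
  rw [← hlen] at hK
  obtain ⟨v', es', h'⟩ := hK.relabel hnd
  refine ⟨v', es', ?_⟩
  rw [addLoop_map _ _ _ hi, h.map_ends] at h'
  · simpa using h'
  · intro a ha
    simp [List.getElem?_append_left ha, ha]

end Draws

/-- The graph `G₁` on the torus, with eight additional vertices on every edge. -/
def meshG1 : Mesh :=
  ((((theta 8 44 44).chordAt 0 36 63 8).chordAt 1 54 99 8).chordAt 2 27 108 8).chordAt 3 18 45 8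

/-- The vertices of `meshG1` that represent the vertices of `G₁`. -/
def verticesG1 : List ℕ := [0, 36, 71, 1, 27, 80, 62, 45, 89, 18]

/-- The paths of `meshG1` that represent the edges of `G₁`. -/
def pathsG1 : List (List ℕ) :=
  [path 2 8 0 1, (path 28 8 27 36).reverse, path 72 8 71 80,
    path 54 8 0 62, (path 46 8 45 0).reverse, path 98 8 36 62, path 37 8 36 45,
    (path 63 8 62 71).reverse, path 106 8 71 45,
    (path 90 8 89 1).reverse, path 10 8 1 18, path 114 8 27 89, (path 19 8 18 27).reverse,
    path 81 8 80 89, (path 122 8 18 80).reverse]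

/-- The vertices `A` and `A'` are the branch vertices of a spanning theta subgraph with paths `AA'`,
`A' 4 B' B 2 A` and `A 1 C C' 3 A'`. The chords are `B1`, `B'3`, `C2` and `C'4`. A long path has
four inner vertices and five edges, whence `44 = 4 + 5 * 8`. Eight auxiliary vertices on an edge
suffice for two cuts leaving two inner vertices on each of the three parts. -/
theorem realizable_meshG1 : meshG1.Realizable (UnitAddCircle × UnitAddCircle) := by
  refine ((((theta_realizable (by norm_num) (by norm_num) (by norm_num)).chordAt ?_ ?_ ?_
    ?_).chordAt ?_ ?_ ?_ ?_).chordAt ?_ ?_ ?_ ?_).chordAt ?_ ?_ ?_ ?_ <;> decide +kernel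

/-- A numerical code of an unordered pair. -/
def pairCode : Sym2 ℕ → ℕ :=
  Sym2.lift ⟨fun a b => 1000 * min a b + max a b, fun a b => by
    simp only [min_comm a b, max_comm a b]⟩

/-- Distinctness is checked on the numerical codes, which is cheap to evaluate. Distinct codes force
distinct pairs, so injectivity of `pairCode` is not needed. -/
theorem drawn_meshG1 : Drawn meshG1 verticesG1 pathsG1 := by
  have h1 : ((allPieces verticesG1 pathsG1).map pairCode).Nodup := by decide +kernel
  have h2 : ∀ a ∈ verticesG1, a < meshG1.size := by decide +kernel
  have h3 : ∀ l ∈ pathsG1, ∀ a ∈ l, a < meshG1.size := by decide +kernel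
  have h4 : ∀ l ∈ pathsG1, ∀ z ∈ links l, z ∈ meshG1.arcs := by decide +kernel
  refine ⟨List.Nodup.of_map _ h1, fun z hz => ?_, by decide⟩
  rcases List.mem_append.1 hz with hz | hz
  · obtain ⟨a, ha, rfl⟩ := List.mem_map.1 hz
    exact Or.inr ⟨a, h2 a ha, rfl⟩
  · obtain ⟨l, hl, hz⟩ := List.mem_flatMap.1 hz
    rcases pieces_subset hz with hz | ⟨a, ha, rfl⟩
    · exact Or.inl (h4 l hl z hz)
    · exact Or.inr ⟨a, h3 l hl a ha, rfl⟩

end CubicTorus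

/-! ### Pictures, automorphisms of `G1`, and a fast test for common cells. -/

namespace CubicTorus

open Set Function
open scoped Graph

/-- A mesh with chosen vertices and paths. -/
structure Picture where
  mesh : Mesh
  vertices : List ℕ
  paths : List (List ℕ)

/-- The picture is a drawing on the torus of the graph with the edge list `L`. -/
def Picture.DrawsList (P : Picture) (L : List (ℕ × ℕ)) : Prop := Draws P.mesh P.vertices P.paths L

/-- The automorphisms of `G₁`, as lists of images. -/
def symmetriesG1 : List (List ℕ) :=
  [[0, 1, 2], [0, 2, 1], [1, 0, 2], [1, 2, 0], [2, 0, 1], [2, 1, 0]].flatMap fun w =>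
    [[6, 7], [7, 6]].flatMap fun s => [[8, 9], [9, 8]].flatMap fun t =>
      [w ++ w.map (· + 3) ++ s ++ t, w.map (· + 3) ++ w ++ t ++ s]

/-- The image of a pair of vertices under `σ`. -/
def imagePair (σ : List ℕ) (z : ℕ × ℕ) : ℕ × ℕ := (σ.getD z.1 0, σ.getD z.2 0)

/-- The index of the image under `σ` of an edge of `G₁`. -/
def imageIndex (σ : List ℕ) (z : ℕ × ℕ) : ℕ := edgesG1.idxOf (sortEnds (imagePair σ z))

/-- The drawing of `G₁` relabelled by the automorphism `σ`. -/
def pictureG1 (σ : List ℕ) : Picture where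
  mesh := meshG1
  vertices := σ.map fun a => verticesG1.getD a 0
  paths := selectPaths pathsG1 (edgesG1.map fun z =>
    (imageIndex σ z, decide ((imagePair σ z).2 < (imagePair σ z).1)))

/-- An automorphism carries the edge list of `G1` to itself up to order and orientation, so the one
mesh, with its paths reordered and reversed, is again a drawing. The relabelled drawings show
different pairs of edges on a common cell. -/
theorem pictureG1_drawsList {σ : List ℕ} (hσ : σ ∈ symmetriesG1) :
    (pictureG1 σ).DrawsList edgesG1 := by
  have h1 : ∀ σ ∈ symmetriesG1, σ.Perm (List.range 10) := by decide +kernel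
  have h2 : ∀ σ ∈ symmetriesG1,
      (edgesG1.map (imageIndex σ)).Perm (List.range pathsG1.length) := by decide +kernel
  have h3 : ∀ σ ∈ symmetriesG1, (pictureG1 σ).paths.map ends = edgesG1.map
      (Prod.map ((pictureG1 σ).vertices.getD · 0) ((pictureG1 σ).vertices.getD · 0)) := by
    decide +kernel
  have h4 : ∀ z ∈ edgesG1, z.1 < 10 ∧ z.2 < 10 := by decide
  have hlen : (pictureG1 σ).vertices.length = 10 := by
    simpa [pictureG1] using (h1 σ hσ).length_eq
  refine ⟨realizable_meshG1, drawn_meshG1.selectPaths ?_ ?_, h3 σ hσ, by rwa [hlen]⟩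
  · exact (h1 σ hσ).map _
  · rw [List.map_map]
    exact h2 σ hσ

/-- Draw a new edge through the cell `k`, from its vertex number `a`, which lies on the path `i`,
to its vertex number `b`, which lies on the path `j`. -/
def Picture.addChord (P : Picture) (i j k a b : ℕ) : Picture where
  mesh := P.mesh.chordAt k a b 2
  vertices := P.vertices ++ [(P.mesh.cells.getD k []).getD a 0] ++
    [(P.mesh.cells.getD k []).getD b 0]
  paths := splitPath (splitPath P.paths i ((P.mesh.cells.getD k []).getD a 0)) j
    ((P.mesh.cells.getD k []).getD b 0) ++
    [path P.mesh.size 2 ((P.mesh.cells.getD k []).getD a 0) ((P.mesh.cells.getD k []).getD b 0)]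

/-- The conditions under which `Picture.addChord` is a drawing. -/
def Picture.CanAddChord (P : Picture) (i j k a b : ℕ) : Prop :=
  P.vertices.length = 10 ∧ a < b ∧ b < (P.mesh.cells.getD k []).length ∧
    (P.mesh.cells.getD k []).getD a 0 ≠ (P.mesh.cells.getD k []).getD b 0 ∧
    Inner ((P.mesh.cells.getD k []).getD a 0) (P.paths.getD i []) ∧
    Inner ((P.mesh.cells.getD k []).getD b 0)
      ((splitPath P.paths i ((P.mesh.cells.getD k []).getD a 0)).getD j [])

instance (P : Picture) (i j k a b : ℕ) : Decidable (P.CanAddChord i j k a b) :=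
  inferInstanceAs (Decidable (_ ∧ _))

theorem Picture.DrawsList.addChord {P : Picture} {L : List (ℕ × ℕ)} (h : P.DrawsList L)
    {i j k a b : ℕ} (hP : P.CanAddChord i j k a b) :
    (P.addChord i j k a b).DrawsList (CubicTorus.addChord L i j 10 11) :=
  Draws.chordAt h hP.1 hP.2.1 hP.2.2.1 two_pos rfl rfl hP.2.2.2.1 hP.2.2.2.2.1 hP.2.2.2.2.2

/-- Draw a new pendant loop in the cell `k`, attached to its vertex number `a`, which lies on the
path `i`. -/
def Picture.addLoop (P : Picture) (i k a : ℕ) : Picture where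
  mesh := P.mesh.lollipop k a
  vertices := P.vertices ++ [(P.mesh.cells.getD k []).getD a 0] ++ [P.mesh.size + 2]
  paths := splitPath P.paths i ((P.mesh.cells.getD k []).getD a 0) ++
    [[(P.mesh.cells.getD k []).getD a 0, P.mesh.size, P.mesh.size + 1, P.mesh.size + 2]] ++
    [[P.mesh.size + 2, P.mesh.size + 7, P.mesh.size + 8, P.mesh.size + 5, P.mesh.size + 4,
      P.mesh.size + 3, P.mesh.size + 2]]

/-- The conditions under which `Picture.addLoop` is a drawing. -/
def Picture.CanAddLoop (P : Picture) (i k a : ℕ) : Prop :=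
  P.vertices.length = 10 ∧ a + 1 < (P.mesh.cells.getD k []).length ∧
    (P.mesh.cells.getD k []).getD a 0 ≠ (P.mesh.cells.getD k []).getD (a + 1) 0 ∧
    Inner ((P.mesh.cells.getD k []).getD a 0) (P.paths.getD i [])

instance (P : Picture) (i k a : ℕ) : Decidable (P.CanAddLoop i k a) :=
  inferInstanceAs (Decidable (_ ∧ _))

theorem Picture.DrawsList.addLoop {P : Picture} {L : List (ℕ × ℕ)} (h : P.DrawsList L)
    {i k a : ℕ} (hP : P.CanAddLoop i k a) :
    (P.addLoop i k a).DrawsList (CubicTorus.addLoop L i 10 11) :=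
  Draws.lollipop h hP.1 hP.2.1 rfl hP.2.2.1 hP.2.2.2

/-- The set of the members of a list, as the binary digits of a number. -/
def bits (l : List ℕ) : ℕ := l.foldr (fun a s => s ||| 2 ^ a) 0

theorem mem_of_testBit_bits {l : List ℕ} {a : ℕ} (h : (bits l).testBit a = true) : a ∈ l := by
  induction l with
  | nil => simp [bits] at h
  | cons b l ih =>
    simp only [bits, List.foldr_cons, Nat.testBit_or, Bool.or_eq_true] at h
    rcases h with h | h
    · exact List.mem_cons_of_mem _ (ih h)
    · rw [Nat.testBit_two_pow, decide_eq_true_eq] at h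
      simp [h]

/-- The cells that contain `x`, as the binary digits of a number. -/
def Mesh.around (M : Mesh) (x : ℕ) : ℕ :=
  (M.cells.map bits).foldr (fun s n => 2 * n + (s.testBit x).toNat) 0

/-- A binary digit shared by both numbers names a cell containing both vertices. Thus a single
bitwise operation replaces a search through all cells during evaluation. -/
theorem exists_mem_cells_of_land {M : Mesh} {x y : ℕ} (h : M.around x &&& M.around y ≠ 0) :
    ∃ c ∈ M.cells, x ∈ c ∧ y ∈ c := by
  have key : ∀ C : List (List ℕ),
      ((C.map bits).foldr (fun s n => 2 * n + (s.testBit x).toNat) 0 &&&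
        (C.map bits).foldr (fun s n => 2 * n + (s.testBit y).toNat) 0) ≠ 0 →
      ∃ c ∈ C, x ∈ c ∧ y ∈ c := by
    intro C
    induction C with
    | nil => simp
    | cons c C ih =>
      intro h
      by_cases hc : (bits c).testBit x = true ∧ (bits c).testBit y = true
      · exact ⟨c, by simp, mem_of_testBit_bits hc.1, mem_of_testBit_bits hc.2⟩
      · obtain ⟨d, hd, h'⟩ := ih fun h0 => h (by
          simp only [List.map_cons, List.foldr_cons]
          refine Nat.eq_of_testBit_eq fun i => ?_
          have h0i := congrArg (Nat.testBit · (i - 1)) h0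
          rw [Nat.testBit_and, Nat.zero_testBit]
          simp only [Nat.testBit_and, Nat.zero_testBit] at h0i
          cases i with
          | zero =>
            simp only [Nat.testBit_zero]
            rcases hx : (bits c).testBit x <;> rcases hy : (bits c).testBit y <;>
              simp_all [Nat.add_mod]
          | succ i =>
            simp only [Nat.testBit_succ, Nat.add_sub_cancel] at h0i ⊢
            have e : ∀ (n : ℕ) (b : Bool), (2 * n + b.toNat) / 2 = n := by
              intro n b
              have := b.toNat_lt
              omega
            rwa [e, e])
        exact ⟨d, List.mem_cons_of_mem _ hd, h'⟩
  exact key _ h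

/-- The first two inner vertices of every path. -/
def Picture.Marked (P : Picture) : Prop :=
  ∀ d ∈ P.paths, Inner (d.getD 1 0) d ∧ Inner (d.getD 2 0) d

/-- The paths `i` and `j` have inner vertices on a common cell. -/
def Picture.Meets (P : Picture) (i j : ℕ) : Prop :=
  (P.paths.getD i []).getD 1 0 ≠ (P.paths.getD j []).getD 2 0 ∧
    P.mesh.around ((P.paths.getD i []).getD 1 0) &&&
      P.mesh.around ((P.paths.getD j []).getD 2 0) ≠ 0

instance (P : Picture) (i j : ℕ) : Decidable (P.Meets i j) := inferInstanceAs (Decidable (_ ∧ _))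

instance (P : Picture) : Decidable P.Marked := inferInstanceAs (Decidable (∀ d ∈ _, _))

/-- Each path is represented by its first two inner vertices. The first is used for `i` and the
second for `j`, so that the test also makes sense for `i = j`. -/
theorem Picture.Meets.cofacial {P : Picture} (hP : P.Marked) {i j : ℕ} (h : P.Meets i j)
    (hi : i < P.paths.length) (hj : j < P.paths.length) :
    P.mesh.Cofacial (P.paths.getD i []) (P.paths.getD j []) := by
  obtain ⟨c, hc, hx, hy⟩ := exists_mem_cells_of_land h.2
  refine ⟨c, hc, _, hx, _, hy, h.1, ?_, ?_⟩
  · rw [List.getD_eq_getElem _ _ hi]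
    exact (hP _ (List.getElem_mem hi)).1
  · rw [List.getD_eq_getElem _ _ hj]
    exact (hP _ (List.getElem_mem hj)).2

end CubicTorus

/-! ### Atlases: every pair of edges is cofacial or yields an excluded graph. -/

namespace CubicTorus

open Set Function
open scoped Graph

/-- Cuts in different edges commute; only the order of the two second halves and the orientation of
the new edge change. -/
theorem addChord_perm_symm {L : List (ℕ × ℕ)} {i j p q : ℕ} (hij : i ≠ j) (hi : i < L.length)
    (hj : j < L.length) :
    ((addChord L i j p q).map sortEnds).Perm ((addChord L j i q p).map sortEnds) := by
  have h : ∀ {i j : ℕ} (p q : ℕ), i ≠ j → i < L.length → j < L.length → addChord L i j p q =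
      (L.set i ((L.getD i (0, 0)).1, p)).set j ((L.getD j (0, 0)).1, q) ++
        [(p, (L.getD i (0, 0)).2), (q, (L.getD j (0, 0)).2), (p, q)] := by
    intro i j p q hij hi hj
    simp [addChord, subdivide, List.getElem?_append_left, List.set_append_left, hi, hj, hij]
  have e : sortEnds (p, q) = sortEnds (q, p) := by simp [sortEnds, min_comm, max_comm]
  rw [h p q hij hi hj, h q p hij.symm hj hi, List.set_comm _ _ hij]
  simp only [List.map_append, List.map_cons, List.map_nil, e]
  exact (List.Perm.swap _ _ _).append_left _

/-- The edge lists of the graphs `H₄, …, H₉`. -/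
def edgesH : List (List (ℕ × ℕ)) :=
  [addChord (addChord edgesG1 0 1 10 11) 0 2 12 13,
    addChord (addChord edgesG1 0 1 10 11) 3 6 12 13,
    addChord (addChord edgesG1 3 6 10 11) 3 6 12 13,
    addChord (addChord edgesG1 3 6 10 11) 3 5 12 13,
    addChord (addChord edgesG1 3 6 10 11) 4 5 12 13,
    addChord (addChord edgesG1 0 1 10 11) 17 2 12 13]

/-- After the first join, a subdivided edge's first half keeps its index, `15` and `16` are the
second halves, and `17` is the new edge. So `Ax` has the index of the edge through `x`, and `xy` has
index `17`. -/
theorem isomorphic_of_presents_edgesH {α β : Type*} {K : Graph α β} {v : ℕ → α} {es : List β}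
    {L : List (ℕ × ℕ)} (hL : L ∈ edgesH) (h : Presents K v es (List.range 14) L) :
    Isomorphic K H4 ∨ Isomorphic K H5 ∨ Isomorphic K H6 ∨ Isomorphic K H7 ∨ Isomorphic K H8 ∨
      Isomorphic K H9 := by
  simp only [edgesH, List.mem_cons, List.not_mem_nil, or_false] at hL
  rcases hL with rfl | rfl | rfl | rfl | rfl | rfl
  · exact Or.inl (h.isomorphic (by decide +kernel))
  · exact Or.inr (Or.inl (h.isomorphic (by decide +kernel)))
  · exact Or.inr (Or.inr (Or.inl (h.isomorphic (by decide +kernel))))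
  · exact Or.inr (Or.inr (Or.inr (Or.inl (h.isomorphic (by decide +kernel)))))
  · exact Or.inr (Or.inr (Or.inr (Or.inr (Or.inl (h.isomorphic (by decide +kernel))))))
  · exact Or.inr (Or.inr (Or.inr (Or.inr (Or.inr (h.isomorphic (by decide +kernel))))))

/-- Two edges, the graph among `H₄, …, H₉` that arises when they are joined, and an isomorphism. -/
structure Obstruction where
  fst : ℕ
  snd : ℕ
  target : ℕ
  perm : List ℕ

/-- The obstruction is correct for the graph with the edge list `L`. -/
def Obstruction.Correct (o : Obstruction) (L : List (ℕ × ℕ)) : Prop :=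
  o.fst < o.snd ∧ o.snd < L.length ∧ o.target < edgesH.length ∧ o.perm.Perm (List.range 14) ∧
    ((edgesH.getD o.target []).map sortEnds).Perm
      (((addChord L o.fst o.snd 12 13).map (imagePair o.perm)).map sortEnds)

instance (o : Obstruction) (L : List (ℕ × ℕ)) : Decidable (o.Correct L) :=
  inferInstanceAs (Decidable (_ ∧ _))

/-- A graph with twelve vertices, pictures of it, and obstructions. -/
structure Atlas where
  edges : List (ℕ × ℕ)
  pictures : List Picture
  obstructions : List Obstruction

/-- The pictures and the obstructions of the atlas are correct, and settle all pairs of edges. -/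
structure Atlas.Complete (A : Atlas) : Prop where
  draws : ∀ P ∈ A.pictures, P.DrawsList A.edges
  length_eq : ∀ P ∈ A.pictures, P.vertices.length = 12
  marked : ∀ P ∈ A.pictures, P.Marked
  correct : ∀ o ∈ A.obstructions, o.Correct A.edges
  covers : ∀ j < A.edges.length, ∀ i < j + 1,
    (∃ o ∈ A.obstructions, o.fst = i ∧ o.snd = j) ∨ ∃ P ∈ A.pictures, P.Meets i j

section Complete

variable {A : Atlas} {α β : Type*} {K : Graph α β} {v : ℕ → α} {es : List β}

theorem Obstruction.Correct.isomorphic {o : Obstruction} {L : List (ℕ × ℕ)} (h : o.Correct L)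
    (hK : Presents K v es (List.range 14) (addChord L o.fst o.snd 12 13)) :
    Isomorphic K H4 ∨ Isomorphic K H5 ∨ Isomorphic K H6 ∨ Isomorphic K H7 ∨ Isomorphic K H8 ∨
      Isomorphic K H9 := by
  obtain ⟨h1, h2, h3, h4, h5⟩ := h
  have hlen : o.perm.length = 14 := by simpa using h4.length_eq
  have hmap : (List.range 14).map (fun a => o.perm.getD a 0) = o.perm := by
    rw [← hlen, map_range_getD]
  obtain ⟨v', es', h⟩ := hK.transfer (fun a => o.perm.getD a 0) (V' := List.range 14)
    (L' := edgesH.getD o.target []) (by rw [hmap]; exact h4.nodup_iff.2 List.nodup_range)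
    (by rw [hmap]; exact h4.symm) h5
  refine isomorphic_of_presents_edgesH ?_ h
  rw [List.getD_eq_getElem _ _ h3]
  exact List.getElem_mem h3

theorem Atlas.Complete.cofacial (h : A.Complete) {i j : ℕ} (hi : i < A.edges.length)
    (hj : j < A.edges.length) :
    (∃ o ∈ A.obstructions, i = o.fst ∧ j = o.snd ∨ i = o.snd ∧ j = o.fst) ∨
      ∃ P ∈ A.pictures, P.mesh.Cofacial (P.paths.getD i []) (P.paths.getD j []) := by
  have key : ∀ {i j : ℕ}, i < j + 1 → j < A.edges.length →
      (∃ o ∈ A.obstructions, i = o.fst ∧ j = o.snd) ∨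
      ∃ P ∈ A.pictures, P.mesh.Cofacial (P.paths.getD i []) (P.paths.getD j []) := by
    intro i j hij hj
    rcases h.covers j hj i hij with ⟨o, ho, h1, h2⟩ | ⟨P, hP, hm⟩
    · exact Or.inl ⟨o, ho, h1.symm, h2.symm⟩
    · have := (h.draws P hP).length_eq
      exact Or.inr ⟨P, hP, hm.cofacial (h.marked P hP) (by omega) (by omega)⟩
  rcases le_total i j with hij | hij
  · rcases key (Nat.lt_succ_of_le hij) hj with ⟨o, ho, h1⟩ | h1
    · exact Or.inl ⟨o, ho, Or.inl h1⟩
    · exact Or.inr h1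
  · rcases key (Nat.lt_succ_of_le hij) hi with ⟨o, ho, h1, h2⟩ | ⟨P, hP, h1⟩
    · exact Or.inl ⟨o, ho, Or.inr ⟨h2, h1⟩⟩
    · exact Or.inr ⟨P, hP, h1.symm⟩

/-- A correct obstruction has `fst < snd`, so the diagonal can only be settled by pictures. -/
theorem Atlas.Complete.exists_cofacial_self (h : A.Complete) {i : ℕ} (hi : i < A.edges.length) :
    ∃ P ∈ A.pictures, P.mesh.Cofacial (P.paths.getD i []) (P.paths.getD i []) := by
  rcases h.cofacial hi hi with ⟨o, ho, h1⟩ | h1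
  · have := (h.correct o ho).1
    omega
  · exact h1

/-- A pair of edges is settled by a picture or an obstruction. A pendant loop, or a cut in the
second half of the first edge, only needs an edge cofacial with itself. -/
theorem Atlas.Complete.toroidal_or_isomorphic (h : A.Complete)
    (hK : Presents K v es (List.range 12) A.edges) {K₂ : Graph α β} (hK₂ : IsAddEdge K K₂) :
    Toroidal K₂ ∨ Isomorphic K₂ H4 ∨ Isomorphic K₂ H5 ∨ Isomorphic K₂ H6 ∨ Isomorphic K₂ H7 ∨
      Isomorphic K₂ H8 ∨ Isomorphic K₂ H9 := by
  rcases hK.addEdge hK₂ with ⟨i, hi, j, hj, h'⟩ | ⟨i, hi, h'⟩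
  · obtain ⟨v', es', hp⟩ := h' 12 (by simp) 13 (by simp) (by norm_num)
    have hp : Presents K₂ v' es' (List.range 14) (addChord A.edges i j 12 13) := hp
    by_cases hjl : j = A.edges.length
    · obtain ⟨P, hP, hc⟩ := h.exists_cofacial_self hi
      refine Or.inl ((h.draws P hP).toroidal_addChord (h.length_eq P hP) hi hj hp ?_)
      rwa [if_pos hjl]
    · rcases h.cofacial hi (j := j) (by omega) with
        ⟨o, ho, ⟨rfl, rfl⟩ | ⟨rfl, rfl⟩⟩ | ⟨P, hP, hc⟩
      · exact Or.inr ((h.correct o ho).isomorphic hp)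
      · obtain ⟨h1, h2, -⟩ := h.correct o ho
        -- The obstruction names the pair in the opposite order. Giving the new vertices the names
        -- `13` and `12` makes the two edge lists agree up to order and orientation.
        obtain ⟨v', es', hp⟩ := h' 13 (by simp) 12 (by simp) (by norm_num)
        obtain ⟨v', es', hp⟩ := hp.transfer id (V' := List.range 14)
          (L' := addChord A.edges o.fst o.snd 12 13) (by decide) (by decide) (by
            rw [Prod.map_id, List.map_id]
            exact addChord_perm_symm h1.ne (h1.trans h2) h2)
        exact Or.inr ((h.correct o ho).isomorphic hp)
      · refine Or.inl ((h.draws P hP).toroidal_addChord (h.length_eq P hP) hi hj hp ?_)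
        rwa [if_neg hjl]
  · obtain ⟨v', es', hp⟩ := h' 12 (by simp) 13 (by simp) (by norm_num)
    have hp : Presents K₂ v' es' (List.range 14) (addLoop A.edges i 12 13) := hp
    obtain ⟨P, hP, hc⟩ := h.exists_cofacial_self hi
    exact Or.inl ((h.draws P hP).toroidal_addLoop (h.length_eq P hP) hi hp hc)

end Complete

end CubicTorus

/-! ### The tables and their verification. -/

namespace CubicTorus

open Set Function
open scoped Graph

/-- Edges of `G₁` to which a pendant loop is attached, with the symmetries, cells and positions
for pictures. -/
def loopData : List (ℕ × List (ℕ × ℕ × ℕ)) :=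
  [(0, [(16, 2, 13), (2, 1, 40), (8, 1, 40), (17, 2, 12)]),
    (3, [(1, 2, 84), (18, 2, 21), (8, 0, 30), (0, 4, 50)])]

/-- Pairs of edges of `G₁` that are joined, where the index `15` stands for the second half of the
subdivided first edge, with the symmetries, cells and positions for pictures, and with
obstructions to joining a second pair. -/
def chordData : List (ℕ × ℕ × List (ℕ × ℕ × ℕ × ℕ) × List Obstruction) :=
  [(0, 15, [(16, 2, 56, 59), (2, 4, 3, 6), (8, 4, 3, 6), (17, 2, 11, 14)], []),
    (3, 15, [(1, 2, 83, 86), (18, 2, 20, 23), (10, 0, 29, 32), (3, 4, 12, 15), (11, 4, 12, 15)], []),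
    (0, 1, [(8, 4, 4, 32), (9, 4, 5, 31), (10, 4, 4, 32), (12, 4, 4, 32)],
      [⟨0, 2, 0, [0, 1, 2, 3, 4, 5, 6, 7, 8, 9, 10, 11, 12, 13]⟩,
        ⟨0, 7, 1, [12, 1, 2, 3, 4, 5, 13, 6, 8, 9, 10, 11, 0, 7]⟩,
        ⟨0, 8, 1, [12, 1, 2, 3, 4, 5, 6, 13, 8, 9, 10, 11, 0, 7]⟩,
        ⟨0, 13, 2, [5, 3, 4, 11, 12, 1, 8, 9, 10, 13, 7, 0, 2, 6]⟩,
        ⟨0, 14, 2, [5, 3, 4, 11, 12, 1, 8, 9, 13, 10, 7, 0, 2, 6]⟩,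
        ⟨1, 2, 0, [1, 0, 2, 4, 3, 5, 6, 7, 8, 9, 11, 10, 12, 13]⟩,
        ⟨1, 7, 1, [0, 13, 2, 3, 4, 5, 12, 7, 8, 9, 10, 11, 1, 6]⟩,
        ⟨1, 8, 1, [0, 13, 2, 3, 4, 5, 7, 12, 8, 9, 10, 11, 1, 6]⟩,
        ⟨1, 13, 2, [3, 5, 4, 12, 11, 1, 8, 9, 10, 13, 0, 7, 2, 6]⟩,
        ⟨1, 14, 2, [3, 5, 4, 12, 11, 1, 8, 9, 13, 10, 0, 7, 2, 6]⟩,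
        ⟨2, 15, 0, [0, 2, 1, 3, 5, 4, 6, 7, 8, 9, 12, 13, 11, 10]⟩,
        ⟨2, 16, 0, [2, 0, 1, 5, 3, 4, 6, 7, 8, 9, 13, 12, 11, 10]⟩,
        ⟨2, 17, 5, [0, 1, 2, 3, 4, 5, 6, 7, 8, 9, 10, 11, 13, 12]⟩,
        ⟨3, 6, 1, [0, 1, 2, 3, 4, 5, 6, 7, 8, 9, 10, 11, 12, 13]⟩,
        ⟨4, 5, 1, [0, 1, 2, 3, 4, 5, 7, 6, 8, 9, 10, 11, 12, 13]⟩,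
        ⟨7, 15, 2, [10, 13, 0, 5, 4, 3, 11, 12, 8, 9, 6, 1, 7, 2]⟩,
        ⟨7, 16, 2, [12, 11, 1, 3, 5, 4, 10, 13, 8, 9, 0, 7, 6, 2]⟩,
        ⟨7, 17, 3, [6, 12, 1, 5, 3, 4, 10, 13, 8, 9, 2, 0, 11, 7]⟩,
        ⟨8, 15, 2, [10, 13, 0, 5, 4, 3, 12, 11, 8, 9, 6, 1, 7, 2]⟩,
        ⟨8, 16, 2, [12, 11, 1, 3, 5, 4, 13, 10, 8, 9, 0, 7, 6, 2]⟩,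
        ⟨8, 17, 3, [6, 12, 1, 5, 3, 4, 13, 10, 8, 9, 2, 0, 11, 7]⟩,
        ⟨9, 12, 1, [3, 4, 5, 0, 1, 2, 8, 9, 6, 7, 10, 11, 12, 13]⟩,
        ⟨10, 11, 1, [3, 4, 5, 0, 1, 2, 8, 9, 7, 6, 10, 11, 12, 13]⟩,
        ⟨13, 15, 1, [3, 4, 5, 12, 1, 2, 8, 9, 13, 6, 10, 11, 7, 0]⟩,
        ⟨13, 16, 1, [3, 4, 5, 0, 13, 2, 8, 9, 12, 7, 10, 11, 6, 1]⟩,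
        ⟨13, 17, 3, [3, 5, 4, 12, 6, 1, 8, 9, 10, 13, 0, 2, 11, 7]⟩,
        ⟨14, 15, 1, [3, 4, 5, 12, 1, 2, 8, 9, 6, 13, 10, 11, 7, 0]⟩,
        ⟨14, 16, 1, [3, 4, 5, 0, 13, 2, 8, 9, 7, 12, 10, 11, 6, 1]⟩,
        ⟨14, 17, 3, [3, 5, 4, 12, 6, 1, 8, 9, 13, 10, 0, 2, 11, 7]⟩]),
    (0, 3, [(16, 2, 13, 21), (11, 4, 5, 13), (19, 2, 12, 66), (0, 4, 4, 50), (3, 4, 5, 13)], []),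
    (0, 5, [(8, 4, 4, 40), (19, 2, 12, 76), (11, 4, 5, 23), (17, 2, 12, 84)],
      [⟨0, 2, 2, [10, 0, 13, 5, 3, 4, 11, 12, 8, 9, 2, 7, 6, 1]⟩,
        ⟨0, 7, 2, [10, 2, 1, 3, 5, 4, 11, 6, 8, 9, 0, 7, 12, 13]⟩,
        ⟨0, 8, 3, [10, 2, 1, 3, 5, 4, 11, 6, 8, 9, 0, 7, 12, 13]⟩,
        ⟨1, 3, 4, [6, 11, 0, 5, 4, 3, 12, 10, 8, 9, 2, 7, 1, 13]⟩,
        ⟨2, 15, 1, [12, 2, 1, 3, 5, 4, 13, 6, 8, 9, 0, 7, 11, 10]⟩,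
        ⟨2, 17, 3, [6, 1, 12, 5, 4, 3, 10, 13, 8, 9, 2, 11, 0, 7]⟩,
        ⟨3, 5, 3, [11, 0, 2, 4, 3, 5, 6, 7, 8, 9, 1, 13, 10, 12]⟩,
        ⟨3, 6, 3, [6, 0, 1, 5, 3, 4, 11, 13, 8, 9, 2, 7, 10, 12]⟩,
        ⟨4, 16, 2, [12, 2, 1, 3, 5, 4, 13, 6, 8, 9, 0, 7, 10, 11]⟩,
        ⟨7, 15, 2, [10, 1, 2, 3, 4, 5, 11, 6, 8, 9, 12, 13, 7, 0]⟩,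
        ⟨7, 17, 3, [11, 2, 0, 4, 5, 3, 10, 7, 8, 9, 1, 6, 12, 13]⟩,
        ⟨8, 15, 3, [10, 1, 2, 3, 4, 5, 6, 11, 8, 9, 12, 13, 7, 0]⟩,
        ⟨8, 17, 4, [6, 1, 0, 5, 4, 3, 10, 13, 8, 9, 2, 11, 12, 7]⟩]),
    (3, 4, [(16, 0, 4, 12), (11, 2, 76, 84), (3, 2, 76, 84), (19, 3, 13, 21), (16, 2, 21, 49)], []),
    (3, 5, [(11, 4, 13, 23), (16, 0, 4, 30), (19, 2, 66, 76), (33, 1, 21, 31), (43, 3, 3, 13)],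
      [⟨0, 16, 3, [11, 0, 2, 4, 3, 5, 6, 7, 8, 9, 10, 12, 1, 13]⟩,
        ⟨1, 15, 3, [0, 11, 2, 3, 4, 5, 6, 7, 8, 9, 12, 10, 1, 13]⟩,
        ⟨2, 17, 3, [0, 2, 11, 3, 5, 4, 10, 7, 8, 9, 12, 6, 1, 13]⟩,
        ⟨3, 16, 5, [10, 11, 13, 0, 1, 2, 5, 12, 6, 7, 8, 4, 3, 9]⟩,
        ⟨4, 16, 3, [1, 0, 2, 4, 3, 5, 6, 7, 8, 9, 13, 12, 11, 10]⟩,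
        ⟨5, 15, 5, [10, 11, 13, 0, 1, 2, 5, 12, 6, 7, 3, 8, 4, 9]⟩,
        ⟨6, 15, 3, [0, 1, 2, 3, 4, 5, 6, 7, 8, 9, 12, 13, 11, 10]⟩,
        ⟨7, 17, 5, [10, 11, 13, 0, 1, 2, 8, 12, 6, 7, 3, 4, 5, 9]⟩,
        ⟨8, 17, 3, [0, 2, 1, 3, 5, 4, 13, 7, 8, 9, 12, 6, 11, 10]⟩]),
    (3, 6, [(16, 0, 4, 22), (42, 2, 31, 49), (47, 3, 3, 21), (17, 2, 4, 76)],
      [⟨0, 1, 1, [0, 1, 2, 3, 4, 5, 6, 7, 8, 9, 12, 13, 10, 11]⟩,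
        ⟨0, 5, 3, [6, 0, 1, 5, 3, 4, 11, 13, 8, 9, 10, 12, 2, 7]⟩,
        ⟨0, 6, 2, [12, 2, 1, 3, 5, 4, 6, 13, 8, 9, 10, 11, 0, 7]⟩,
        ⟨1, 3, 2, [2, 12, 1, 5, 3, 4, 13, 6, 8, 9, 11, 10, 0, 7]⟩,
        ⟨1, 4, 3, [0, 6, 1, 3, 5, 4, 13, 11, 8, 9, 12, 10, 2, 7]⟩,
        ⟨2, 17, 4, [0, 1, 6, 3, 4, 5, 13, 10, 8, 9, 12, 11, 2, 7]⟩,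
        ⟨3, 5, 3, [0, 1, 2, 3, 4, 5, 6, 7, 8, 9, 10, 11, 12, 13]⟩,
        ⟨3, 6, 2, [0, 1, 2, 3, 4, 5, 6, 7, 8, 9, 10, 11, 12, 13]⟩,
        ⟨4, 5, 4, [0, 1, 2, 3, 4, 5, 6, 7, 8, 9, 10, 11, 12, 13]⟩,
        ⟨4, 6, 3, [1, 0, 2, 4, 3, 5, 7, 6, 8, 9, 11, 10, 13, 12]⟩,
        ⟨7, 17, 3, [0, 1, 2, 3, 4, 5, 13, 7, 8, 9, 12, 11, 6, 10]⟩,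
        ⟨8, 17, 3, [1, 2, 0, 4, 5, 3, 7, 13, 8, 9, 11, 6, 12, 10]⟩,
        ⟨15, 16, 2, [0, 1, 2, 3, 4, 5, 6, 7, 8, 9, 12, 13, 10, 11]⟩]),
    (3, 9, [(17, 2, 4, 21), (3, 4, 13, 50), (18, 2, 21, 66), (35, 4, 23, 40), (11, 4, 13, 50), (43, 4, 23, 40)], []),
    (3, 11, [(11, 4, 13, 40), (16, 2, 21, 84), (42, 2, 31, 66), (32, 2, 31, 84), (35, 4, 23, 50)], [])]

/-- The atlas of `G₁` with a pendant loop. -/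
def loopAtlas (z : ℕ × List (ℕ × ℕ × ℕ)) : Atlas where
  edges := addLoop edgesG1 z.1 10 11
  pictures := z.2.map fun s => (pictureG1 (symmetriesG1.getD s.1 [])).addLoop z.1 s.2.1 s.2.2
  obstructions := []

/-- The atlas of `G₁` with a new edge that joins two edges. -/
def chordAtlas (z : ℕ × ℕ × List (ℕ × ℕ × ℕ × ℕ) × List Obstruction) : Atlas where
  edges := addChord edgesG1 z.1 z.2.1 10 11
  pictures := z.2.2.1.map fun s =>
    (pictureG1 (symmetriesG1.getD s.1 [])).addChord z.1 z.2.1 s.2.1 s.2.2.1 s.2.2.2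
  obstructions := z.2.2.2

theorem pictureG1_getD_drawsList {s : ℕ} (h : s < symmetriesG1.length) :
    (pictureG1 (symmetriesG1.getD s [])).DrawsList edgesG1 := by
  rw [List.getD_eq_getElem _ _ h]
  exact pictureG1_drawsList (List.getElem_mem h)

theorem loopData_canAddLoop : ∀ z ∈ loopData, ∀ s ∈ z.2, s.1 < symmetriesG1.length ∧
    (pictureG1 (symmetriesG1.getD s.1 [])).CanAddLoop z.1 s.2.1 s.2.2 := by
  decide +kernel

theorem loopData_marked : ∀ z ∈ loopData, ∀ P ∈ (loopAtlas z).pictures,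
    P.vertices.length = 12 ∧ P.Marked := by
  decide +kernel

theorem loopData_covers : ∀ z ∈ loopData, ∀ j < 18, ∀ i < j + 1,
    ∃ P ∈ (loopAtlas z).pictures, P.Meets i j := by
  decide +kernel

theorem loopAtlas_complete : ∀ z ∈ loopData, (loopAtlas z).Complete := by
  intro z hz
  have hlen : (loopAtlas z).edges.length = 18 := by simp [loopAtlas, addLoop, subdivide, edgesG1]
  refine ⟨?_, fun P hP => (loopData_marked z hz P hP).1, fun P hP => (loopData_marked z hz P hP).2,
    by simp [loopAtlas], ?_⟩
  · intro P hP
    obtain ⟨s, hs, rfl⟩ := List.mem_map.1 hP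
    obtain ⟨h1, h2⟩ := loopData_canAddLoop z hz s hs
    exact (pictureG1_getD_drawsList h1).addLoop h2
  · intro j hj i hi
    exact Or.inr (loopData_covers z hz j (hlen ▸ hj) i hi)

theorem chordData_canAddChord : ∀ z ∈ chordData, ∀ s ∈ z.2.2.1, s.1 < symmetriesG1.length ∧
    (pictureG1 (symmetriesG1.getD s.1 [])).CanAddChord z.1 z.2.1 s.2.1 s.2.2.1 s.2.2.2 := by
  decide +kernel

theorem chordData_marked : ∀ z ∈ chordData, ∀ P ∈ (chordAtlas z).pictures,
    P.vertices.length = 12 ∧ P.Marked := by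
  decide +kernel

theorem chordData_correct : ∀ z ∈ chordData, ∀ o ∈ (chordAtlas z).obstructions,
    o.Correct (chordAtlas z).edges := by
  decide +kernel

theorem chordData_covers : ∀ z ∈ chordData, ∀ j < 18, ∀ i < j + 1,
    (∃ o ∈ (chordAtlas z).obstructions, o.fst = i ∧ o.snd = j) ∨
      ∃ P ∈ (chordAtlas z).pictures, P.Meets i j := by
  decide +kernel

theorem chordAtlas_complete : ∀ z ∈ chordData, (chordAtlas z).Complete := by
  intro z hz
  have hlen : (chordAtlas z).edges.length = 18 := by
    simp [chordAtlas, addChord, subdivide, edgesG1]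
  refine ⟨?_, fun P hP => (chordData_marked z hz P hP).1,
    fun P hP => (chordData_marked z hz P hP).2, chordData_correct z hz, ?_⟩
  · intro P hP
    obtain ⟨s, hs, rfl⟩ := List.mem_map.1 hP
    obtain ⟨h1, h2⟩ := chordData_canAddChord z hz s hs
    exact (pictureG1_getD_drawsList h1).addChord h2
  · intro j hj i hi
    exact chordData_covers z hz j (hlen ▸ hj) i hi

/-- The images of the vertices of `G₁` under a symmetry, extended to the two new vertices. -/
def extendedSymmetries (σ : List ℕ) : List (List ℕ) := [σ ++ [10, 11], σ ++ [11, 10]]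

/-- The relabelling `τ` of twelve vertices takes the edges `L` to the edges `L'`. -/
def Relabels (τ : List ℕ) (L L' : List (ℕ × ℕ)) : Prop :=
  τ.Perm (List.range 12) ∧ (L'.map sortEnds).Perm ((L.map (imagePair τ)).map sortEnds)

instance (τ : List ℕ) (L L' : List (ℕ × ℕ)) : Decidable (Relabels τ L L') :=
  inferInstanceAs (Decidable (_ ∧ _))

/-- The automorphisms have two orbits on edges, represented by `AA'` and `A1`. -/
theorem exists_loopData : ∀ i < 15, ∃ σ ∈ symmetriesG1, ∃ z ∈ loopData,
    imageIndex σ (edgesG1.getD i (0, 0)) = z.1 ∧ ∃ τ ∈ extendedSymmetries σ,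
      Relabels τ (addLoop edgesG1 i 10 11) (loopAtlas z).edges := by
  decide +kernel

/-- The pair of the indices of the images under `σ` of two edges of `G₁` that are joined, where the
index `15` stands for the second half of the first edge. -/
def imageIndices (σ : List ℕ) (i j : ℕ) : ℕ × ℕ :=
  sortEnds (imageIndex σ (edgesG1.getD i (0, 0)),
    imageIndex σ (edgesG1.getD (if j = 15 then i else j) (0, 0)))

/-- Two representatives stand for a double subdivision and eight for pairs of distinct edges. Both
`j = i` and `j = 15` cut the same edge twice. The conditions on `imageIndices` are discarded
afterwards; they only spare the evaluation most comparisons of whole edge lists. -/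
theorem exists_chordData : ∀ i < 15, ∀ j < 16, ∃ σ ∈ symmetriesG1,
    (imageIndices σ i j).1 ∈ [0, 3] ∧ ∃ z ∈ chordData,
      imageIndices σ i j = (z.1, if z.2.1 = 15 then z.1 else z.2.1) ∧
        ∃ τ ∈ extendedSymmetries σ,
          Relabels τ (addChord edgesG1 i j 10 11) (chordAtlas z).edges := by
  decide +kernel

theorem exists_complete_atlas {α β : Type*} {K K₁ : Graph α β} (hK : Isomorphic K G1)
    (h₁ : IsAddEdge K K₁) : ∃ (A : Atlas) (v : ℕ → α) (es : List β), A.Complete ∧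
      Presents K₁ v es (List.range 12) A.edges := by
  obtain ⟨v, es, hp⟩ := exists_presents_of_isomorphic hK
  have key : ∀ {L L' : List (ℕ × ℕ)} {τ : List ℕ} {v : ℕ → α} {es : List β},
      Presents K₁ v es (List.range 12) L → Relabels τ L L' →
      ∃ (v : ℕ → α) (es : List β), Presents K₁ v es (List.range 12) L' := by
    rintro L L' τ v es h ⟨hτ, hL⟩
    have hlen : τ.length = 12 := by simpa using hτ.length_eq
    have hmap : (List.range 12).map (fun a => τ.getD a 0) = τ := by rw [← hlen, map_range_getD]
    exact h.transfer (fun a => τ.getD a 0) (by rw [hmap]; exact hτ.nodup_iff.2 List.nodup_range)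
      (by rw [hmap]; exact hτ.symm) hL
  rcases hp.addEdge h₁ with ⟨i, hi, j, hj, h⟩ | ⟨i, hi, h⟩
  · obtain ⟨v', es', h'⟩ := h 10 (by simp) 11 (by simp) (by norm_num)
    obtain ⟨σ, -, -, z, hz, -, τ, -, hτ⟩ := exists_chordData i hi j hj
    obtain ⟨v, es, hv⟩ := key h' hτ
    exact ⟨_, v, es, chordAtlas_complete z hz, hv⟩
  · obtain ⟨v', es', h'⟩ := h 10 (by simp) 11 (by simp) (by norm_num)
    obtain ⟨σ, -, z, hz, -, τ, -, hτ⟩ := exists_loopData i hi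
    obtain ⟨v, es, hv⟩ := key h' hτ
    exact ⟨_, v, es, loopAtlas_complete z hz, hv⟩

end CubicTorus

theorem mainTheorem5 {α β : Type*} (K K₁ K₂ : Graph α β)
    (hK : CubicTorus.Isomorphic K CubicTorus.G1)
    (h₁ : CubicTorus.IsAddEdge K K₁) (h₂ : CubicTorus.IsAddEdge K₁ K₂)
    (hH : ¬ (CubicTorus.Isomorphic K₂ CubicTorus.H4 ∨ CubicTorus.Isomorphic K₂ CubicTorus.H5 ∨
      CubicTorus.Isomorphic K₂ CubicTorus.H6 ∨ CubicTorus.Isomorphic K₂ CubicTorus.H7 ∨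
      CubicTorus.Isomorphic K₂ CubicTorus.H8 ∨ CubicTorus.Isomorphic K₂ CubicTorus.H9)) :
    CubicTorus.Toroidal K₂ := by
  obtain ⟨A, v, es, hA, hp⟩ := CubicTorus.exists_complete_atlas hK h₁
  exact (hA.toroidal_or_isomorphic hp h₂).resolve_right hH
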